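/- **Conventions.** Let $K$ be a field. For a graded vector space $V=\bigoplus_{i\in\mathbb Z}V_i$, $V[k]$ is $V$ with the grading $V[k]_i=V_{i+k}$. Elements are homogeneous where their degrees occur. For homogeneous elements of degrees $x_1,\dots,x_n$, $\varepsilon(x_1\dots x_n;\,x_{i_1}\dots x_{i_n})$ is the Koszul sign of the rearrangement, i.e. the product of $(-1)^{x_ix_j}$ over all pairs put out of order. Let $a,b\in\mathbb Z$ and let $(\mathcal A,\cdot,[\ ,\ ],d)$ be a differential graded $(a,b)$-algebra over $K$: a graded vector space with a product of degree $a$, a bracket of degree $b$ and a map $d$ of degree $1$ such that, $|\alpha|$ being the degree in $\mathcal A$, - $\alpha\cdot\beta=(-1)^{(|\alpha|+a)(|\beta|+a)}\beta\cdot\alpha$ and $\alpha\cdot(\beta\cdot\gamma)=(\alpha\cdot\beta)\cdot\gamma$; - $[\alpha,\beta]=-(-1)^{(|\alpha|+b)(|\beta|+b)}[\beta,\alpha]$ and $(-1)^{(|\alpha|+b)(|\gamma|+b)}[[\alpha,\beta],\gamma]+(-1)^{(|\beta|+b)(|\alpha|+b)}[[\beta,\gamma],\alpha]+(-1)^{(|\gamma|+b)(|\beta|+b)}[[\gamma,\alpha],\beta]=0$;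 - $[\alpha,\beta\cdot\gamma]=[\alpha,\beta]\cdot\gamma+(-1)^{(|\beta|+a)(|\alpha|+b)}\beta\cdot[\alpha,\gamma]$; - $d^2=0$, $d(\alpha\cdot\beta)=d\alpha\cdot\beta+(-1)^{|\alpha|+a}\alpha\cdot d\beta$ and $d[\alpha,\beta]=[d\alpha,\beta]+(-1)^{|\alpha|+b}[\alpha,d\beta]$. On $\mathcal A[-a+1]$ write $\alpha$ also for the degree $|\alpha|+a-1$ of $\alpha$, and put $\mu(\alpha,\beta)=(-1)^{\alpha}\alpha\cdot\beta$ and $\ell(\alpha,\beta)=(-1)^{(b-a+1)\alpha}[\alpha,\beta]$. A $(p,q)$-shuffle is a permutation $\sigma$ of $\{1,\dots,p+q\}$ with $\sigma(1)<\dots<\sigma(p)$ and $\sigma(p+1)<\dots<\sigma(p+q)$; write $\varepsilon_\alpha(\sigma^{-1})=\varepsilon(\alpha_1\dots\alpha_{p+q};\,\alpha_{\sigma^{-1}(1)}\dots\alpha_{\sigma^{-1}(p+q)})$. Let $\mathcal H=\bigoplus_{n\ge1}\mathcal A[-a+1]^{\otimes n}/\mathrm{Sh}_n$, where $\mathrm{Sh}_n$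 is the span of all signed shuffle products $\sum_{\sigma}\varepsilon_\alpha(\sigma^{-1})\,\alpha_{\sigma^{-1}(1)}\otimes\dots\otimes\alpha_{\sigma^{-1}(n)}$ with $p+q=n$, $p,q\ge1$ and $\sigma$ running over the $(p,q)$-shuffles. Classes are written $\alpha_1\underline\otimes\cdots\underline\otimes\alpha_n$ and have degree $\alpha_1+\dots+\alpha_n$. Put $$D(\alpha_1\underline\otimes\cdots\underline\otimes\alpha_n)=\sum_{k\le n}(-1)^{\sum_{i<k}\alpha_i}\alpha_1\underline\otimes\cdots\underline\otimes d\alpha_k\underline\otimes\cdots\underline\otimes\alpha_n+\sum_{k<n}(-1)^{\sum_{i<k}\alpha_i}\alpha_1\underline\otimes\cdots\underline\otimes\mu(\alpha_k,\alpha_{k+1})\underline\otimes\cdots\underline\otimes\alpha_n$$ and, for $X=\alpha_1\underline\otimes\cdots\underline\otimes\alpha_p$ and $Y=\alpha_{p+1}\underline\otimes\cdots\underline\otimes\alpha_{p+q}$, $$\ell_2(X,Y)=\sum_{\sigma,\,k}\varepsilon_\alpha(\sigma^{-1})(-1)^{(b-a+1)\sum_{s<k}\alpha_{\sigma^{-1}(s)}}\,\alpha_{\sigma^{-1}(1)}\underline\otimes\cdots\underline\otimes\ell(\alpha_{\sigma^{-1}(k)},\alpha_{\sigma^{-1}(k+1)})\underline\otimes\cdots\underline\otimes\alpha_{\sigma^{-1}(p+q)},$$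 summed over the $(p,q)$-shuffles $\sigma$ and the $k$ with $\sigma^{-1}(k)\le p<\sigma^{-1}(k+1)$. For $X\in\mathcal H$ homogeneous, let $x'$ be its degree in $\mathcal H[a-b-1]$ and $x''=x'-1$ its degree in $\mathcal H[a-b]$, and put $\ell'_2(X,Y)=(-1)^{(a-b-1)x'}\ell_2(X,Y)$ and $\ell''_2(X,Y)=(-1)^{x''}\ell'_2(X,Y)$. For a graded space $W$ let $S^+(W)=\bigoplus_{n\ge1}S^n(W)$ be its graded symmetric space ($X\cdot Y=(-1)^{|X||Y|}Y\cdot X$), with the coproduct $\Delta(X_1\dots X_n)=\sum_{I\sqcup J=\{1,\dots,n\},\ I,J\ne\emptyset}\varepsilon(x_1\dots x_n;x_Ix_J)\,X_I\otimes X_J$. On $S^+(\mathcal H[a-b])$ put $$m(X_1\dots X_n)=\sum_i\varepsilon(x''_1\dots x''_n;\,x''_ix''_1\dots\widehat{i}\dots x''_n)\,D(X_i).X_1\dots\widehat i\dots X_n,$$ $$\ell''(X_1\dots X_n)=\sum_{i<j}\varepsilon(x''_1\dots x''_n;\,x''_ix''_jx''_1\dots\widehat{ij}\dots x''_n)\,\ell''_2(X_i,X_j).X_1\dots\widehat{ij}\dots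 X_n$$ and $Q=m+\ell''$. **Proposition.** The space $\mathcal H[a-b]$ is graded, and the operators $D,\ell_2,\ell'_2,\ell''_2$ on $\mathcal H$ and $m,\ell''$ on $S^+(\mathcal H[a-b])$ are well defined by these formulas. On $\mathcal H[a-b]$, $\ell''_2$ and $D$ have degree $1$, and for all homogeneous $X,Y,Z$: 1. $\ell''_2(X,Y)=(-1)^{x''y''}\ell''_2(Y,X)$; 2. $(-1)^{x''z''}\ell''_2(\ell''_2(X,Y),Z)+(-1)^{y''x''}\ell''_2(\ell''_2(Y,Z),X)+(-1)^{z''y''}\ell''_2(\ell''_2(Z,X),Y)=0$; 3. $D(\ell''_2(X,Y))=-\ell''_2(DX,Y)+(-1)^{1+x''}\ell''_2(X,DY)$. Consequently $m$ and $\ell''$ are coderivations of degree $1$ of $(S^+(\mathcal H[a-b]),\Delta)$ with $m\circ m=0$ and $\ell''\circ\ell''=0$, and $(S^+(\mathcal H[a-b]),\Delta,Q)$ is an $L_\infty$ algebra: $\Delta$ is well defined, of degree $0$, graded cocommutative and coassociative on the graded space $S^+(\mathcal H[a-b])$, and $Q$ has degree $1$ and satisfies $(Q\otimes id+id\otimes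 Q)\circ\Delta=\Delta\circ Q$ and $Q^2=0$. -/

import Mathlib

open scoped TensorProduct

namespace ABHomotopy

/-! ### Graded vector spaces, Koszul signs -/

section Graded

variable {K : Type*} [Field K]

/-- The shifted grading: `V[k]` is the space `V` with the grading `V[k]_i = V_{i+k}`. -/
def shift {V : Type*} [AddCommGroup V] [Module K V] (gr : ℤ → Submodule K V) (k : ℤ) :
    ℤ → Submodule K V :=
  fun i => gr (i + k)

/-- Homogeneous elements, recorded with their degree: `x.1` is the degree of `x.2`. -/
abbrev Homog {V : Type*} [AddCommGroup V] [Module K V] (gr : ℤ → Submodule K V) : Type _ :=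
  Σ i : ℤ, gr i

/-- The linear map `F` with `F (g w) = f w` for all `w`, for a family `g` that spans `M` (so that
there is at most one such map). If there is none, the value is the junk map `0`. This only
gives names to the operators that are prescribed by their values on a spanning family; that they
exist and take the prescribed values is never assumed, it is part of the conclusion of the theorem
(`WellDefined`, `IsLInfinity.coproduct_apply`), or follows, for `signTwist` and
`flip`, from the directness of the grading, which is also part of the conclusion. -/
noncomputable def linearExt {M N : Type*} [AddCommGroup M] [Module K M] [AddCommGroup N]
    [Module K N] {ι : Type*} (g : ι → M) (f : ι → N) : M →ₗ[K] N :=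
  open Classical in
  if h : ∃ F : M →ₗ[K] N, ∀ w, F (g w) = f w then h.choose else 0

theorem linearExt_apply {M N : Type*} [AddCommGroup M] [Module K M] [AddCommGroup N]
    [Module K N] {ι : Type*} {g : ι → M} {f : ι → N}
    (h : ∃ F : M →ₗ[K] N, ∀ w, F (g w) = f w) (w : ι) :
    linearExt (K := K) g f (g w) = f w := by
  unfold linearExt
  rw [dif_pos h]
  exact h.choose_spec w

/-- For a linear map `f` on a graded space and an integer `c`, the map
`X ↦ (-1)^{c |X|} f(X)` (`X` homogeneous). -/
noncomputable def signTwist {M N : Type*} [AddCommGroup M] [Module K M] [AddCommGroup N]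
    [Module K N] (gr : ℤ → Submodule K M) (c : ℤ) (f : M →ₗ[K] N) : M →ₗ[K] N :=
  linearExt (fun X : Homog gr => (X.2 : M)) (fun X => (c * X.1).negOnePow • f X.2)

/-- The graded flip `X ⊗ Y ↦ (-1)^{|X||Y|} Y ⊗ X`. -/
noncomputable def flip {M : Type*} [AddCommGroup M] [Module K M] (gr : ℤ → Submodule K M) :
    M ⊗[K] M →ₗ[K] M ⊗[K] M :=
  linearExt (fun p : Homog gr × Homog gr => (p.1.2 : M) ⊗ₜ[K] (p.2.2 : M))
    (fun p => (p.1.1 * p.2.1).negOnePow • ((p.2.2 : M) ⊗ₜ[K] (p.1.2 : M)))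

/-- The Koszul sign `ε(x_1 … x_n ; x_{i_1} … x_{i_n})` of the rearrangement of homogeneous elements
of degrees `deg 0, …, deg (n-1)` into the order `i_1, …, i_n`: each pair that
is put out of order contributes `(-1)` to the product of its degrees. -/
def koszulSign {n : ℕ} (deg : Fin n → ℤ) : List (Fin n) → ℤˣ
  | [] => 1
  | i :: l => ((l.filter (fun j => j < i)).map (fun j => (deg i * deg j).negOnePow)).prod *
      koszulSign deg l

end Graded

section Tensors

variable {K : Type*} [Field K] {V : Type*} [AddCommGroup V] [Module K V]

/-- The degrees of a word of homogeneous elements. -/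
def degs {gr : ℤ → Submodule K V} {n : ℕ} (α : Fin n → Homog gr) : Fin n → ℤ :=
  fun i => (α i).1

/-- The letters `α_{i_1}, …, α_{i_r}` of a word `α`, for a list `i_1, …, i_r` of places. -/
def letters {gr : ℤ → Submodule K V} {n : ℕ} (α : Fin n → Homog gr) (idx : List (Fin n)) :
    List V :=
  idx.map (fun i => ((α i).2 : V))

/-- The letters of `α` at the places `idx`, except that the block of `r` letters that starts at
position `k` (counted from `0`) is replaced by the single letter `x`. -/
def replaceBlock {gr : ℤ → Submodule K V} {n : ℕ} (α : Fin n → Homog gr) (idx : List (Fin n))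
    (k r : ℕ) (x : V) : List V :=
  letters α (idx.take k) ++ x :: letters α (idx.drop (k + r))

/-- The tensor `v_1 ⊗ … ⊗ v_n` in the tensor algebra of `V`. -/
noncomputable def tens (l : List V) : TensorAlgebra K V :=
  (l.map (TensorAlgebra.ι K)).prod

/-- `σ` is a `(p,q)`-shuffle: it is increasing on the first `p` and on the last `q` places. -/
def IsShuffle (p q : ℕ) (σ : Equiv.Perm (Fin (p + q))) : Prop :=
  ∀ i j : Fin (p + q), i < j → ((j : ℕ) < p ∨ p ≤ (i : ℕ)) → σ i < σ j

/-- The signed shuffle product of two tensors of homogeneous elements. With `γ` the concatenation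
of `α` and `β`, it is the sum over all shuffles `σ` of
`ε(σ⁻¹) γ_{σ⁻¹(1)} ⊗ … ⊗ γ_{σ⁻¹(p+q)}`. -/
noncomputable def bat {gr : ℤ → Submodule K V} {p q : ℕ} (α : Fin p → Homog gr)
    (β : Fin q → Homog gr) : TensorAlgebra K V :=
  open Classical in
  ∑ σ : Equiv.Perm (Fin (p + q)) with IsShuffle p q σ,
    koszulSign (degs (Fin.append α β)) (List.ofFn σ.symm) •
      tens (letters (Fin.append α β) (List.ofFn σ.symm))

/-- The subspace of the tensor algebra spanned by the scalars and by the shuffle products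
of tensors of positive length. -/
noncomputable def shuffleSubmodule (gr : ℤ → Submodule K V) : Submodule K (TensorAlgebra K V) :=
  Submodule.span K ({1} ∪ {t | ∃ (p q : ℕ) (α : Fin p → Homog gr) (β : Fin q → Homog gr),
    1 ≤ p ∧ 1 ≤ q ∧ t = bat α β})

/-- The space `⊗̲⁺ V = ⨁_{n ≥ 1} (V^{⊗ n} / ∑_{p+q=n, p,q≥1} Im bat_{p,q})`. As the tensor algebra
is the direct sum of the scalars and of the `V^{⊗ n}` with `n ≥ 1`, dividing it by the scalars
and by the shuffles gives this space. -/
abbrev Packets (gr : ℤ → Submodule K V) : Type _ :=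
  TensorAlgebra K V ⧸ shuffleSubmodule gr

/-- The class `v_1 ⊗̲ … ⊗̲ v_n` (it is zero for `n = 0`). -/
noncomputable def packet (gr : ℤ → Submodule K V) (l : List V) : Packets gr :=
  Submodule.Quotient.mk (tens l)

/-- The class `α_1 ⊗̲ … ⊗̲ α_n` of a word of homogeneous elements. -/
noncomputable def packetOf {gr : ℤ → Submodule K V} {n : ℕ} (α : Fin n → Homog gr) :
    Packets gr :=
  packet gr (letters α (List.finRange n))

/-- The grading of `⊗̲⁺ V` by the sum of the degrees of the letters. -/
noncomputable def packetGr (gr : ℤ → Submodule K V) (x : ℤ) : Submodule K (Packets gr) :=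
  Submodule.span K {X | ∃ (n : ℕ) (α : Fin n → Homog gr), ∑ i, degs α i = x ∧ X = packetOf α}

end Tensors

/-! ### The graded symmetric coalgebra and `L∞` algebras -/

section Symmetric

variable {K : Type*} [Field K] {W : Type*} [AddCommGroup W] [Module K W]

/-- The subspace of the tensor algebra spanned by the scalars and by the elements
`u ⊗ x ⊗ y ⊗ v - (-1)^{|x||y|} u ⊗ y ⊗ x ⊗ v`, where `u`, `v` are tensors and `x`, `y` are
homogeneous. -/
noncomputable def symSubmodule (gr : ℤ → Submodule K W) : Submodule K (TensorAlgebra K W) :=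
  Submodule.span K ({1} ∪ {t | ∃ (u v : List W) (x y : Homog gr),
    t = tens (u ++ (x.2 : W) :: (y.2 : W) :: v) -
      (x.1 * y.1).negOnePow • tens (u ++ (y.2 : W) :: (x.2 : W) :: v)})

/-- The graded symmetric space `S⁺(W) = ⨁_{n ≥ 1} Sⁿ(W)`: the tensor algebra without
its scalars, divided by graded commutativity. -/
abbrev SymPlus (gr : ℤ → Submodule K W) : Type _ :=
  TensorAlgebra K W ⧸ symSubmodule gr

/-- The product `X_1 … X_n` in `S⁺(W)` (it is zero for `n = 0`). -/
noncomputable def symProd (gr : ℤ → Submodule K W) (l : List W) : SymPlus gr :=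
  Submodule.Quotient.mk (tens l)

/-- The product `X_{i_1} … X_{i_r}` of homogeneous elements. -/
noncomputable def symProdOf {gr : ℤ → Submodule K W} {n : ℕ} (X : Fin n → Homog gr)
    (idx : List (Fin n)) : SymPlus gr :=
  symProd gr (letters X idx)

/-- The grading of `S⁺(W)` by the sum of the degrees of the factors. -/
noncomputable def symGr (gr : ℤ → Submodule K W) (x : ℤ) : Submodule K (SymPlus gr) :=
  Submodule.span K {s | ∃ (n : ℕ) (X : Fin n → Homog gr),
    ∑ i, degs X i = x ∧ s = symProdOf X (List.finRange n)}

/-- The elements of a set of places, in increasing order. -/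
def places {n : ℕ} (I : Finset (Fin n)) : List (Fin n) :=
  (List.finRange n).filter (fun i => i ∈ I)

/-- The value `∑_{I ⊔ J = {1..n}, I, J ≠ ∅} ε(x_1 … x_n ; x_I x_J) X_I ⊗ X_J` of the
coproduct on `X_1 … X_n`. -/
noncomputable def coproductFormula {gr : ℤ → Submodule K W} {n : ℕ} (X : Fin n → Homog gr) :
    SymPlus gr ⊗[K] SymPlus gr :=
  ∑ I : Finset (Fin n) with I ≠ ∅ ∧ Iᶜ ≠ ∅,
    koszulSign (degs X) (places I ++ places Iᶜ) •
      (symProdOf X (places I) ⊗ₜ[K] symProdOf X (places Iᶜ))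

/-- The coproduct `Δ` of `S⁺(W)`. -/
noncomputable def coproduct (gr : ℤ → Submodule K W) :
    SymPlus gr →ₗ[K] SymPlus gr ⊗[K] SymPlus gr :=
  linearExt (fun X : (Σ n : ℕ, Fin n → Homog gr) => symProdOf X.2 (List.finRange X.1))
    (fun X => coproductFormula X.2)

/-- The value `∑_i ε(x_1 … x_n ; x_i x_1 … î … x_n) D(X_i).X_1 … î … X_n` on `X_1 … X_n`
of the extension of a linear map `D`. -/
noncomputable def extendOneFormula {gr : ℤ → Submodule K W} (D : W →ₗ[K] W) {n : ℕ}
    (X : Fin n → Homog gr) : SymPlus gr :=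
  ∑ i : Fin n, koszulSign (degs X) (i :: places {i}ᶜ) •
    symProd gr (D (X i).2 :: letters X (places {i}ᶜ))

/-- The extension to `S⁺(W)` of a linear map `D` on `W`. -/
noncomputable def extendOne (gr : ℤ → Submodule K W) (D : W →ₗ[K] W) :
    SymPlus gr →ₗ[K] SymPlus gr :=
  linearExt (fun X : (Σ n : ℕ, Fin n → Homog gr) => symProdOf X.2 (List.finRange X.1))
    (fun X => extendOneFormula D X.2)

/-- The value `∑_{i<j} ε(x_1 … x_n ; x_i x_j x_1 … î … ĵ … x_n) B(X_i,X_j).X_1 … î … ĵ … X_n` on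
`X_1 … X_n` of the extension of a bilinear map `B`. -/
noncomputable def extendTwoFormula {gr : ℤ → Submodule K W} (B : W →ₗ[K] W →ₗ[K] W) {n : ℕ}
    (X : Fin n → Homog gr) : SymPlus gr :=
  ∑ i : Fin n, ∑ j : Fin n with i < j,
    koszulSign (degs X) (i :: j :: places {i, j}ᶜ) •
      symProd gr (B (X i).2 (X j).2 :: letters X (places {i, j}ᶜ))

/-- The extension to `S⁺(W)` of a bilinear map `B` on `W`. -/
noncomputable def extendTwo (gr : ℤ → Submodule K W) (B : W →ₗ[K] W →ₗ[K] W) :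
    SymPlus gr →ₗ[K] SymPlus gr :=
  linearExt (fun X : (Σ n : ℕ, Fin n → Homog gr) => symProdOf X.2 (List.finRange X.1))
    (fun X => extendTwoFormula B X.2)

/-- `F` is a coderivation of degree `1` of `(S⁺(W), Δ)`:
`(F ⊗ id + id ⊗ F) ∘ Δ = Δ ∘ F`, where `(id ⊗ F)(X ⊗ Y) = (-1)^{|X|} X ⊗ F(Y)`. -/
structure IsCoderivation (gr : ℤ → Submodule K W) (F : SymPlus gr →ₗ[K] SymPlus gr) : Prop where
  degree_one : ∀ (i : ℤ), ∀ X ∈ symGr gr i, F X ∈ symGr gr (i + 1)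
  coleibniz : (TensorProduct.map F LinearMap.id +
      TensorProduct.map (signTwist (symGr gr) 1 LinearMap.id) F) ∘ₗ coproduct gr =
    coproduct gr ∘ₗ F

/-- `(S⁺(W), Δ, Q)` is an `L∞` algebra: `S⁺(W)` is a graded space, `Δ` is well defined on it by its
formula, of degree `0`, graded cocommutative and coassociative, and `Q` is a coderivation
of degree `1` and of square zero. -/
structure IsLInfinity (gr : ℤ → Submodule K W) (Q : SymPlus gr →ₗ[K] SymPlus gr) : Prop where
  graded : DirectSum.IsInternal (symGr gr)
  coproduct_apply : ∀ (n : ℕ) (X : Fin n → Homog gr),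
    coproduct gr (symProdOf X (List.finRange n)) = coproductFormula X
  coproduct_degree : ∀ (k : ℤ), ∀ X ∈ symGr gr k, coproduct gr X ∈
    Submodule.span K {t | ∃ (i j : ℤ) (Y Z : SymPlus gr),
      Y ∈ symGr gr i ∧ Z ∈ symGr gr j ∧ i + j = k ∧ t = Y ⊗ₜ[K] Z}
  cocommutative : flip (symGr gr) ∘ₗ coproduct gr = coproduct gr
  coassociative : (TensorProduct.assoc K (SymPlus gr) (SymPlus gr) (SymPlus gr)).toLinearMap ∘ₗ
      TensorProduct.map (coproduct gr) LinearMap.id ∘ₗ coproduct gr =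
    TensorProduct.map LinearMap.id (coproduct gr) ∘ₗ coproduct gr
  coderivation : IsCoderivation gr Q
  sq_zero : Q ∘ₗ Q = 0

end Symmetric

/-! ### Differential graded `(a,b)`-algebras and the operators on `H = ⊗̲⁺ A[-a+1]` -/

/-- A differential graded `(a,b)`-algebra: a graded vector space `A` with a product of degree `a`,
a bracket of degree `b` and a differential of degree `1` such that `A[-a]` is a
graded commutative associative differential algebra, `A[-b]` is a graded Lie differential algebra,
and the bracket acts by graded derivations of the product. -/
structure DiffABAlgebra (K A : Type*) [Field K] [AddCommGroup A] [Module K A] (a b : ℤ) where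
  gr : ℤ → Submodule K A
  graded : DirectSum.IsInternal gr
  mul : A →ₗ[K] A →ₗ[K] A
  br : A →ₗ[K] A →ₗ[K] A
  d : A →ₗ[K] A
  mul_mem : ∀ {i j : ℤ} {x y : A}, x ∈ gr i → y ∈ gr j → mul x y ∈ gr (i + j + a)
  br_mem : ∀ {i j : ℤ} {x y : A}, x ∈ gr i → y ∈ gr j → br x y ∈ gr (i + j + b)
  d_mem : ∀ {i : ℤ} {x : A}, x ∈ gr i → d x ∈ gr (i + 1)
  mul_comm : ∀ {i j : ℤ} {x y : A}, x ∈ gr i → y ∈ gr j →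
    mul x y = ((i + a) * (j + a)).negOnePow • mul y x
  mul_assoc : ∀ x y z : A, mul x (mul y z) = mul (mul x y) z
  br_antisymm : ∀ {i j : ℤ} {x y : A}, x ∈ gr i → y ∈ gr j →
    br x y = -(((i + b) * (j + b)).negOnePow • br y x)
  jacobi : ∀ {i j k : ℤ} {x y z : A}, x ∈ gr i → y ∈ gr j → z ∈ gr k →
    ((i + b) * (k + b)).negOnePow • br (br x y) z +
      ((j + b) * (i + b)).negOnePow • br (br y z) x +
      ((k + b) * (j + b)).negOnePow • br (br z x) y = 0
  leibniz : ∀ {i j : ℤ} {x y : A} (z : A), x ∈ gr i → y ∈ gr j →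
    br x (mul y z) = mul (br x y) z + ((j + a) * (i + b)).negOnePow • mul y (br x z)
  d_d : ∀ x : A, d (d x) = 0
  d_mul : ∀ {i : ℤ} {x : A} (y : A), x ∈ gr i →
    d (mul x y) = mul (d x) y + (i + a).negOnePow • mul x (d y)
  d_br : ∀ {i : ℤ} {x : A} (y : A), x ∈ gr i →
    d (br x y) = br (d x) y + (i + b).negOnePow • br x (d y)

namespace DiffABAlgebra

variable {K A : Type*} [Field K] [AddCommGroup A] [Module K A] {a b : ℤ}

/-- The grading of `A[-a+1]`, that is, by `dg(α) = |α| + a - 1`. -/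
def grV (P : DiffABAlgebra K A a b) : ℤ → Submodule K A :=
  shift P.gr (-a + 1)

/-- The product `μ(α,β) = (-1)^{dg α} α.β` on `A[-a+1]`. -/
def mu (P : DiffABAlgebra K A a b) (x y : Homog P.grV) : A :=
  x.1.negOnePow • P.mul x.2 y.2

/-- The bracket `ℓ(α,β) = (-1)^{(b-a+1) dg α} [α,β]` on `A[-a+1]`. -/
def ell (P : DiffABAlgebra K A a b) (x y : Homog P.grV) : A :=
  ((b - a + 1) * x.1).negOnePow • P.br x.2 y.2

/-- The space `H = ⊗̲⁺ A[-a+1]`. -/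
abbrev H (P : DiffABAlgebra K A a b) : Type _ := Packets P.grV

/-- The value of `D = d_1 + μ_1` on `α_1 ⊗̲ … ⊗̲ α_n`. -/
noncomputable def DFormula (P : DiffABAlgebra K A a b) {n : ℕ} (α : Fin n → Homog P.grV) : P.H :=
  (∑ k : Fin n, (∑ i : Fin n with i < k, degs α i).negOnePow •
    packet P.grV (replaceBlock α (List.finRange n) k 1 (P.d (α k).2))) +
  ∑ k : Fin n, ∑ k' : Fin n with k.val + 1 = k'.val,
    (∑ i : Fin n with i < k, degs α i).negOnePow •
      packet P.grV (replaceBlock α (List.finRange n) k 2 (P.mu (α k) (α k')))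

/-- The differential `D = d_1 + μ_1` of `H`. -/
noncomputable def D (P : DiffABAlgebra K A a b) : P.H →ₗ[K] P.H :=
  linearExt (fun α : (Σ n : ℕ, Fin n → Homog P.grV) => packetOf α.2) (fun α => P.DFormula α.2)

/-- The value of `ℓ_2` on two packets. With `γ` the concatenation of `α` and `β`, it is the sum
over the `(p,q)`-shuffles `σ` and the `k` with `σ⁻¹(k) ≤ p < σ⁻¹(k+1)` of
`ε(σ⁻¹) (-1)^{(b-a+1) ∑_{s<k} γ_{σ⁻¹(s)}}
  γ_{σ⁻¹(1)} ⊗̲ … ⊗̲ ℓ(γ_{σ⁻¹(k)}, γ_{σ⁻¹(k+1)}) ⊗̲ … ⊗̲ γ_{σ⁻¹(p+q)}`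
(places are counted from `0` in the code). -/
noncomputable def ell2Formula (P : DiffABAlgebra K A a b) {p q : ℕ} (α : Fin p → Homog P.grV)
    (β : Fin q → Homog P.grV) : P.H :=
  open Classical in
  ∑ σ : Equiv.Perm (Fin (p + q)) with IsShuffle p q σ,
    ∑ k : Fin (p + q),
      ∑ k' : Fin (p + q) with
          k.val + 1 = k'.val ∧ (σ.symm k).val < p ∧ p ≤ (σ.symm k').val,
        (koszulSign (degs (Fin.append α β)) (List.ofFn σ.symm) *
          ((b - a + 1) * ∑ s : Fin (p + q) with s < k,
            degs (Fin.append α β) (σ.symm s)).negOnePow) •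
        packet P.grV (replaceBlock (Fin.append α β) (List.ofFn σ.symm) k 2
          (P.ell (Fin.append α β (σ.symm k)) (Fin.append α β (σ.symm k'))))

/-- The bracket `ℓ_2` of `H`, of degree `b - a + 1`. -/
noncomputable def ell2 (P : DiffABAlgebra K A a b) : P.H →ₗ[K] P.H →ₗ[K] P.H :=
  linearExt (fun α : (Σ n : ℕ, Fin n → Homog P.grV) => packetOf α.2) (fun α =>
    linearExt (fun β : (Σ n : ℕ, Fin n → Homog P.grV) => packetOf β.2) (fun β =>
      P.ell2Formula α.2 β.2))

/-- The grading of `H[a-b-1]`, by `x' = dg(X) - a + b + 1`. -/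
noncomputable def gr' (P : DiffABAlgebra K A a b) : ℤ → Submodule K P.H :=
  shift (packetGr P.grV) (a - b - 1)

/-- The grading of `H[a-b]`, by `x'' = dg(X) - a + b`. -/
noncomputable def gr'' (P : DiffABAlgebra K A a b) : ℤ → Submodule K P.H :=
  shift (packetGr P.grV) (a - b)

/-- The bracket `ℓ'_2(X,Y) = (-1)^{(a-b-1) x'} ℓ_2(X,Y)` of `H[a-b-1]`. -/
noncomputable def ell2' (P : DiffABAlgebra K A a b) : P.H →ₗ[K] P.H →ₗ[K] P.H :=
  signTwist P.gr' (a - b - 1) P.ell2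

/-- The bracket `ℓ''_2(X,Y) = (-1)^{x''} ℓ'_2(X,Y)` of `H[a-b]`. -/
noncomputable def ell2'' (P : DiffABAlgebra K A a b) : P.H →ₗ[K] P.H →ₗ[K] P.H :=
  signTwist P.gr'' 1 P.ell2'

/-- The operator `m` of `S⁺(H[a-b])`, which extends `D`. -/
noncomputable def m (P : DiffABAlgebra K A a b) : SymPlus P.gr'' →ₗ[K] SymPlus P.gr'' :=
  extendOne P.gr'' P.D

/-- The operator `ℓ''` of `S⁺(H[a-b])`, which extends `ℓ''_2`. -/
noncomputable def l'' (P : DiffABAlgebra K A a b) : SymPlus P.gr'' →ₗ[K] SymPlus P.gr'' :=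
  extendTwo P.gr'' P.ell2''

/-- `Q = m + ℓ''`. -/
noncomputable def Q (P : DiffABAlgebra K A a b) : SymPlus P.gr'' →ₗ[K] SymPlus P.gr'' :=
  P.m + P.l''

/-- The operators that are prescribed by a formula are well defined: `H` is a graded space, `D` and
`ℓ_2` have the prescribed values on packets, `ℓ'_2` and `ℓ''_2` are the prescribed multiples
of `ℓ_2`, and `m` and `ℓ''` have the prescribed values on products. -/
structure WellDefined (P : DiffABAlgebra K A a b) : Prop where
  graded : DirectSum.IsInternal P.gr''
  D_apply : ∀ (n : ℕ) (α : Fin n → Homog P.grV), P.D (packetOf α) = P.DFormula α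
  ell2_apply : ∀ (p q : ℕ) (α : Fin p → Homog P.grV) (β : Fin q → Homog P.grV),
    P.ell2 (packetOf α) (packetOf β) = P.ell2Formula α β
  ell2'_apply : ∀ (x' : ℤ), ∀ X ∈ P.gr' x', ∀ Y : P.H,
    P.ell2' X Y = ((a - b - 1) * x').negOnePow • P.ell2 X Y
  ell2''_apply : ∀ (x'' : ℤ), ∀ X ∈ P.gr'' x'', ∀ Y : P.H,
    P.ell2'' X Y = x''.negOnePow • P.ell2' X Y
  m_apply : ∀ (n : ℕ) (X : Fin n → Homog P.gr''),
    P.m (symProdOf X (List.finRange n)) = extendOneFormula P.D X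
  l''_apply : ∀ (n : ℕ) (X : Fin n → Homog P.gr''),
    P.l'' (symProdOf X (List.finRange n)) = extendTwoFormula P.ell2'' X

end DiffABAlgebra

end ABHomotopy

/-!
On `A[-a+1]`, with suitable sign twists, `d` and `μ` have degree one and the bracket has degree
`k + 1`, where `k = b - a`. They extend to the tensor algebra by recursion on the first letter:
`D = d + μ` is a derivation of the signed shuffle product, and the extension of the bracket is a
biderivation of it. Hence both descend to the quotient by shuffles, and there the relation
`D² = 0`, the Leibniz rule and the Jacobi identity follow by induction on words.

An operator of a graded symmetric algebra is determined by its value at `1` and its signed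
commutators with the multiplications by a letter `x`. For the extension `m` of `D` this commutator
is multiplication by `D x`, and for the extension `ℓ''` of the bracket it is the derivation
extending `ℓ''₂(x, ·)`. So `m² = 0`, `ℓ''² = 0`, `m ℓ'' + ℓ'' m = 0` and the compatibility with
`Δ` all reduce to identities on letters.
-/

namespace ABHomotopy

/-! ### Signs and linear maps on graded modules -/

section Sign

/-- The sign `(-1)^n` as a scalar. -/
def sgn (R : Type*) [Ring R] (n : ℤ) : R := ((n.negOnePow : ℤ) : R)

theorem negOnePow_smul {R M : Type*} [Ring R] [AddCommGroup M] [Module R M] (n : ℤ) (x : M) :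
    n.negOnePow • x = sgn R n • x := by
  rw [sgn, Int.cast_smul_eq_zsmul, Units.smul_def]

variable {R : Type*} [Ring R]

@[simp] theorem sgn_zero : sgn R 0 = 1 := by simp [sgn]

@[simp] theorem sgn_one : sgn R 1 = -1 := by simp [sgn]

theorem sgn_add (m n : ℤ) : sgn R (m + n) = sgn R m * sgn R n := by
  simp [sgn, Int.negOnePow_add]

@[simp] theorem sgn_neg (n : ℤ) : sgn R (-n) = sgn R n := by simp [sgn]

@[simp] theorem sgn_sub (m n : ℤ) : sgn R (m - n) = sgn R m * sgn R n := by
  rw [sub_eq_add_neg, sgn_add, sgn_neg]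

@[simp] theorem sgn_mul_sgn_self (n : ℤ) : sgn R n * sgn R n = 1 := by
  rw [← sgn_add, sgn, Int.negOnePow_even _ ⟨n, rfl⟩]; simp

@[simp] theorem sgn_sq (n : ℤ) : sgn R n ^ 2 = 1 := by rw [sq, sgn_mul_sgn_self]

@[simp] theorem sgn_pow_three (n : ℤ) : sgn R n ^ 3 = sgn R n := by
  rw [pow_succ, sgn_sq, one_mul]

@[simp] theorem sgn_pow_four (n : ℤ) : sgn R n ^ 4 = 1 := by
  rw [pow_succ, sgn_pow_three, sgn_mul_sgn_self]

@[simp] theorem sgn_mul_sgn_self_assoc (n : ℤ) (r : R) : sgn R n * (sgn R n * r) = r := by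
  rw [← mul_assoc, sgn_mul_sgn_self, one_mul]

@[simp] theorem sgn_mul_self (n : ℤ) : sgn R (n * n) = sgn R n := by
  simp [sgn, Int.negOnePow_mul_self]

@[simp] theorem sgn_mul_two (n : ℤ) : sgn R (n * 2) = 1 := by
  rw [mul_two, sgn_add, sgn_mul_sgn_self]

end Sign

section ByDegree

variable {ι R V M : Type*} [DecidableEq ι]

section Semiring

variable [Semiring R] [AddCommMonoid V] [Module R V] [AddCommMonoid M] [Module R M]
  {gr : ι → Submodule R V}

/-- The linear map on an internally graded module that is `f i` on the component of degree `i`. -/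
noncomputable def byDegree (h : DirectSum.IsInternal gr) (f : ι → V →ₗ[R] M) : V →ₗ[R] M :=
  (DirectSum.toModule R ι M fun i => (f i) ∘ₗ (gr i).subtype) ∘ₗ
    (LinearEquiv.ofBijective (DirectSum.coeLinearMap gr) h).symm.toLinearMap

theorem byDegree_apply (h : DirectSum.IsInternal gr) (f : ι → V →ₗ[R] M) {i : ι} {x : V}
    (hx : x ∈ gr i) : byDegree h f x = f i x := by
  have hsymm : (LinearEquiv.ofBijective (DirectSum.coeLinearMap gr) h).symm x =
      DirectSum.lof R ι (fun i => gr i) i ⟨x, hx⟩ := by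
    rw [LinearEquiv.symm_apply_eq]
    exact (DirectSum.coeLinearMap_lof gr i ⟨x, hx⟩).symm
  simp [byDegree, hsymm]

theorem homogeneous_induction (h : DirectSum.IsInternal gr) {p : V → Prop} (zero : p 0)
    (add : ∀ x y, p x → p y → p (x + y)) (mem : ∀ i, ∀ x ∈ gr i, p x) (x : V) : p x :=
  Submodule.iSup_induction gr (motive := p) (h.submodule_iSup_eq_top ▸ Submodule.mem_top)
    mem zero add

theorem linearMap_ext_homogeneous (h : DirectSum.IsInternal gr) {f g : V →ₗ[R] M}
    (hfg : ∀ i, ∀ x ∈ gr i, f x = g x) : f = g :=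
  LinearMap.ext <| homogeneous_induction h (by simp)
    (fun x y hx hy => by rw [map_add, map_add, hx, hy]) hfg

end Semiring

theorem isInternal_of_projections [Ring R] [AddCommGroup V] [Module R V] {gr : ι → Submodule R V}
    (p : ι → V →ₗ[R] V) (hp : ∀ i, ∀ x ∈ gr i, p i x = x)
    (hp' : ∀ i j, i ≠ j → ∀ x ∈ gr i, p j x = 0) (hgr : ⨆ i, gr i = ⊤) :
    DirectSum.IsInternal gr := by
  rw [DirectSum.isInternal_submodule_iff_iSupIndep_and_iSup_eq_top]
  refine ⟨fun i => Submodule.disjoint_def.2 fun x hx hx' => ?_, hgr⟩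
  have hker : (⨆ j, ⨆ (_ : j ≠ i), gr j) ≤ LinearMap.ker (p i) :=
    iSup₂_le fun j hj y hy => hp' j i hj y hy
  rw [← hp i x hx]
  exact hker hx'

end ByDegree

section SignMap

variable {R V : Type*} [CommRing R] [AddCommGroup V] [Module R V] {gr : ℤ → Submodule R V}

/-- The map `X ↦ (-1)^{c |X|} X` of a graded module. -/
noncomputable def signMap (h : DirectSum.IsInternal gr) (c : ℤ) : V →ₗ[R] V :=
  byDegree h fun i => sgn R (c * i) • LinearMap.id

theorem signMap_apply (h : DirectSum.IsInternal gr) (c : ℤ) {i : ℤ} {x : V} (hx : x ∈ gr i) :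
    signMap h c x = sgn R (c * i) • x := by
  simp [signMap, byDegree_apply h _ hx]

theorem signMap_map_of_degree {M : Type*} [AddCommGroup M] [Module R M]
    {gr' : ℤ → Submodule R M} (h : DirectSum.IsInternal gr) (h' : DirectSum.IsInternal gr')
    {f : V →ₗ[R] M} {e : ℤ}
    (hf : ∀ n, ∀ X ∈ gr n, f X ∈ gr' (n + e)) (c : ℤ) (X : V) :
    signMap h' c (f X) = sgn R (c * e) • f (signMap h c X) := by
  suffices signMap h' c ∘ₗ f = sgn R (c * e) • f ∘ₗ signMap h c from congr($this X)
  refine linearMap_ext_homogeneous h fun n X hX => ?_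
  simp only [LinearMap.comp_apply, LinearMap.smul_apply, signMap_apply h' c (hf n X hX),
    signMap_apply h c hX, map_smul, smul_smul, mul_add, sgn_add, mul_comm]

theorem signMap_signMap_comm (h : DirectSum.IsInternal gr) (c c' : ℤ) (X : V) :
    signMap h c (signMap h c' X) = signMap h c' (signMap h c X) := by
  simpa using signMap_map_of_degree (f := signMap h c') (e := 0) h h
    (fun n X hX => by simpa [signMap_apply h c' hX] using Submodule.smul_mem _ _ hX) c X

theorem signMap_add (h : DirectSum.IsInternal gr) (c c' : ℤ) (X : V) :
    signMap h (c + c') X = signMap h c (signMap h c' X) := by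
  suffices signMap h (c + c') = signMap h c ∘ₗ signMap h c' from congr($this X)
  refine linearMap_ext_homogeneous h fun n X hX => ?_
  simp only [LinearMap.comp_apply, signMap_apply h _ hX, map_smul, smul_smul, add_mul, sgn_add]
  rw [mul_comm]

end SignMap

section LinearExt

variable {K V M : Type*} [Field K] [AddCommGroup V] [Module K V] [AddCommGroup M] [Module K M]

theorem linearExt_eq {ι : Type*} {g : ι → V} {f : ι → M}
    (hg : Submodule.span K (Set.range g) = ⊤) (F : V →ₗ[K] M) (hF : ∀ w, F (g w) = f w) :
    linearExt g f = F := by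
  refine LinearMap.ext_on hg ?_
  rintro _ ⟨w, rfl⟩
  rw [linearExt_apply ⟨F, hF⟩ w, hF]

variable {gr : ℤ → Submodule K V}

theorem isInternal_shift (h : DirectSum.IsInternal gr) (k : ℤ) :
    DirectSum.IsInternal (shift gr k) := by
  rw [DirectSum.isInternal_submodule_iff_iSupIndep_and_iSup_eq_top] at h ⊢
  refine ⟨h.1.comp (add_left_injective k), ?_⟩
  rw [← h.2]
  exact (Equiv.addRight k).iSup_comp (g := gr)

theorem span_range_homog (h : DirectSum.IsInternal gr) :
    Submodule.span K (Set.range fun x : Homog gr => (x.2 : V)) = ⊤ := by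
  rw [eq_top_iff, ← h.submodule_iSup_eq_top]
  exact iSup_le fun i x hx => Submodule.subset_span ⟨⟨i, x, hx⟩, rfl⟩

theorem signTwist_eq (h : DirectSum.IsInternal gr) (c : ℤ) (f : V →ₗ[K] M) :
    signTwist gr c f = f ∘ₗ signMap h c :=
  linearExt_eq (span_range_homog h) _ fun X => by
    simp [signMap_apply h c X.2.2, negOnePow_smul (R := K)]

end LinearExt

/-! ### Recursion on tensors -/

section TensorRecursion

variable {R V M : Type*} [CommRing R] [AddCommGroup V] [Module R V] [AddCommGroup M] [Module R M]

/-- Left multiplication of tensors by letters, `(x, t) ↦ x ⊗ t`. -/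
noncomputable def leftMul (R : Type*) {V : Type*} [CommRing R] [AddCommGroup V] [Module R V] :
    V →ₗ[R] TensorAlgebra R V →ₗ[R] TensorAlgebra R V :=
  LinearMap.mul R (TensorAlgebra R V) ∘ₗ TensorAlgebra.ι R

@[simp] theorem leftMul_apply (x : V) (t : TensorAlgebra R V) :
    leftMul R x t = TensorAlgebra.ι R x * t := rfl

@[elab_as_elim]
theorem tensor_induction {p : TensorAlgebra R V → Prop} (one : p 1)
    (add : ∀ s t, p s → p t → p (s + t)) (smul : ∀ (r : R) t, p t → p (r • t))
    (ι_mul : ∀ x t, p t → p (TensorAlgebra.ι R x * t)) (t : TensorAlgebra R V) : p t := by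
  have mul_closed : ∀ s t : TensorAlgebra R V, p t → p (s * t) := by
    intro s
    induction s using TensorAlgebra.induction with
    | algebraMap r => intro t ht; rw [← Algebra.smul_def]; exact smul r t ht
    | ι x => exact ι_mul x
    | mul a b ha hb => intro t ht; rw [mul_assoc]; exact ha _ (hb _ ht)
    | add a b ha hb => intro t ht; rw [add_mul]; exact add _ _ (ha _ ht) (hb _ ht)
  simpa using mul_closed t 1 one

/-- The linear map `F` on tensors with `F 1 = m` and `F (x ⊗ t) = g x (F t)`. -/
noncomputable def tensorFoldr (g : V →ₗ[R] M →ₗ[R] M) (m : M) : TensorAlgebra R V →ₗ[R] M :=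
  LinearMap.applyₗ m ∘ₗ (TensorAlgebra.lift R (A := Module.End R M) g).toLinearMap

@[simp] theorem tensorFoldr_one (g : V →ₗ[R] M →ₗ[R] M) (m : M) : tensorFoldr g m 1 = m := by
  simp [tensorFoldr]

@[simp] theorem tensorFoldr_ι_mul (g : V →ₗ[R] M →ₗ[R] M) (m : M) (x : V)
    (t : TensorAlgebra R V) :
    tensorFoldr g m (TensorAlgebra.ι R x * t) = g x (tensorFoldr g m t) := by
  simp [tensorFoldr]

variable (ρ : V →ₗ[R] M →ₗ[R] M) (q : M × (V →ₗ[R] TensorAlgebra R V →ₗ[R] M))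

/-- The step `(t, y) ↦ (x ⊗ t, ρ x y + G x t)` of the recursion `tensorRec`. -/
noncomputable def tensorRecStep (G : V →ₗ[R] TensorAlgebra R V →ₗ[R] M) :
    V →ₗ[R] (TensorAlgebra R V × M) →ₗ[R] (TensorAlgebra R V × M) :=
  LinearMap.mk₂ R (fun x s => (TensorAlgebra.ι R x * s.1, ρ x s.2 + G x s.1))
    (fun x y s => by ext <;> simp [add_mul]; abel) (fun r x s => by ext <;> simp)
    (fun x s s' => by ext <;> simp [mul_add]; abel) (fun r x s => by ext <;> simp)

theorem tensorRecStep_apply (G : V →ₗ[R] TensorAlgebra R V →ₗ[R] M) (x : V)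
    (s : TensorAlgebra R V × M) :
    tensorRecStep ρ G x s = (TensorAlgebra.ι R x * s.1, ρ x s.2 + G x s.1) := rfl

/-- The underlying map of `tensorRec`. -/
noncomputable def tensorRecAux : TensorAlgebra R V →ₗ[R] M :=
  LinearMap.snd R _ _ ∘ₗ tensorFoldr (tensorRecStep ρ q.2) (1, q.1)

theorem tensorRecAux_one : tensorRecAux ρ q 1 = q.1 := by simp [tensorRecAux]

theorem tensorRecAux_ι_mul (x : V) (t : TensorAlgebra R V) :
    tensorRecAux ρ q (TensorAlgebra.ι R x * t) = ρ x (tensorRecAux ρ q t) + q.2 x t := by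
  have fst_eq (t : TensorAlgebra R V) : (tensorFoldr (tensorRecStep ρ q.2) (1, q.1) t).1 = t := by
    induction t using tensor_induction with
    | one => simp
    | add s t hs ht => simp [hs, ht]
    | smul r t ht => simp [ht]
    | ι_mul x t ht => simp [tensorRecStep_apply, ht]
  simp [tensorRecAux, tensorRecStep_apply, fst_eq]

variable {ρ q} in
theorem eq_tensorRecAux {F : TensorAlgebra R V →ₗ[R] M} (one : F 1 = q.1)
    (ι_mul : ∀ x t, F (TensorAlgebra.ι R x * t) = ρ x (F t) + q.2 x t) :
    F = tensorRecAux ρ q := by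
  ext t
  induction t using tensor_induction with
  | one => rw [one, tensorRecAux_one]
  | add s t hs ht => rw [map_add, map_add, hs, ht]
  | smul r t ht => rw [map_smul, map_smul, ht]
  | ι_mul x t ht => rw [ι_mul, tensorRecAux_ι_mul, ht]

/-- The linear map `F` on tensors with `F 1 = m` and `F (x ⊗ t) = ρ x (F t) + G x t`. It depends
linearly on the pair `(m, G)`. -/
noncomputable def tensorRec :
    (M × (V →ₗ[R] TensorAlgebra R V →ₗ[R] M)) →ₗ[R] TensorAlgebra R V →ₗ[R] M where
  toFun := tensorRecAux ρ
  map_add' q q' := .symm <| eq_tensorRecAux (by simp [tensorRecAux_one])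
    fun x t => by simp [tensorRecAux_ι_mul]; abel
  map_smul' r q := .symm <| eq_tensorRecAux (by simp [tensorRecAux_one])
    fun x t => by simp [tensorRecAux_ι_mul]

@[simp] theorem tensorRec_one : tensorRec ρ q 1 = q.1 := tensorRecAux_one ρ q

@[simp] theorem tensorRec_ι_mul (x : V) (t : TensorAlgebra R V) :
    tensorRec ρ q (TensorAlgebra.ι R x * t) = ρ x (tensorRec ρ q t) + q.2 x t :=
  tensorRecAux_ι_mul ρ q x t

end TensorRecursion

section Words

variable {K V M : Type*} [Field K] [AddCommGroup V] [Module K V] [AddCommGroup M] [Module K M]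
  {gr : ℤ → Submodule K V}

/-- The tensor of a word of homogeneous letters. -/
noncomputable def word (l : List (Homog gr)) : TensorAlgebra K V :=
  tens (l.map fun x => (x.2 : V))

/-- The degree of a word of homogeneous letters. -/
def wordDegree (l : List (Homog gr)) : ℤ := (l.map fun x => x.1).sum

@[simp] theorem tens_cons (x : V) (l : List V) :
    tens (x :: l) = TensorAlgebra.ι K x * tens l := by simp [tens]

@[simp] theorem word_nil : word ([] : List (Homog gr)) = 1 := rfl

@[simp] theorem word_cons (x : Homog gr) (l : List (Homog gr)) :
    word (x :: l) = TensorAlgebra.ι K (x.2 : V) * word l := by simp [word]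

@[simp] theorem wordDegree_nil : wordDegree ([] : List (Homog gr)) = 0 := rfl

@[simp] theorem wordDegree_cons (x : Homog gr) (l : List (Homog gr)) :
    wordDegree (x :: l) = x.1 + wordDegree l := by simp [wordDegree]

variable (gr) in
/-- The grading of the tensor algebra by the sum of the degrees of the letters. -/
def tensorGr (n : ℤ) : Submodule K (TensorAlgebra K V) :=
  Submodule.span K {t | ∃ l : List (Homog gr), wordDegree l = n ∧ t = word l}

theorem word_mem_tensorGr (l : List (Homog gr)) : word l ∈ tensorGr gr (wordDegree l) :=
  Submodule.subset_span ⟨l, rfl, rfl⟩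

theorem mem_tensorGr_congr {m n : ℤ} {X : TensorAlgebra K V} (hX : X ∈ tensorGr gr m)
    (e : m = n) : X ∈ tensorGr gr n := e ▸ hX

theorem map_mem_of_mem_tensorGr {F : TensorAlgebra K V →ₗ[K] M} {N : Submodule K M} {n : ℤ}
    (hF : ∀ l : List (Homog gr), wordDegree l = n → F (word l) ∈ N) {t : TensorAlgebra K V}
    (ht : t ∈ tensorGr gr n) : F t ∈ N := by
  have hle : tensorGr gr n ≤ N.comap F := Submodule.span_le.2 <| by
    rintro _ ⟨l, hl, rfl⟩
    exact hF l hl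
  exact hle ht

theorem eqOn_tensorGr {F G : TensorAlgebra K V →ₗ[K] M} {n : ℤ}
    (hFG : ∀ l : List (Homog gr), wordDegree l = n → F (word l) = G (word l))
    {t : TensorAlgebra K V} (ht : t ∈ tensorGr gr n) : F t = G t := by
  refine LinearMap.eqOn_span
    (s := {t | ∃ l : List (Homog gr), wordDegree l = n ∧ t = word l}) ?_ ht
  rintro _ ⟨l, hl, rfl⟩
  exact hFG l hl

theorem eqOn_tensorGr₂ {F G : TensorAlgebra K V →ₗ[K] TensorAlgebra K V →ₗ[K] M} {m n : ℤ}
    (hFG : ∀ u v : List (Homog gr), wordDegree u = m → wordDegree v = n →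
      F (word u) (word v) = G (word u) (word v))
    {X Y : TensorAlgebra K V} (hX : X ∈ tensorGr gr m) (hY : Y ∈ tensorGr gr n) :
    F X Y = G X Y :=
  eqOn_tensorGr (F := F.flip Y) (G := G.flip Y)
    (fun u hu => eqOn_tensorGr (fun v hv => hFG u v hu hv) hY) hX

theorem map₂_mem_tensorGr
    {F : TensorAlgebra K V →ₗ[K] TensorAlgebra K V →ₗ[K] TensorAlgebra K V} {c : ℤ}
    (hF : ∀ u v : List (Homog gr),
      F (word u) (word v) ∈ tensorGr gr (wordDegree u + wordDegree v + c))
    {m n : ℤ} {X Y : TensorAlgebra K V} (hX : X ∈ tensorGr gr m) (hY : Y ∈ tensorGr gr n) :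
    F X Y ∈ tensorGr gr (m + n + c) := by
  refine map_mem_of_mem_tensorGr (F := F.flip Y) ?_ hX
  rintro u rfl
  refine map_mem_of_mem_tensorGr (F := F (word u)) ?_ hY
  rintro v rfl
  exact hF u v

theorem ι_mul_mem_tensorGr {i n : ℤ} {x : V} {t : TensorAlgebra K V} (hx : x ∈ gr i)
    (ht : t ∈ tensorGr gr n) : TensorAlgebra.ι K x * t ∈ tensorGr gr (i + n) := by
  refine map_mem_of_mem_tensorGr (F := leftMul K x) (fun l hl => ?_) ht
  exact Submodule.subset_span ⟨⟨i, x, hx⟩ :: l, by simp [hl], by simp⟩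

theorem span_range_word (h : DirectSum.IsInternal gr) :
    Submodule.span K (Set.range (word (gr := gr))) = ⊤ := by
  rw [Submodule.eq_top_iff']
  intro t
  induction t using tensor_induction with
  | one => exact Submodule.subset_span ⟨[], rfl⟩
  | add s t hs ht => exact add_mem hs ht
  | smul r t ht => exact Submodule.smul_mem _ _ ht
  | ι_mul x t ht =>
    induction x using homogeneous_induction h with
    | zero => simp
    | add x y hx hy => rw [map_add, add_mul]; exact add_mem hx hy
    | mem i x hx =>
      have hle : Submodule.span K (Set.range (word (gr := gr))) ≤
          (Submodule.span K (Set.range (word (gr := gr)))).comap (leftMul K x) := by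
        refine Submodule.span_le.2 ?_
        rintro _ ⟨l, rfl⟩
        exact Submodule.subset_span ⟨⟨i, x, hx⟩ :: l, by simp⟩
      exact hle ht

theorem linearMap_ext_word (h : DirectSum.IsInternal gr) {F G : TensorAlgebra K V →ₗ[K] M}
    (hFG : ∀ l : List (Homog gr), F (word l) = G (word l)) : F = G := by
  refine LinearMap.ext_on (span_range_word h) ?_
  rintro _ ⟨l, rfl⟩
  exact hFG l

theorem iSup_tensorGr (h : DirectSum.IsInternal gr) : ⨆ n, tensorGr gr n = ⊤ := by
  rw [eq_top_iff, ← span_range_word h, Submodule.span_le]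
  rintro _ ⟨l, rfl⟩
  exact Submodule.mem_iSup_of_mem _ (word_mem_tensorGr l)

/-- The family of the homogeneous components of a tensor. -/
noncomputable def tensorComponents (h : DirectSum.IsInternal gr) :
    TensorAlgebra K V →ₗ[K] (ℤ → TensorAlgebra K V) :=
  tensorFoldr (byDegree h fun i => LinearMap.mk₂ K
      (fun x f n => TensorAlgebra.ι K x * f (n - i))
      (fun x y f => by ext; simp [add_mul]) (fun r x f => by ext; simp)
      (fun x f g => by ext; simp [mul_add]) (fun r x f => by ext; simp))
    (Pi.single 0 1)

theorem tensorComponents_word (h : DirectSum.IsInternal gr) (l : List (Homog gr)) :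
    tensorComponents h (word l) = Pi.single (wordDegree l) (word l) := by
  induction l with
  | nil => simp [tensorComponents]
  | cons x l ih =>
    rw [tensorComponents] at ih ⊢
    rw [word_cons, tensorFoldr_ι_mul, ih, byDegree_apply h _ x.2.2]
    ext n
    by_cases hn : n = x.1 + wordDegree l
    · subst hn; simp
    · have hn' : n - x.1 ≠ wordDegree l := by omega
      simp [hn, hn']

theorem tensorComponents_of_mem (h : DirectSum.IsInternal gr) {n : ℤ} {t : TensorAlgebra K V}
    (ht : t ∈ tensorGr gr n) : tensorComponents h t = Pi.single n t :=
  eqOn_tensorGr (G := LinearMap.single K (fun _ => TensorAlgebra K V) n)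
    (fun l hl => by rw [tensorComponents_word, hl]; rfl) ht

theorem isInternal_map_mkQ_tensorGr (h : DirectSum.IsInternal gr) {S : Set (TensorAlgebra K V)}
    (hS : ∀ r ∈ S, ∃ n, r ∈ tensorGr gr n) :
    DirectSum.IsInternal fun n => (tensorGr gr n).map (Submodule.span K S).mkQ := by
  have hker : ∀ i, Submodule.span K S ≤
      LinearMap.ker ((Submodule.span K S).mkQ ∘ₗ LinearMap.proj i ∘ₗ tensorComponents h) := by
    refine fun i => Submodule.span_le.2 fun r hr => ?_
    obtain ⟨n, hn⟩ := hS r hr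
    by_cases hi : i = n
    · subst hi
      simpa [tensorComponents_of_mem h hn] using Submodule.subset_span hr
    · simp [tensorComponents_of_mem h hn, hi]
  refine isInternal_of_projections (fun i => Submodule.liftQ _ _ (hker i)) ?_ ?_ ?_
  · rintro i _ ⟨t, ht, rfl⟩
    simp [tensorComponents_of_mem h ht]
  · rintro i j hij _ ⟨t, ht, rfl⟩
    simp [tensorComponents_of_mem h ht, hij.symm]
  · rw [← Submodule.map_iSup, iSup_tensorGr h, Submodule.map_top, Submodule.range_mkQ]

theorem isInternal_tensorGr (h : DirectSum.IsInternal gr) : DirectSum.IsInternal (tensorGr gr) :=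
  isInternal_of_projections (fun i => LinearMap.proj i ∘ₗ tensorComponents h)
    (fun i t ht => by simp [tensorComponents_of_mem h ht])
    (fun i j hij t ht => by simp [tensorComponents_of_mem h ht, hij.symm]) (iSup_tensorGr h)

end Words

/-! ### The signed shuffle product -/

section ShuffleProduct

variable {K V : Type*} [Field K] [AddCommGroup V] [Module K V] {gr : ℤ → Submodule K V}
  (h : DirectSum.IsInternal gr)

/-- For a letter `b` of degree `j` and a map `φ = (X ↦ X ⧢ Y)`, the map `X ↦ X ⧢ (b ⊗ Y)`. -/
noncomputable def shuffleStep (j : ℤ) :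
    V →ₗ[K] (TensorAlgebra K V →ₗ[K] TensorAlgebra K V) →ₗ[K]
      (TensorAlgebra K V →ₗ[K] TensorAlgebra K V) :=
  LinearMap.mk₂ K (fun b φ => tensorRec (leftMul K) (TensorAlgebra.ι K b * φ 1,
      (leftMul K).compr₂ (leftMul K b ∘ₗ φ ∘ₗ signMap (isInternal_tensorGr h) j)))
    (fun b b' φ => by rw [← map_add]; congr 1; ext <;> simp [add_mul])
    (fun r b φ => by rw [← map_smul]; congr 1; ext <;> simp)
    (fun b φ φ' => by rw [← map_add]; congr 1; ext <;> simp [mul_add])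
    (fun r b φ => by rw [← map_smul]; congr 1; ext <;> simp)

/-- The signed shuffle product of tensors, defined by the recursion `shuffleProd_cons`. -/
noncomputable def shuffleProd :
    TensorAlgebra K V →ₗ[K] TensorAlgebra K V →ₗ[K] TensorAlgebra K V :=
  (tensorFoldr (byDegree h (shuffleStep h)) LinearMap.id).flip

@[simp] theorem shuffleProd_one_right (X : TensorAlgebra K V) : shuffleProd h X 1 = X := by
  simp [shuffleProd]

@[simp] theorem shuffleProd_one_left (Y : TensorAlgebra K V) : shuffleProd h 1 Y = Y := by
  suffices shuffleProd h 1 = LinearMap.id by rw [this, LinearMap.id_apply]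
  refine linearMap_ext_word h fun l => ?_
  induction l with
  | nil => simp
  | cons x l ih =>
    simp only [shuffleProd, LinearMap.flip_apply] at ih
    simp [shuffleProd, byDegree_apply h _ x.2.2, shuffleStep, ih]

theorem shuffleProd_cons {i m j : ℤ} {a b : V} {X : TensorAlgebra K V} (ha : a ∈ gr i)
    (hX : X ∈ tensorGr gr m) (hb : b ∈ gr j) (Y : TensorAlgebra K V) :
    shuffleProd h (TensorAlgebra.ι K a * X) (TensorAlgebra.ι K b * Y) =
      TensorAlgebra.ι K a * shuffleProd h X (TensorAlgebra.ι K b * Y) +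
        sgn K (j * (i + m)) •
          (TensorAlgebra.ι K b * shuffleProd h (TensorAlgebra.ι K a * X) Y) := by
  simp [shuffleProd, byDegree_apply h _ hb, shuffleStep,
    signMap_apply _ _ (ι_mul_mem_tensorGr ha hX)]

theorem shuffleProd_mem {m n : ℤ} {X Y : TensorAlgebra K V} (hX : X ∈ tensorGr gr m)
    (hY : Y ∈ tensorGr gr n) : shuffleProd h X Y ∈ tensorGr gr (m + n) := by
  rw [← add_zero (m + n)]
  refine map₂_mem_tensorGr (fun u v => ?_) hX hY
  rw [add_zero]
  induction u generalizing v with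
  | nil => simpa using word_mem_tensorGr v
  | cons a u ihu =>
    induction v with
    | nil => simpa using word_mem_tensorGr (a :: u)
    | cons b v ihv =>
      rw [word_cons, word_cons, shuffleProd_cons h a.2.2 (word_mem_tensorGr u) b.2.2,
        ← word_cons, ← word_cons]
      refine add_mem ?_ (Submodule.smul_mem _ _ ?_)
      · exact mem_tensorGr_congr (ι_mul_mem_tensorGr a.2.2 (ihu (b :: v))) (by simp; ring)
      · exact mem_tensorGr_congr (ι_mul_mem_tensorGr b.2.2 ihv) (by simp; ring)

theorem shuffleProd_word_comm (u v : List (Homog gr)) :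
    shuffleProd h (word u) (word v) =
      sgn K (wordDegree u * wordDegree v) • shuffleProd h (word v) (word u) := by
  induction u generalizing v with
  | nil => simp
  | cons a u ihu =>
    induction v with
    | nil => simp
    | cons b v ihv =>
      have ihu := ihu (b :: v)
      simp only [word_cons, wordDegree_cons] at ihu ihv ⊢
      rw [shuffleProd_cons h a.2.2 (word_mem_tensorGr u) b.2.2,
        shuffleProd_cons h b.2.2 (word_mem_tensorGr v) a.2.2, ihu, ihv]
      simp only [mul_smul_comm, smul_add, smul_smul]
      match_scalars <;>
        simp [sgn_add, mul_add, mul_comm, mul_left_comm, mul_assoc]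

theorem shuffleProd_comm {m n : ℤ} {X Y : TensorAlgebra K V} (hX : X ∈ tensorGr gr m)
    (hY : Y ∈ tensorGr gr n) : shuffleProd h X Y = sgn K (m * n) • shuffleProd h Y X := by
  refine eqOn_tensorGr₂ (G := sgn K (m * n) • (shuffleProd h).flip) ?_ hX hY
  rintro u v rfl rfl
  simpa using shuffleProd_word_comm h u v

theorem shuffleProd_word_assoc (u v w : List (Homog gr)) :
    shuffleProd h (shuffleProd h (word u) (word v)) (word w) =
      shuffleProd h (word u) (shuffleProd h (word v) (word w)) := by
  induction u generalizing v w with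
  | nil => simp
  | cons a u ihu =>
    induction v generalizing w with
    | nil => simp
    | cons b v ihv =>
      induction w with
      | nil => simp
      | cons c w ihw =>
        have ihu := congrArg (leftMul K (a.2 : V)) (ihu (b :: v) (c :: w))
        have ihv := congrArg (leftMul K (b.2 : V)) (ihv (c :: w))
        have ihw := congrArg (leftMul K (c.2 : V)) ihw
        have hu := word_mem_tensorGr u
        have hv := word_mem_tensorGr v
        have hau := ι_mul_mem_tensorGr a.2.2 hu
        have hbv := ι_mul_mem_tensorGr b.2.2 hv
        simp only [word_cons, leftMul_apply, shuffleProd_cons h a.2.2 hu b.2.2,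
          shuffleProd_cons h b.2.2 hv c.2.2, map_add, map_smul, LinearMap.add_apply,
          LinearMap.smul_apply, shuffleProd_cons h a.2.2 (shuffleProd_mem h hu hbv) c.2.2,
          shuffleProd_cons h b.2.2 (shuffleProd_mem h hau hv) c.2.2,
          shuffleProd_cons h a.2.2 hu c.2.2, mul_add, smul_add] at ihu ihv ihw ⊢
        linear_combination (norm := skip) ihu + sgn K (b.1 * (a.1 + wordDegree u)) • ihv +
          sgn K (c.1 * (a.1 + wordDegree u + b.1 + wordDegree v)) • ihw
        match_scalars <;>
          simp [sgn_add, mul_add, mul_comm, mul_left_comm, mul_assoc]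

theorem shuffleProd_assoc (X Y Z : TensorAlgebra K V) :
    shuffleProd h (shuffleProd h X Y) Z = shuffleProd h X (shuffleProd h Y Z) := by
  have hassoc : (shuffleProd h).compr₂ (shuffleProd h) =
      (LinearMap.llcomp K _ _ _).flip (shuffleProd h) ∘ₗ (LinearMap.llcomp K _ _ _) ∘ₗ
        shuffleProd h :=
    linearMap_ext_word h fun u => linearMap_ext_word h fun v => linearMap_ext_word h fun w =>
      shuffleProd_word_assoc h u v w
  exact congr($hassoc X Y Z)

theorem shuffleProd_word_right_comm (u v w : List (Homog gr)) :
    shuffleProd h (shuffleProd h (word u) (word v)) (word w) =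
      sgn K (wordDegree v * wordDegree w) •
        shuffleProd h (shuffleProd h (word u) (word w)) (word v) := by
  rw [shuffleProd_assoc, shuffleProd_word_comm h v, map_smul, shuffleProd_assoc]

theorem shuffleProd_word_rotate (u v w : List (Homog gr)) :
    shuffleProd h (shuffleProd h (word u) (word v)) (word w) =
      sgn K ((wordDegree u + wordDegree v) * wordDegree w) •
        shuffleProd h (shuffleProd h (word w) (word u)) (word v) := by
  rw [shuffleProd_comm h (shuffleProd_mem h (word_mem_tensorGr u) (word_mem_tensorGr v))
    (word_mem_tensorGr w), shuffleProd_assoc]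

end ShuffleProduct

/-! ### The differential and the bracket of tensors -/

/-- A graded space with a differential `d`, a product `μ` of degree `1` and a bracket `β` that has
degree `1` for the grading shifted by `k`. This is what a differential graded `(a,b)`-algebra `A`
becomes on the letters `A[-a+1]`, with `k = b - a`: the signs are those for which `d + μ` and `β`
extend to words as a differential and a bracket of degree `1`. -/
structure ShiftedABAlgebra {K V : Type*} [Field K] [AddCommGroup V] [Module K V]
    (gr : ℤ → Submodule K V) (k : ℤ) where
  graded : DirectSum.IsInternal gr
  d : V →ₗ[K] V
  μ : V →ₗ[K] V →ₗ[K] V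
  β : V →ₗ[K] V →ₗ[K] V
  d_mem : ∀ {i : ℤ} {x : V}, x ∈ gr i → d x ∈ gr (i + 1)
  μ_mem : ∀ {i j : ℤ} {x y : V}, x ∈ gr i → y ∈ gr j → μ x y ∈ gr (i + j + 1)
  β_mem : ∀ {i j : ℤ} {x y : V}, x ∈ gr i → y ∈ gr j → β x y ∈ gr (i + j + k + 1)
  d_d : ∀ x : V, d (d x) = 0
  μ_comm : ∀ {i j : ℤ} {x y : V}, x ∈ gr i → y ∈ gr j → μ x y = -(sgn K (i * j) • μ y x)
  μ_assoc : ∀ {i : ℤ} {x : V} (y z : V), x ∈ gr i → μ (μ x y) z = -(sgn K i • μ x (μ y z))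
  d_μ : ∀ {i : ℤ} {x : V} (y : V), x ∈ gr i → d (μ x y) = -μ (d x) y - sgn K i • μ x (d y)
  β_comm : ∀ {i j : ℤ} {x y : V}, x ∈ gr i → y ∈ gr j →
    β x y = sgn K ((i + k) * (j + k)) • β y x
  d_β : ∀ {i : ℤ} {x : V} (y : V), x ∈ gr i →
    d (β x y) = -β (d x) y - sgn K (i + k) • β x (d y)
  β_μ : ∀ {i j : ℤ} {x y : V} (z : V), x ∈ gr i → y ∈ gr j →
    β x (μ y z) = sgn K (i + k + 1) • μ (β x y) z + sgn K ((j + 1) * (i + k + 1)) • μ y (β x z)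
  jacobi : ∀ {i j l : ℤ} {x y z : V}, x ∈ gr i → y ∈ gr j → z ∈ gr l →
    sgn K ((i + k) * (l + k)) • β (β x y) z + sgn K ((j + k) * (i + k)) • β (β y z) x +
      sgn K ((l + k) * (j + k)) • β (β z x) y = 0

namespace ShiftedABAlgebra

variable {K V : Type*} [Field K] [AddCommGroup V] [Module K V] {gr : ℤ → Submodule K V} {k : ℤ}
  (O : ShiftedABAlgebra gr k)

/-- Multiplication of the first letter of a tensor by a letter, `(a, b ⊗ X) ↦ μ(a, b) ⊗ X`. -/
noncomputable def merge : V →ₗ[K] TensorAlgebra K V →ₗ[K] TensorAlgebra K V :=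
  (tensorRec 0 ∘ₗ LinearMap.inr K _ _ ∘ₗ LinearMap.llcomp K _ _ _ (leftMul K)) ∘ₗ O.μ

@[simp] theorem merge_one (a : V) : O.merge a 1 = 0 := by simp [merge]

@[simp] theorem merge_ι_mul (a b : V) (X : TensorAlgebra K V) :
    O.merge a (TensorAlgebra.ι K b * X) = TensorAlgebra.ι K (O.μ a b) * X := by simp [merge]

/-- The differential of the tensor algebra that is induced by `d` and `μ`. -/
noncomputable def tensorD : TensorAlgebra K V →ₗ[K] TensorAlgebra K V :=
  tensorRec (leftMul K ∘ₗ signMap O.graded 1) (0, leftMul K ∘ₗ O.d + O.merge)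

@[simp] theorem tensorD_one : O.tensorD 1 = 0 := by simp [tensorD]

theorem tensorD_cons {i : ℤ} {a : V} (ha : a ∈ gr i) (X : TensorAlgebra K V) :
    O.tensorD (TensorAlgebra.ι K a * X) = TensorAlgebra.ι K (O.d a) * X +
      sgn K i • (TensorAlgebra.ι K a * O.tensorD X) + O.merge a X := by
  simp [tensorD, signMap_apply _ _ ha]
  abel

/-- The part of `X ↦ [X, b ⊗ Y]` in which `b`, of degree `j`, is the letter that enters `β`. -/
noncomputable def tensorBrContract (j : ℤ) :
    V →ₗ[K] TensorAlgebra K V →ₗ[K] (TensorAlgebra K V →ₗ[K] TensorAlgebra K V) :=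
  LinearMap.mk₂ K (fun b Y => tensorRec (leftMul K ∘ₗ signMap O.graded 1) (0,
      (LinearMap.mk₂ K (fun a X => TensorAlgebra.ι K (O.β a b) *
          shuffleProd O.graded (signMap (isInternal_tensorGr O.graded) (j + k) X) Y)
        (fun a a' X => by simp [add_mul]) (fun r a X => by simp)
        (fun a X X' => by simp [mul_add]) (fun r a X => by simp))))
    (fun b b' Y => by rw [← map_add]; congr 1; ext <;> simp [add_mul])
    (fun r b Y => by rw [← map_smul]; congr 1; ext <;> simp)
    (fun b Y Y' => by rw [← map_add]; congr 1; ext <;> simp [mul_add])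
    (fun r b Y => by rw [← map_smul]; congr 1; ext <;> simp)

/-- The part of `X ↦ [X, b ⊗ Y]` in which `b`, of degree `j`, is only moved to the left; it is
determined by `φ = (X ↦ [X, Y])`. -/
noncomputable def tensorBrPass (j : ℤ) :
    V →ₗ[K] (TensorAlgebra K V →ₗ[K] TensorAlgebra K V) →ₗ[K]
      (TensorAlgebra K V →ₗ[K] TensorAlgebra K V) :=
  LinearMap.mk₂ K (fun b φ => tensorRec (leftMul K ∘ₗ signMap O.graded 1) (0,
      (leftMul K).compr₂ (sgn K (j * (k + 1)) •
        (leftMul K b ∘ₗ φ ∘ₗ signMap (isInternal_tensorGr O.graded) j))))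
    (fun b b' Y => by rw [← map_add]; congr 1; ext <;> simp)
    (fun r b Y => by rw [← map_smul]; congr 1; ext <;> simp [smul_comm r])
    (fun b Y Y' => by rw [← map_add]; congr 1; ext <;> simp [mul_add])
    (fun r b Y => by rw [← map_smul]; congr 1; ext <;> simp [smul_comm r])

/-- The bracket of the tensor algebra that is induced by `β`, given by the recursion
`tensorBr_cons`. -/
noncomputable def tensorBr :
    TensorAlgebra K V →ₗ[K] TensorAlgebra K V →ₗ[K] TensorAlgebra K V :=
  (tensorRec (byDegree O.graded O.tensorBrPass) (0, byDegree O.graded O.tensorBrContract)).flip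

@[simp] theorem tensorBr_one_right (X : TensorAlgebra K V) : O.tensorBr X 1 = 0 := by
  simp [tensorBr]

@[simp] theorem tensorBr_one_left (Y : TensorAlgebra K V) : O.tensorBr 1 Y = 0 := by
  suffices O.tensorBr 1 = 0 by rw [this, LinearMap.zero_apply]
  refine linearMap_ext_word O.graded fun l => ?_
  cases l with
  | nil => simp
  | cons x l => simp [tensorBr, byDegree_apply O.graded _ x.2.2, tensorBrPass, tensorBrContract]

theorem tensorBr_cons {i m j : ℤ} {a b : V} {X : TensorAlgebra K V} (ha : a ∈ gr i)
    (hX : X ∈ tensorGr gr m) (hb : b ∈ gr j) (Y : TensorAlgebra K V) :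
    O.tensorBr (TensorAlgebra.ι K a * X) (TensorAlgebra.ι K b * Y) =
      sgn K (m * (j + k)) • (TensorAlgebra.ι K (O.β a b) * shuffleProd O.graded X Y) +
      sgn K i • (TensorAlgebra.ι K a * O.tensorBr X (TensorAlgebra.ι K b * Y)) +
        sgn K (j * (i + m + k + 1)) •
          (TensorAlgebra.ι K b * O.tensorBr (TensorAlgebra.ι K a * X) Y) := by
  have hsplit (X' : TensorAlgebra K V) : O.tensorBr X' (TensorAlgebra.ι K b * Y) =
      O.tensorBrPass j b (O.tensorBr.flip Y) X' + O.tensorBrContract j b Y X' := by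
    simp [tensorBr, byDegree_apply _ _ hb]
  rw [hsplit, hsplit X]
  simp only [tensorBrPass, tensorBrContract, LinearMap.mk₂_apply, tensorRec_ι_mul,
    LinearMap.comp_apply, signMap_apply _ _ ha, signMap_apply _ _ hX,
    signMap_apply _ _ (ι_mul_mem_tensorGr ha hX), LinearMap.compr₂_apply, leftMul_apply, map_smul,
    LinearMap.smul_apply, mul_smul_comm, one_mul, mul_add, LinearMap.flip_apply]
  match_scalars <;> simp [sgn_add, mul_add, mul_comm, mul_assoc]

theorem merge_mem {i m : ℤ} {a : V} {X : TensorAlgebra K V} (ha : a ∈ gr i)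
    (hX : X ∈ tensorGr gr m) : O.merge a X ∈ tensorGr gr (i + m + 1) := by
  refine map_mem_of_mem_tensorGr (fun l hl => ?_) hX
  subst hl
  cases l with
  | nil => simp
  | cons b l =>
    rw [word_cons, merge_ι_mul]
    exact mem_tensorGr_congr (ι_mul_mem_tensorGr (O.μ_mem ha b.2.2) (word_mem_tensorGr l))
      (by simp; ring)

theorem tensorD_mem {m : ℤ} {X : TensorAlgebra K V} (hX : X ∈ tensorGr gr m) :
    O.tensorD X ∈ tensorGr gr (m + 1) := by
  refine map_mem_of_mem_tensorGr (fun l hl => ?_) hX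
  clear hX
  subst hl
  induction l with
  | nil => simp
  | cons a l ih =>
    have hl := word_mem_tensorGr l
    rw [word_cons, O.tensorD_cons a.2.2]
    refine add_mem (add_mem ?_ (Submodule.smul_mem _ _ ?_)) ?_
    · exact mem_tensorGr_congr (ι_mul_mem_tensorGr (O.d_mem a.2.2) hl) (by simp; ring)
    · exact mem_tensorGr_congr (ι_mul_mem_tensorGr a.2.2 ih) (by simp; ring)
    · exact mem_tensorGr_congr (O.merge_mem a.2.2 hl) (by simp)

theorem tensorBr_mem {m n : ℤ} {X Y : TensorAlgebra K V} (hX : X ∈ tensorGr gr m)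
    (hY : Y ∈ tensorGr gr n) : O.tensorBr X Y ∈ tensorGr gr (m + n + (k + 1)) := by
  refine map₂_mem_tensorGr (fun u v => ?_) hX hY
  induction u generalizing v with
  | nil => simp
  | cons a u ihu =>
    induction v with
    | nil => simp
    | cons b v ihv =>
      have hu := word_mem_tensorGr u
      have hv := word_mem_tensorGr v
      rw [word_cons, word_cons, O.tensorBr_cons a.2.2 hu b.2.2, ← word_cons, ← word_cons]
      refine add_mem (add_mem (Submodule.smul_mem _ _ ?_) (Submodule.smul_mem _ _ ?_))
        (Submodule.smul_mem _ _ ?_)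
      · exact mem_tensorGr_congr
          (ι_mul_mem_tensorGr (O.β_mem a.2.2 b.2.2) (shuffleProd_mem _ hu hv)) (by simp; ring)
      · exact mem_tensorGr_congr (ι_mul_mem_tensorGr a.2.2 (ihu (b :: v))) (by simp; ring)
      · exact mem_tensorGr_congr (ι_mul_mem_tensorGr b.2.2 ihv) (by simp; ring)

theorem tensorBr_word_comm (u v : List (Homog gr)) :
    O.tensorBr (word u) (word v) =
      sgn K ((wordDegree u + k) * (wordDegree v + k)) • O.tensorBr (word v) (word u) := by
  induction u generalizing v with
  | nil => simp
  | cons a u ihu =>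
    induction v with
    | nil => simp
    | cons b v ihv =>
      have ihu := ihu (b :: v)
      simp only [word_cons, wordDegree_cons] at ihu ihv ⊢
      rw [O.tensorBr_cons a.2.2 (word_mem_tensorGr u) b.2.2,
        O.tensorBr_cons b.2.2 (word_mem_tensorGr v) a.2.2, ihu, ihv,
        shuffleProd_word_comm, O.β_comm a.2.2 b.2.2]
      simp only [mul_smul_comm, smul_add, smul_smul, map_smul, smul_mul_assoc]
      match_scalars <;>
        simp [sgn_add, mul_add, mul_comm, mul_left_comm, mul_assoc]

theorem tensorBr_comm {m n : ℤ} {X Y : TensorAlgebra K V} (hX : X ∈ tensorGr gr m)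
    (hY : Y ∈ tensorGr gr n) :
    O.tensorBr X Y = sgn K ((m + k) * (n + k)) • O.tensorBr Y X := by
  refine eqOn_tensorGr₂ (G := sgn K ((m + k) * (n + k)) • O.tensorBr.flip) ?_ hX hY
  rintro u v rfl rfl
  simpa using O.tensorBr_word_comm u v

theorem merge_merge {i : ℤ} {a : V} (ha : a ∈ gr i) (b : V) (X : TensorAlgebra K V) :
    O.merge (O.μ a b) X = -(sgn K i • O.merge a (O.merge b X)) := by
  suffices O.merge (O.μ a b) = -(sgn K i • (O.merge a ∘ₗ O.merge b)) by simp [this]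
  refine linearMap_ext_word O.graded fun l => ?_
  cases l with
  | nil => simp
  | cons c l => simp [O.μ_assoc b c.2 ha]

theorem tensorD_merge_word (a : Homog gr) (u : List (Homog gr)) :
    O.tensorD (O.merge a.2 (word u)) =
      -O.merge (O.d a.2) (word u) - sgn K a.1 • O.merge a.2 (O.tensorD (word u)) := by
  cases u with
  | nil => simp
  | cons b u =>
    simp only [word_cons, merge_ι_mul, O.tensorD_cons (O.μ_mem a.2.2 b.2.2),
      O.tensorD_cons b.2.2, map_add, map_smul, O.merge_merge a.2.2, O.d_μ _ a.2.2, map_sub,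
      map_neg, sub_mul, neg_mul, smul_mul_assoc, smul_add]
    match_scalars <;> simp [sgn_add]

theorem tensorD_tensorD_word (u : List (Homog gr)) : O.tensorD (O.tensorD (word u)) = 0 := by
  induction u with
  | nil => simp
  | cons a u ih =>
    simp only [word_cons, O.tensorD_cons a.2.2, map_add, map_smul, O.tensorD_cons (O.d_mem a.2.2),
      ih, O.d_d, map_zero, zero_mul, mul_zero, O.tensorD_merge_word]
    match_scalars <;> simp [sgn_add]

theorem merge_shuffleProd_left {i j : ℤ} {a b : V} (u : List (Homog gr)) (ha : a ∈ gr i)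
    (hb : b ∈ gr j) (Y : TensorAlgebra K V) :
    O.merge a (shuffleProd O.graded (word u) (TensorAlgebra.ι K b * Y)) =
      shuffleProd O.graded (O.merge a (word u)) (TensorAlgebra.ι K b * Y) -
        sgn K (j * (i + wordDegree u + 1)) •
          (TensorAlgebra.ι K b * shuffleProd O.graded (O.merge a (word u)) Y) +
        sgn K (j * wordDegree u) •
          (TensorAlgebra.ι K (O.μ a b) * shuffleProd O.graded (word u) Y) := by
  cases u with
  | nil => simp
  | cons a' u =>
    have hu := word_mem_tensorGr u
    simp only [word_cons, wordDegree_cons, merge_ι_mul, shuffleProd_cons O.graded a'.2.2 hu hb,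
      shuffleProd_cons O.graded (O.μ_mem ha a'.2.2) hu hb, map_add, map_smul]
    match_scalars <;> simp [sgn_add, mul_add, mul_comm, mul_assoc]

theorem merge_shuffleProd_right {i j m : ℤ} {a b : V} {X : TensorAlgebra K V}
    (v : List (Homog gr)) (ha : a ∈ gr i) (hX : X ∈ tensorGr gr m) (hb : b ∈ gr j) :
    O.merge b (shuffleProd O.graded (TensorAlgebra.ι K a * X) (word v)) =
      TensorAlgebra.ι K (O.μ b a) * shuffleProd O.graded X (word v) +
        sgn K ((j + 1) * (i + m)) •
          (shuffleProd O.graded (TensorAlgebra.ι K a * X) (O.merge b (word v)) -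
            TensorAlgebra.ι K a * shuffleProd O.graded X (O.merge b (word v))) := by
  cases v with
  | nil => simp
  | cons b' v =>
    simp only [word_cons, merge_ι_mul, shuffleProd_cons O.graded ha hX b'.2.2,
      shuffleProd_cons O.graded ha hX (O.μ_mem hb b'.2.2), map_add, map_smul]
    match_scalars <;> simp [sgn_add, mul_add, mul_comm, mul_left_comm, mul_assoc]

theorem tensorD_shuffleProd_word (u v : List (Homog gr)) :
    O.tensorD (shuffleProd O.graded (word u) (word v)) =
      shuffleProd O.graded (O.tensorD (word u)) (word v) +
        sgn K (wordDegree u) • shuffleProd O.graded (word u) (O.tensorD (word v)) := by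
  induction u generalizing v with
  | nil => simp
  | cons a u ihu =>
    induction v with
    | nil => simp
    | cons b v ihv =>
      have ihu := congrArg (leftMul K (a.2 : V)) (ihu (b :: v))
      have ihv := congrArg (leftMul K (b.2 : V)) ihv
      have ha := a.2.2
      have hb := b.2.2
      have hu := word_mem_tensorGr u
      have hmerge_a := O.merge_shuffleProd_left u ha hb (word v)
      have hmerge_b := O.merge_shuffleProd_right v ha hu hb
      simp only [word_cons, wordDegree_cons, leftMul_apply, shuffleProd_cons O.graded ha hu hb,
        O.tensorD_cons ha, O.tensorD_cons hb, hmerge_a, hmerge_b,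
        shuffleProd_cons O.graded (O.d_mem ha) hu hb,
        shuffleProd_cons O.graded ha (O.tensorD_mem hu) hb,
        shuffleProd_cons O.graded ha hu (O.d_mem hb), map_add, map_smul, LinearMap.add_apply,
        LinearMap.smul_apply, mul_add, smul_add, O.μ_comm hb ha, map_neg,
        neg_mul, smul_mul_assoc] at ihu ihv ⊢
      linear_combination (norm := skip) sgn K a.1 • ihu +
        (sgn K (b.1 * (a.1 + wordDegree u)) * sgn K b.1) • ihv
      match_scalars <;> simp [sgn_add, mul_add, mul_comm, mul_left_comm, mul_assoc]

theorem tensorBr_shuffleProd_word (u v w : List (Homog gr)) :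
    O.tensorBr (shuffleProd O.graded (word u) (word v)) (word w) =
      sgn K (wordDegree u) • shuffleProd O.graded (word u) (O.tensorBr (word v) (word w)) +
        sgn K (wordDegree v * (wordDegree w + k)) •
          shuffleProd O.graded (O.tensorBr (word u) (word w)) (word v) := by
  induction u generalizing v w with
  | nil => simp
  | cons a u ihu =>
    induction v generalizing w with
    | nil => simp
    | cons b v ihv =>
      induction w with
      | nil => simp
      | cons c w ihw =>
        have ihu := congrArg (leftMul K (a.2 : V)) (ihu (b :: v) (c :: w))
        have ihv := congrArg (leftMul K (b.2 : V)) (ihv (c :: w))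
        have ihw := congrArg (leftMul K (c.2 : V)) ihw
        have ha := a.2.2
        have hb := b.2.2
        have hc := c.2.2
        have hu := word_mem_tensorGr u
        have hv := word_mem_tensorGr v
        have hw := word_mem_tensorGr w
        have hau := ι_mul_mem_tensorGr ha hu
        have hbv := ι_mul_mem_tensorGr hb hv
        have hcw := ι_mul_mem_tensorGr hc hw
        have hassoc := shuffleProd_assoc O.graded (TensorAlgebra.ι K (a.2 : V) * word u)
          (word v) (word w)
        have hright_comm := shuffleProd_word_right_comm O.graded u w (b :: v)
        simp only [word_cons, wordDegree_cons, leftMul_apply] at ihu ihv ihw hright_comm ⊢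
        simp only [shuffleProd_cons O.graded ha hu hb, O.tensorBr_cons hb hv hc,
          O.tensorBr_cons ha hu hc, map_add, map_smul, LinearMap.add_apply, LinearMap.smul_apply,
          O.tensorBr_cons ha (shuffleProd_mem O.graded hu hbv) hc,
          O.tensorBr_cons hb (shuffleProd_mem O.graded hau hv) hc,
          shuffleProd_cons O.graded ha hu (O.β_mem hb hc), shuffleProd_cons O.graded ha hu hc,
          shuffleProd_cons O.graded (O.β_mem ha hc) (shuffleProd_mem O.graded hu hw) hb,
          shuffleProd_cons O.graded ha (O.tensorBr_mem hu hcw) hb,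
          shuffleProd_cons O.graded hc (O.tensorBr_mem hau hw) hb,
          hright_comm, hassoc, mul_add, smul_add, mul_smul_comm] at ihu ihv ihw ⊢
        linear_combination (norm := skip) sgn K a.1 • ihu +
          (sgn K (b.1 * (a.1 + wordDegree u)) * sgn K b.1) • ihv +
          sgn K (c.1 * (a.1 + wordDegree u + b.1 + wordDegree v + k + 1)) • ihw
        match_scalars <;>
          simp only [sgn_add, mul_add, add_mul, mul_one] <;> ring_nf <;> simp [sq, mul_assoc]

theorem β_μ_left {i j l : ℤ} {x y z : V} (hx : x ∈ gr i) (hy : y ∈ gr j) (hz : z ∈ gr l) :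
    O.β (O.μ x y) z =
      -(sgn K (j * (l + k)) • O.μ (O.β x z) y) - sgn K i • O.μ x (O.β y z) := by
  rw [O.β_comm (O.μ_mem hx hy) hz, O.β_μ y hz hx, O.β_comm hz hx, O.β_comm hz hy]
  simp only [map_smul, LinearMap.smul_apply]
  match_scalars <;> simp only [sgn_add, mul_add, add_mul, mul_one] <;> ring_nf <;>
    simp [sq, mul_comm]

/-- The terms of `D [a ⊗ u, b ⊗ v]` in which `μ` takes in a first letter. -/
theorem merge_tensorBr {i j : ℤ} {a b : V} (u v : List (Homog gr)) (ha : a ∈ gr i)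
    (hb : b ∈ gr j) :
    sgn K (wordDegree u * (j + k)) • O.merge (O.β a b) (shuffleProd O.graded (word u) (word v)) +
      sgn K i • O.merge a (O.tensorBr (word u) (TensorAlgebra.ι K b * word v)) +
      sgn K (j * (i + wordDegree u + k + 1)) •
        O.merge b (O.tensorBr (TensorAlgebra.ι K a * word u) (word v)) =
    -(O.tensorBr (O.merge a (word u)) (TensorAlgebra.ι K b * word v) -
      sgn K (j * (i + wordDegree u + k)) •
        (TensorAlgebra.ι K b * O.tensorBr (O.merge a (word u)) (word v))) -
    sgn K (i + wordDegree u + k) •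
      (O.tensorBr (TensorAlgebra.ι K a * word u) (O.merge b (word v)) -
        sgn K i • (TensorAlgebra.ι K a * O.tensorBr (word u) (O.merge b (word v)))) := by
  rcases u with _ | ⟨a', u⟩ <;> rcases v with _ | ⟨b', v⟩
  · simp
  · have hnil : word [] ∈ tensorGr gr 0 := word_mem_tensorGr []
    have hb' := b'.2.2
    rw [word_nil] at hnil
    simp only [word_nil, wordDegree_nil, word_cons, merge_ι_mul, shuffleProd_one_left,
      tensorBr_one_left, merge_one, O.tensorBr_cons ha hnil hb',
      O.tensorBr_cons ha hnil (O.μ_mem hb hb'), map_add, map_smul, map_zero,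
      LinearMap.zero_apply, mul_zero, smul_zero, add_zero, sub_zero, neg_zero, zero_sub,
      O.β_μ _ ha hb, add_mul, smul_mul_assoc]
    match_scalars <;> simp only [sgn_add, mul_add, mul_one] <;> ring_nf <;> simp
  · have ha' := a'.2.2
    have hu := word_mem_tensorGr u
    simp only [word_nil, word_cons, wordDegree_cons, merge_ι_mul, shuffleProd_one_right,
      tensorBr_one_right, merge_one, O.tensorBr_cons ha' hu hb,
      O.tensorBr_cons (O.μ_mem ha ha') hu hb, map_add, map_smul, map_zero, mul_zero, smul_zero,
      add_zero, sub_zero, O.β_μ_left ha ha' hb, map_sub, map_neg, sub_mul, neg_mul,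
      smul_mul_assoc]
    match_scalars <;> simp only [sgn_add, mul_add, add_mul, mul_one, sgn_one] <;> ring_nf
  · have ha' := a'.2.2
    have hb' := b'.2.2
    have hu := word_mem_tensorGr u
    have hau := ι_mul_mem_tensorGr ha' hu
    simp only [word_cons, wordDegree_cons, merge_ι_mul, O.tensorBr_cons ha' hu hb,
      O.tensorBr_cons (O.μ_mem ha ha') hu hb, O.tensorBr_cons ha hau (O.μ_mem hb hb'),
      O.tensorBr_cons ha hau hb', O.tensorBr_cons (O.μ_mem ha ha') hu hb',
      O.tensorBr_cons ha' hu hb', O.tensorBr_cons ha' hu (O.μ_mem hb hb'),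
      shuffleProd_cons O.graded ha' hu hb', map_add, map_smul, O.β_μ _ ha hb,
      O.β_μ_left ha ha' hb, add_mul, sub_mul, smul_mul_assoc, mul_add, smul_add,
      O.μ_comm hb ha, map_sub, map_neg, neg_mul]
    match_scalars <;> simp only [sgn_add, mul_one] <;> ring_nf <;>
      simp

theorem tensorD_tensorBr_word (u v : List (Homog gr)) :
    O.tensorD (O.tensorBr (word u) (word v)) = -O.tensorBr (O.tensorD (word u)) (word v) -
      sgn K (wordDegree u + k) • O.tensorBr (word u) (O.tensorD (word v)) := by
  induction u generalizing v with
  | nil => simp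
  | cons a u ihu =>
    induction v with
    | nil => simp
    | cons b v ihv =>
      have ihu := congrArg (leftMul K (a.2 : V)) (ihu (b :: v))
      have ihv := congrArg (leftMul K (b.2 : V)) ihv
      have ha := a.2.2
      have hb := b.2.2
      have hu := word_mem_tensorGr u
      have hmerge := O.merge_tensorBr u v ha hb
      simp only [word_cons, wordDegree_cons, leftMul_apply] at ihu ihv hmerge ⊢
      simp only [O.tensorBr_cons ha hu hb, O.tensorD_cons ha, O.tensorD_cons hb,
        O.tensorD_cons (O.β_mem ha hb), O.tensorBr_cons (O.d_mem ha) hu hb,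
        O.tensorBr_cons ha (O.tensorD_mem hu) hb, O.d_β _ ha, O.tensorD_shuffleProd_word,
        O.tensorBr_cons ha hu (O.d_mem hb), map_add, map_smul, map_sub, map_neg,
        LinearMap.add_apply, LinearMap.smul_apply, mul_add, smul_add, smul_sub, smul_neg,
        mul_smul_comm, sub_mul, mul_sub, mul_neg, neg_mul, smul_mul_assoc] at ihu ihv ⊢
      linear_combination (norm := skip) hmerge + ihu +
        (sgn K (b.1 * (a.1 + wordDegree u + k + 1)) * sgn K b.1) • ihv
      match_scalars <;> (try simp only [sgn_add, mul_add, add_mul, mul_one]) <;>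
        ring_nf <;> simp

/-- Under cyclic rotation, the terms that begin with `a`, `b`, `c` are the Jacobi sums of shorter
words, `β (β a b) c` is the Jacobi sum of letters, and those with a single `β` cancel in pairs. -/
theorem tensorBr_tensorBr_word_cons (a b c : Homog gr) (u v w : List (Homog gr)) :
    O.tensorBr (O.tensorBr (word (a :: u)) (word (b :: v))) (word (c :: w)) =
      TensorAlgebra.ι K (a.2 : V) *
          O.tensorBr (O.tensorBr (word u) (word (b :: v))) (word (c :: w)) +
      sgn K (b.1 * (a.1 + wordDegree u + k)) • (TensorAlgebra.ι K (b.2 : V) *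
          O.tensorBr (O.tensorBr (word (a :: u)) (word v)) (word (c :: w))) +
      sgn K (c.1 * (a.1 + wordDegree u + b.1 + wordDegree v)) • (TensorAlgebra.ι K (c.2 : V) *
          O.tensorBr (O.tensorBr (word (a :: u)) (word (b :: v))) (word w)) +
      sgn K (wordDegree u * (b.1 + k) + (wordDegree u + wordDegree v) * (c.1 + k)) •
        (TensorAlgebra.ι K (O.β (O.β a.2 b.2) c.2) *
          shuffleProd O.graded (shuffleProd O.graded (word u) (word v)) (word w)) +
      sgn K (a.1 + b.1 + k + 1 +
          wordDegree u * (b.1 + wordDegree v + c.1 + wordDegree w)) •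
        (TensorAlgebra.ι K (O.β a.2 b.2) * shuffleProd O.graded
          (O.tensorBr (word v) (word (c :: w))) (word u)) +
      sgn K (a.1 + b.1 + k + 1 + wordDegree u * (b.1 + k) +
          wordDegree v * (c.1 + wordDegree w + k)) •
        (TensorAlgebra.ι K (O.β a.2 b.2) * shuffleProd O.graded
          (O.tensorBr (word u) (word (c :: w))) (word v)) +
      sgn K (a.1 + (wordDegree u + b.1 + wordDegree v + k + 1) * (c.1 + k)) •
        (TensorAlgebra.ι K (O.β a.2 c.2) * shuffleProd O.graded
          (O.tensorBr (word u) (word (b :: v))) (word w)) +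
      sgn K (b.1 * (a.1 + wordDegree u + k + 1) +
          (a.1 + wordDegree u + wordDegree v + k + 1) * (c.1 + k) +
          (a.1 + wordDegree u + k) * (wordDegree v + k)) •
        (TensorAlgebra.ι K (O.β b.2 c.2) * shuffleProd O.graded
          (O.tensorBr (word v) (word (a :: u))) (word w)) := by
  have ha := a.2.2
  have hb := b.2.2
  have hc := c.2.2
  have hu := word_mem_tensorGr u
  have hv := word_mem_tensorGr v
  have hau := ι_mul_mem_tensorGr ha hu
  have hbv := ι_mul_mem_tensorGr hb hv
  have hcw := word_mem_tensorGr (c :: w)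
  have hshuffle := O.tensorBr_shuffleProd_word u v (c :: w)
  rw [shuffleProd_comm O.graded hu (O.tensorBr_mem hv hcw)] at hshuffle
  simp only [word_cons, wordDegree_cons] at hshuffle ⊢
  simp only [O.tensorBr_cons ha hu hb, map_add, map_smul, LinearMap.add_apply,
    LinearMap.smul_apply, O.tensorBr_cons (O.β_mem ha hb) (shuffleProd_mem O.graded hu hv) hc,
    O.tensorBr_cons ha (O.tensorBr_mem hu hbv) hc, O.tensorBr_cons hb (O.tensorBr_mem hau hv) hc,
    hshuffle, mul_add, smul_add, mul_smul_comm, O.tensorBr_comm hv hau]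
  match_scalars <;> simp only [sgn_add, add_mul, mul_one] <;> ring_nf <;>
    simp

theorem tensorBr_word_jacobi (u v w : List (Homog gr)) :
    sgn K ((wordDegree u + k) * (wordDegree w + k)) •
        O.tensorBr (O.tensorBr (word u) (word v)) (word w) +
      sgn K ((wordDegree v + k) * (wordDegree u + k)) •
        O.tensorBr (O.tensorBr (word v) (word w)) (word u) +
      sgn K ((wordDegree w + k) * (wordDegree v + k)) •
        O.tensorBr (O.tensorBr (word w) (word u)) (word v) = 0 := by
  induction u generalizing v w with
  | nil => simp
  | cons a u ihu =>
    induction v generalizing w with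
    | nil => simp
    | cons b v ihv =>
      induction w with
      | nil => simp
      | cons c w ihw =>
        have ihu := congrArg (leftMul K (a.2 : V)) (ihu (b :: v) (c :: w))
        have ihv := congrArg (leftMul K (b.2 : V)) (ihv (c :: w))
        have ihw := congrArg (leftMul K (c.2 : V)) ihw
        have hβ := congrArg (fun x => TensorAlgebra.ι K x *
          shuffleProd O.graded (shuffleProd O.graded (word u) (word v)) (word w))
          (O.jacobi a.2.2 b.2.2 c.2.2)
        simp only [map_zero, zero_mul, map_add, map_smul, leftMul_apply, wordDegree_cons, add_mul,
          smul_mul_assoc] at ihu ihv ihw hβ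
        rw [O.tensorBr_tensorBr_word_cons a b c, O.tensorBr_tensorBr_word_cons b c a,
          O.tensorBr_tensorBr_word_cons c a b, shuffleProd_word_rotate O.graded v w u,
          shuffleProd_word_rotate O.graded w u v, shuffleProd_word_rotate O.graded v w u,
          O.β_comm b.2.2 a.2.2, O.β_comm c.2.2 b.2.2, O.β_comm a.2.2 c.2.2]
        simp only [wordDegree_cons, map_smul, smul_mul_assoc, mul_smul_comm]
        linear_combination (norm := skip) sgn K (a.1 * (c.1 + wordDegree w + k)) • ihu +
          sgn K (b.1 * (a.1 + wordDegree u + k)) • ihv +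
          sgn K (c.1 * (b.1 + wordDegree v + k)) • ihw +
          sgn K ((a.1 + wordDegree u + k) * (c.1 + wordDegree w + k) + (a.1 + k) * (c.1 + k) +
            wordDegree u * (b.1 + k) + (wordDegree u + wordDegree v) * (c.1 + k)) • hβ
        match_scalars <;> simp only [sgn_add, mul_add, add_mul, mul_one, sgn_one] <;> ring_nf <;>
          simp only [sgn_sq, sgn_pow_three, mul_one] <;> ring

end ShiftedABAlgebra

/-! ### Shuffles of lists -/

section Shuffles

variable {α : Type*} {u v l : List α}

/-- The list of all interleavings of two lists, by recursion on their first letters. -/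
def shuffles : List α → List α → List (List α)
  | [], l => [l]
  | a :: u, [] => [a :: u]
  | a :: u, b :: v => (shuffles u (b :: v)).map (a :: ·) ++ (shuffles (a :: u) v).map (b :: ·)
termination_by u v => u.length + v.length

theorem shuffles_nil_left (l : List α) : shuffles [] l = [l] := by simp [shuffles]

theorem shuffles_nil_right (l : List α) : shuffles l [] = [l] := by
  cases l <;> simp [shuffles]

theorem shuffles_cons (a b : α) (u v : List α) :
    shuffles (a :: u) (b :: v) =
      (shuffles u (b :: v)).map (a :: ·) ++ (shuffles (a :: u) v).map (b :: ·) := by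
  rw [shuffles]

theorem perm_of_mem_shuffles (h : l ∈ shuffles u v) : l.Perm (u ++ v) := by
  induction u generalizing v l with
  | nil => rw [shuffles_nil_left, List.mem_singleton] at h; simp [h]
  | cons a u ihu =>
    induction v generalizing l with
    | nil => rw [shuffles_nil_right, List.mem_singleton] at h; simp [h]
    | cons b v ihv =>
      rw [shuffles_cons, List.mem_append, List.mem_map, List.mem_map] at h
      rcases h with ⟨l', hl', rfl⟩ | ⟨l', hl', rfl⟩
      · exact (ihu hl').cons a
      · exact ((ihv hl').cons b).trans List.perm_middle.symm

theorem nodup_shuffles (h : (u ++ v).Nodup) : (shuffles u v).Nodup := by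
  induction u generalizing v with
  | nil => simp [shuffles_nil_left]
  | cons a u ihu =>
    induction v with
    | nil => simp [shuffles_nil_right]
    | cons b v ihv =>
      have hab : a ≠ b := by rintro rfl; simp at h
      have hleft := (ihu (List.nodup_cons.1 h).2).map (List.cons_injective (a := a))
      have hright := (ihv (List.nodup_cons.1 (List.perm_middle.nodup_iff.1 h)).2).map
        (List.cons_injective (a := b))
      rw [shuffles_cons, List.nodup_append]
      refine ⟨hleft, hright, fun x hx y hy hxy => ?_⟩
      obtain ⟨x', -, rfl⟩ := List.mem_map.1 hx
      obtain ⟨y', -, rfl⟩ := List.mem_map.1 hy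
      exact hab (List.cons.inj hxy).1

theorem cons_mem_shuffles {x : α} : x :: l ∈ shuffles u v ↔
    (∃ u', u = x :: u' ∧ l ∈ shuffles u' v) ∨ ∃ v', v = x :: v' ∧ l ∈ shuffles u v' := by
  rcases u with _ | ⟨a, u⟩ <;> rcases v with _ | ⟨b, v⟩ <;>
    simp [shuffles_nil_left, shuffles_nil_right, shuffles_cons, and_comm, eq_comm]

theorem mem_shuffles {c : α → Prop} [DecidablePred c] (hu : ∀ x ∈ u, c x) (hv : ∀ x ∈ v, ¬ c x) :
    l ∈ shuffles u v ↔ l.filter c = u ∧ l.filter (¬ c ·) = v := by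
  induction l generalizing u v with
  | nil => rcases u with _ | ⟨a, u⟩ <;> rcases v with _ | ⟨b, v⟩ <;>
      simp [shuffles_nil_left, shuffles_nil_right, shuffles_cons]
  | cons x l ih =>
    rw [cons_mem_shuffles]
    constructor
    · rintro (⟨u', rfl, hl⟩ | ⟨v', rfl, hl⟩)
      · rw [List.forall_mem_cons] at hu
        simpa [hu.1] using (ih hu.2 hv).1 hl
      · rw [List.forall_mem_cons] at hv
        simpa [hv.1] using (ih hu hv.2).1 hl
    · rintro ⟨rfl, rfl⟩
      by_cases hx : c x
      · refine Or.inl ⟨l.filter c, by simp [hx], (ih (by simp) hv).2 ⟨rfl, by simp [hx]⟩⟩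
      · refine Or.inr ⟨l.filter (¬ c ·), by simp [hx], (ih hu (by simp)).2 ⟨by simp [hx], rfl⟩⟩

theorem mem_shuffles_iff_perm_pairwise [PartialOrder α] {c : α → Prop}
    (hu : ∀ x ∈ u, c x) (hv : ∀ x ∈ v, ¬ c x) (hu_sorted : u.Pairwise (· < ·))
    (hv_sorted : v.Pairwise (· < ·)) :
    l ∈ shuffles u v ↔ l.Perm (u ++ v) ∧ l.Pairwise fun x y => (c x ↔ c y) → x < y := by
  classical
  constructor
  · intro hl
    refine ⟨perm_of_mem_shuffles hl, ?_⟩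
    obtain ⟨rfl, rfl⟩ := (mem_shuffles hu hv).1 hl
    simp only [List.pairwise_filter, decide_eq_true_iff] at hu_sorted hv_sorted
    refine (hu_sorted.and hv_sorted).imp fun {x y} hxy hc => ?_
    by_cases hx : c x
    · exact hxy.1 hx (hc.1 hx)
    · exact hxy.2 hx (hc.not.1 hx)
  · rintro ⟨hperm, hl⟩
    have hfilter : (u ++ v).filter c = u ∧ (u ++ v).filter (¬ c ·) = v := by
      rw [List.filter_append, List.filter_append,
        (List.filter_eq_self (l := u)).2 fun x hx => decide_eq_true (hu x hx),
        (List.filter_eq_self (l := v)).2 fun x hx => decide_eq_true (hv x hx),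
        (List.filter_eq_nil_iff (l := u)).2 (by simpa using hu),
        (List.filter_eq_nil_iff (l := v)).2 (by simpa using hv)]
      simp
    have hl_filter : (l.filter c).Pairwise (· < ·) ∧ (l.filter (¬ c ·)).Pairwise (· < ·) := by
      simp only [List.pairwise_filter, decide_eq_true_iff]
      exact ⟨hl.imp fun hxy hx hy => hxy (iff_of_true hx hy),
        hl.imp fun hxy hx hy => hxy (iff_of_false hx hy)⟩
    exact (mem_shuffles hu hv).2
      ⟨((hperm.filter c).trans (.of_eq hfilter.1)).eq_of_pairwise' hl_filter.1 hu_sorted,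
        ((hperm.filter (¬ c ·)).trans (.of_eq hfilter.2)).eq_of_pairwise' hl_filter.2 hv_sorted⟩

end Shuffles

section ShufflePermutations

/-- The first `p` places of `p + q`. -/
def firstPlaces (p q : ℕ) : List (Fin (p + q)) := (List.finRange p).map (Fin.castAdd q)

/-- The last `q` places of `p + q`. -/
def lastPlaces (p q : ℕ) : List (Fin (p + q)) := (List.finRange q).map (Fin.natAdd p)

theorem firstPlaces_append_lastPlaces (p q : ℕ) :
    firstPlaces p q ++ lastPlaces p q = List.finRange (p + q) := by
  rw [← List.ofFn_id, List.ofFn_add]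
  simp [firstPlaces, lastPlaces, ← List.ofFn_id, List.map_ofFn]
  rfl

theorem pairwise_firstPlaces_append_lastPlaces (p q : ℕ) :
    (firstPlaces p q ++ lastPlaces p q).Pairwise (· < ·) := by
  rw [firstPlaces_append_lastPlaces]
  exact List.pairwise_lt_finRange _

theorem mem_firstPlaces {p q : ℕ} {x : Fin (p + q)} : x ∈ firstPlaces p q → (x : ℕ) < p := by
  simp only [firstPlaces, List.mem_map]
  rintro ⟨i, -, rfl⟩
  exact i.2

theorem mem_shuffles_places {p q : ℕ} {l : List (Fin (p + q))} :
    l ∈ shuffles (firstPlaces p q) (lastPlaces p q) ↔ l.Perm (List.finRange (p + q)) ∧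
      l.Pairwise fun x y : Fin (p + q) => ((x : ℕ) < p ↔ (y : ℕ) < p) → x < y := by
  have hsorted := List.pairwise_append.1 (pairwise_firstPlaces_append_lastPlaces p q)
  rw [← firstPlaces_append_lastPlaces]
  exact mem_shuffles_iff_perm_pairwise (c := fun x : Fin (p + q) => (x : ℕ) < p)
    (fun _ => mem_firstPlaces) (by simp [lastPlaces]) hsorted.1 hsorted.2.1

theorem isShuffle_iff_pairwise {p q : ℕ} (σ : Equiv.Perm (Fin (p + q))) :
    IsShuffle p q σ ↔ (List.ofFn σ.symm).Pairwise fun x y : Fin (p + q) =>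
      ((x : ℕ) < p ↔ (y : ℕ) < p) → x < y := by
  rw [List.pairwise_ofFn]
  constructor
  · intro h s t hst hc
    contrapose! hst
    rcases hst.eq_or_lt with heq | hlt
    · exact (σ.symm.injective heq).le
    · simpa only [Equiv.apply_symm_apply] using (h _ _ hlt (by omega)).le
  · intro h i j hij hc
    by_contra hlt
    have hlt' : σ j < σ i := lt_of_le_of_ne (not_lt.1 hlt) fun e => hij.ne (σ.injective e).symm
    have := h hlt' (by simp only [Equiv.symm_apply_apply]; omega)
    simp only [Equiv.symm_apply_apply] at this
    exact absurd this hij.not_gt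

theorem exists_ofFn_symm_eq {n : ℕ} {l : List (Fin n)} (hl : l.Perm (List.finRange n)) :
    ∃ σ : Equiv.Perm (Fin n), List.ofFn σ.symm = l := by
  have hlen : l.length = n := by simpa using hl.length_eq
  have hnodup : l.Nodup := hl.nodup_iff.2 (List.nodup_finRange n)
  have hmem : ∀ x, x ∈ l := fun x => hl.mem_iff.2 (List.mem_finRange x)
  refine ⟨((finCongr hlen.symm).trans (hnodup.getEquivOfForallMemList l hmem)).symm,
    List.ext_get (by simp [hlen]) fun i _ _ => by simp⟩

theorem sum_shuffles {M : Type*} [AddCommMonoid M] (p q : ℕ) (f : List (Fin (p + q)) → M)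
    [DecidablePred (IsShuffle p q)] :
    ∑ σ : Equiv.Perm (Fin (p + q)) with IsShuffle p q σ, f (List.ofFn σ.symm) =
      ((shuffles (firstPlaces p q) (lastPlaces p q)).map f).sum := by
  have hnodup := nodup_shuffles ((pairwise_firstPlaces_append_lastPlaces p q).imp LT.lt.ne)
  rw [← List.sum_toFinset f hnodup]
  refine Finset.sum_bij (fun σ _ => List.ofFn σ.symm) (fun σ hσ => ?_) (fun σ _ τ _ h => ?_)
    (fun l hl => ?_) (fun _ _ => rfl)
  · have hperm : (List.ofFn σ.symm).Perm (List.finRange (p + q)) := by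
      rw [List.perm_ext_iff_of_nodup (List.nodup_ofFn.2 σ.symm.injective) (List.nodup_finRange _)]
      simp [σ.symm.surjective _]
    exact List.mem_toFinset.2 <| mem_shuffles_places.2
      ⟨hperm, (isShuffle_iff_pairwise σ).1 (Finset.mem_filter.1 hσ).2⟩
  · exact Equiv.symm_bijective.injective (DFunLike.coe_injective (List.ofFn_injective h))
  · obtain ⟨hperm, hl⟩ := mem_shuffles_places.1 (List.mem_toFinset.1 hl)
    obtain ⟨σ, rfl⟩ := exists_ofFn_symm_eq hperm
    exact ⟨σ, by simpa [isShuffle_iff_pairwise] using hl, rfl⟩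

end ShufflePermutations

section Koszul

variable (K : Type*) [Field K] {n : ℕ}

/-- The Koszul sign of a list of places, as a scalar. -/
def koszulScalar (deg : Fin n → ℤ) (l : List (Fin n)) : K := ((koszulSign deg l : ℤ) : K)

variable (deg : Fin n → ℤ) {i : Fin n} {l u v : List (Fin n)}

theorem koszulScalar_nil : koszulScalar K deg [] = 1 := by simp [koszulScalar, koszulSign]

theorem koszulScalar_cons (i : Fin n) (l : List (Fin n)) :
    koszulScalar K deg (i :: l) =
      sgn K (deg i * ((l.filter (· < i)).map deg).sum) * koszulScalar K deg l := by
  rw [koszulScalar, koszulSign, koszulScalar, Units.val_mul, Int.cast_mul]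
  congr 1
  induction l.filter (· < i) with
  | nil => simp
  | cons j l ih =>
    simp only [List.map_cons, List.prod_cons, List.sum_cons, Units.val_mul, Int.cast_mul, ih,
      mul_add, sgn_add]
    rfl

variable {K}

theorem koszulSign_smul {M : Type*} [AddCommGroup M] [Module K M] (l : List (Fin n)) (x : M) :
    koszulSign deg l • x = koszulScalar K deg l • x := by
  rw [koszulScalar, Int.cast_smul_eq_zsmul, Units.smul_def]

theorem koszulScalar_cons_of_lt (h : ∀ j ∈ l, i < j) :
    koszulScalar K deg (i :: l) = koszulScalar K deg l := by
  rw [koszulScalar_cons, List.filter_eq_nil_iff.2 (fun j hj => by simpa using (h j hj).le)]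
  simp

theorem koszulScalar_of_pairwise (h : l.Pairwise (· < ·)) : koszulScalar K deg l = 1 := by
  induction l with
  | nil => exact koszulScalar_nil K deg
  | cons i l ih =>
    rw [List.pairwise_cons] at h
    rw [koszulScalar_cons_of_lt deg h.1, ih h.2]

theorem koszulScalar_cons_of_perm (hperm : l.Perm (u ++ v)) (hu : ∀ j ∈ u, j < i)
    (hv : ∀ j ∈ v, i < j) :
    koszulScalar K deg (i :: l) = sgn K (deg i * (u.map deg).sum) * koszulScalar K deg l := by
  have hfilter : (u ++ v).filter (· < i) = u := by
    rw [List.filter_append, List.filter_eq_self.2 (fun j hj => by simpa using hu j hj),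
      List.filter_eq_nil_iff.2 (fun j hj => by simpa using (hv j hj).le), List.append_nil]
  rw [koszulScalar_cons, ((hperm.filter (· < i)).map deg).sum_eq, hfilter]

end Koszul

section ShuffleSums

variable {K : Type*} [Field K] {M N : Type*} [AddCommGroup M] [Module K M] [AddCommGroup N]
  [Module K N] {n : ℕ} (deg : Fin n → ℤ) {a b : Fin n} {u v : List (Fin n)}

variable (K) in
/-- The sum of `F` over the shuffles of two lists of places, with Koszul signs. -/
def shuffleSum (u v : List (Fin n)) (F : List (Fin n) → M) : M :=
  ((shuffles u v).map fun l => koszulScalar K deg l • F l).sum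

theorem sum_isShuffle {p q : ℕ} (deg : Fin (p + q) → ℤ) (F : List (Fin (p + q)) → M)
    [DecidablePred (IsShuffle p q)] :
    ∑ σ : Equiv.Perm (Fin (p + q)) with IsShuffle p q σ,
        koszulSign deg (List.ofFn σ.symm) • F (List.ofFn σ.symm) =
      shuffleSum K deg (firstPlaces p q) (lastPlaces p q) F := by
  simp only [koszulSign_smul (K := K)]
  exact sum_shuffles p q fun l => koszulScalar K deg l • F l

theorem shuffleSum_nil_left (hv : v.Pairwise (· < ·)) (F : List (Fin n) → M) :
    shuffleSum K deg [] v F = F v := by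
  simp [shuffleSum, shuffles_nil_left, koszulScalar_of_pairwise deg hv]

theorem shuffleSum_nil_right (hu : u.Pairwise (· < ·)) (F : List (Fin n) → M) :
    shuffleSum K deg u [] F = F u := by
  simp [shuffleSum, shuffles_nil_right, koszulScalar_of_pairwise deg hu]

theorem shuffleSum_cons (h : (a :: u ++ b :: v).Pairwise (· < ·)) (F : List (Fin n) → M) :
    shuffleSum K deg (a :: u) (b :: v) F =
      shuffleSum K deg u (b :: v) (fun l => F (a :: l)) +
        sgn K (deg b * ((a :: u).map deg).sum) •
          shuffleSum K deg (a :: u) v (fun l => F (b :: l)) := by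
  have ha := (List.pairwise_cons.1 h).1
  have hb := List.pairwise_append.1 h
  rw [shuffleSum, shuffles_cons, List.map_append, List.sum_append, List.map_map, List.map_map,
    shuffleSum, shuffleSum, List.smul_sum, List.map_map]
  congr 2 <;> refine List.map_congr_left fun l hl => ?_
  · rw [Function.comp_apply, koszulScalar_cons_of_lt]
    exact fun j hj => ha j ((perm_of_mem_shuffles hl).mem_iff.1 hj)
  · rw [Function.comp_apply, Function.comp_apply, smul_smul,
      koszulScalar_cons_of_perm deg (perm_of_mem_shuffles hl)
        (fun j hj => hb.2.2 j hj b List.mem_cons_self) (List.pairwise_cons.1 hb.2.1).1]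

theorem map_shuffleSum (φ : M →ₗ[K] N) (F : List (Fin n) → M) :
    φ (shuffleSum K deg u v F) = shuffleSum K deg u v fun l => φ (F l) := by
  simp [shuffleSum, map_list_sum, Function.comp_def]

theorem shuffleSum_add (F G : List (Fin n) → M) :
    shuffleSum K deg u v (fun l => F l + G l) =
      shuffleSum K deg u v F + shuffleSum K deg u v G := by
  simp [shuffleSum, List.sum_map_add]

theorem shuffleSum_zero : shuffleSum K deg u v (fun _ => (0 : M)) = 0 := by
  simp [shuffleSum]

end ShuffleSums

section WordOperations

variable {K : Type*} [Field K] {V : Type*} [AddCommGroup V] [Module K V]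
  {gr : ℤ → Submodule K V} {n : ℕ} (γ : Fin n → Homog gr)

theorem tens_letters (l : List (Fin n)) : tens (letters γ l) = word (l.map γ) := by
  simp [word, letters, Function.comp_def]

theorem wordDegree_map (l : List (Fin n)) : wordDegree (l.map γ) = (l.map (degs γ)).sum := by
  simp only [wordDegree, List.map_map]; rfl

theorem replaceBlock_succ (i : Fin n) (l : List (Fin n)) (k r : ℕ) (x : V) :
    replaceBlock γ (i :: l) (k + 1) r x = ((γ i).2 : V) :: replaceBlock γ l k r x := by
  simp only [replaceBlock, letters, List.take_succ_cons, List.map_cons, List.cons_append,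
    Nat.add_right_comm k 1 r, List.drop_succ_cons]

theorem replaceBlock_zero (l : List (Fin n)) (r : ℕ) (x : V) :
    replaceBlock γ l 0 r x = x :: letters γ (l.drop r) := by
  simp [replaceBlock, letters]

/-- Contraction of the letter `i` with the first letter of a word by `E`, if allowed by `Pr`. -/
noncomputable def contractHead (Pr : Fin n → Fin n → Prop) [∀ i j, Decidable (Pr i j)]
    (E : Fin n → Fin n → V) (i : Fin n) : List (Fin n) → TensorAlgebra K V
  | [] => 0
  | j :: l => if Pr i j then TensorAlgebra.ι K (E i j) * word (l.map γ) else 0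

/-- The sum over all contractions by `E` of two adjacent letters `i`, `j` of a word with `Pr i j`;
the contraction has degree `c` for the sign of passing the preceding letters. -/
noncomputable def contract (Pr : Fin n → Fin n → Prop) [∀ i j, Decidable (Pr i j)]
    (E : Fin n → Fin n → V) (c : ℤ) : List (Fin n) → TensorAlgebra K V
  | [] => 0
  | i :: l => sgn K (c * (γ i).1) • (TensorAlgebra.ι K ((γ i).2 : V) * contract Pr E c l) +
      contractHead γ Pr E i l

/-- The signed sum over all applications of the degree one operation `E` to a letter of a word. -/
noncomputable def applyAll (E : Fin n → V) : List (Fin n) → TensorAlgebra K V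
  | [] => 0
  | i :: l => sgn K (γ i).1 • (TensorAlgebra.ι K ((γ i).2 : V) * applyAll E l) +
      TensorAlgebra.ι K (E i) * word (l.map γ)

theorem sum_contract {m : ℕ} (Pr : Fin n → Fin n → Prop) [∀ i j, Decidable (Pr i j)]
    (E : Fin n → Fin n → V) (c : ℤ) (f : Fin m → Fin n) :
    ∑ k : Fin m, ∑ k' : Fin m with k.val + 1 = k'.val ∧ Pr (f k) (f k'),
      sgn K (c * ∑ s : Fin m with s < k, degs γ (f s)) •
        (tens (replaceBlock γ (List.ofFn f) k 2 (E (f k) (f k'))) : TensorAlgebra K V) =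
    contract γ Pr E c (List.ofFn f) := by
  induction m with
  | zero => simp [contract]
  | succ m ih =>
    have ih' := congrArg (leftMul K ((γ (f 0)).2 : V)) (ih fun s => f s.succ)
    simp only [Finset.sum_filter, List.ofFn_succ, contract] at ih' ⊢
    rw [Fin.sum_univ_succ, add_comm]
    congr 1
    · rw [← leftMul_apply, ← ih', map_sum, Finset.smul_sum]
      refine Finset.sum_congr rfl fun k _ => ?_
      rw [Fin.sum_univ_succ, map_sum, Finset.smul_sum]
      simp only [Fin.val_succ, Fin.val_zero, Nat.add_eq_zero_iff, one_ne_zero, and_false,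
        false_and, if_false, zero_add, add_left_inj]
      refine Finset.sum_congr rfl fun k' _ => ?_
      split_ifs with h
      · rw [replaceBlock_succ, tens_cons, Fin.sum_univ_succ]
        simp only [Fin.succ_lt_succ_iff, Fin.succ_pos, if_true, mul_add, sgn_add, map_smul,
          leftMul_apply, smul_smul]
        rfl
      · simp
    · cases m with
      | zero => simp [contractHead]
      | succ m =>
        rw [Fin.sum_univ_succ, Fin.sum_univ_succ, Finset.sum_eq_zero fun k _ => by simp]
        simp [contractHead, replaceBlock_zero, tens_letters, Fin.sum_univ_succ]

theorem sum_applyAll {m : ℕ} (E : Fin n → V) (f : Fin m → Fin n) :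
    ∑ k : Fin m, sgn K (∑ s : Fin m with s < k, degs γ (f s)) •
        (tens (replaceBlock γ (List.ofFn f) k 1 (E (f k))) : TensorAlgebra K V) =
    applyAll γ E (List.ofFn f) := by
  induction m with
  | zero => simp [applyAll]
  | succ m ih =>
    have ih' := congrArg (leftMul K ((γ (f 0)).2 : V)) (ih fun s => f s.succ)
    simp only [Finset.sum_filter, List.ofFn_succ, applyAll] at ih' ⊢
    rw [Fin.sum_univ_succ, add_comm]
    congr 1
    · rw [← leftMul_apply, ← ih', map_sum, Finset.smul_sum]
      refine Finset.sum_congr rfl fun k _ => ?_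
      rw [Fin.val_succ, replaceBlock_succ, tens_cons, Fin.sum_univ_succ]
      simp only [Fin.succ_lt_succ_iff, Fin.succ_pos, if_true, sgn_add, map_smul,
        leftMul_apply, smul_smul]
      rfl
    · simp [replaceBlock_zero, tens_letters]

theorem shuffleSum_word (h : DirectSum.IsInternal gr) {u v : List (Fin n)}
    (huv : (u ++ v).Pairwise (· < ·)) :
    shuffleSum K (degs γ) u v (fun l => word (l.map γ)) =
      shuffleProd h (word (u.map γ)) (word (v.map γ)) := by
  induction u generalizing v with
  | nil => simp [shuffleSum_nil_left (v := v) _ huv]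
  | cons a u ihu =>
    induction v with
    | nil => simp [shuffleSum_nil_right _ (List.append_nil _ ▸ huv)]
    | cons b v ihv =>
      have ihu := congrArg (leftMul K ((γ a).2 : V)) (ihu (List.pairwise_cons.1 huv).2)
      have ihv := congrArg (leftMul K ((γ b).2 : V))
        (ihv (huv.sublist ((List.sublist_cons_self b v).append_left _)))
      simp only [map_shuffleSum, leftMul_apply, List.map_cons, word_cons] at ihu ihv
      rw [shuffleSum_cons _ huv]
      simp only [List.map_cons, word_cons]
      rw [shuffleProd_cons h (γ a).2.2 (word_mem_tensorGr _) (γ b).2.2, ihu, ihv, wordDegree_map]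
      simp [degs]

end WordOperations

section WordBrackets

variable {K : Type*} [Field K] {V : Type*} [AddCommGroup V] [Module K V]
  {gr : ℤ → Submodule K V}

namespace ShiftedABAlgebra

variable {k : ℤ} (O : ShiftedABAlgebra gr k) {n : ℕ} (γ : Fin n → Homog gr)

theorem applyAll_add_contract (l : List (Fin n)) :
    applyAll γ (fun i => O.d (γ i).2) l +
      contract γ (fun _ _ => True) (fun i j => O.μ (γ i).2 (γ j).2) 1 l =
    O.tensorD (word (l.map γ)) := by
  induction l with
  | nil => simp [applyAll, contract]
  | cons i l ih =>
    have hmerge : contractHead γ (fun _ _ => True) (fun i j => O.μ (γ i).2 (γ j).2) i l =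
        O.merge (γ i).2 (word (l.map γ)) := by
      cases l <;> simp [contractHead]
    rw [List.map_cons, word_cons, O.tensorD_cons (γ i).2.2, ← ih, applyAll, contract, hmerge,
      one_mul, mul_add, smul_add]
    abel

variable (c : Fin n → Prop) [DecidablePred c]

/-- The signed sum over all brackets of a letter satisfying `c` with an adjacent letter on its
right not satisfying `c`. The factor `sgn K (k * (γ i).1)` turns `β` into the bracket `ℓ`. -/
noncomputable def bracketAcross : List (Fin n) → TensorAlgebra K V :=
  contract γ (fun i j => c i ∧ ¬ c j)
    (fun i j => sgn K (k * (γ i).1) • O.β (γ i).2 (γ j).2) (k + 1)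

variable {c}

theorem bracketAcross_eq_zero {l : List (Fin n)} (hl : (∀ x ∈ l, c x) ∨ ∀ x ∈ l, ¬ c x) :
    O.bracketAcross γ c l = 0 := by
  rw [bracketAcross]
  induction l with
  | nil => rfl
  | cons i l ih =>
    rw [contract, ih (hl.imp List.forall_mem_of_forall_mem_cons List.forall_mem_of_forall_mem_cons)]
    cases l with
    | nil => simp [contractHead]
    | cons j l =>
      have hij : ¬ (c i ∧ ¬ c j) := by
        rcases hl with hl | hl
        · exact fun h => h.2 (hl j (by simp))
        · exact fun h => hl i (by simp) h.1
      simp [contractHead, hij]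

variable {a b : Fin n} {u v : List (Fin n)}

theorem bracketAcross_cons_of_not (hb : ¬ c b) (l : List (Fin n)) :
    O.bracketAcross γ c (b :: l) =
      sgn K ((k + 1) * (γ b).1) • (TensorAlgebra.ι K ((γ b).2 : V) * O.bracketAcross γ c l) := by
  cases l <;> simp [bracketAcross, contract, contractHead, hb]

theorem shuffleSum_contractHead (E : Fin n → Fin n → V) (h : (u ++ b :: v).Pairwise (· < ·))
    (ha : c a) (hu : ∀ x ∈ u, c x) (hb : ¬ c b) :
    shuffleSum K (degs γ) u (b :: v) (contractHead γ (fun i j => c i ∧ ¬ c j) E a) =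
      sgn K (wordDegree (u.map γ) * (γ b).1) •
        (TensorAlgebra.ι K (E a b) *
          shuffleProd O.graded (word (u.map γ)) (word (v.map γ))) := by
  cases u with
  | nil => simp [shuffleSum_nil_left (v := b :: v) _ h, contractHead, ha, hb]
  | cons a' u =>
    have hword := congrArg (leftMul K (E a b)) (shuffleSum_word γ O.graded
      (h.sublist ((List.sublist_cons_self b v).append_left _)))
    simp only [map_shuffleSum, leftMul_apply] at hword
    rw [shuffleSum_cons _ h, wordDegree_map, mul_comm, ← hword]
    simp [contractHead, ha, hb, hu a', shuffleSum_zero, degs]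

theorem shuffleSum_bracketAcross (huv : (u ++ v).Pairwise (· < ·)) (hu : ∀ x ∈ u, c x)
    (hv : ∀ x ∈ v, ¬ c x) :
    shuffleSum K (degs γ) u v (O.bracketAcross γ c) =
      sgn K (k * wordDegree (u.map γ)) • O.tensorBr (word (u.map γ)) (word (v.map γ)) := by
  induction u generalizing v with
  | nil => simp [shuffleSum_nil_left (v := v) _ huv, O.bracketAcross_eq_zero γ (Or.inr hv)]
  | cons a u ihu =>
    induction v with
    | nil =>
      simp [shuffleSum_nil_right _ (List.append_nil _ ▸ huv),
        O.bracketAcross_eq_zero γ (Or.inl hu)]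
    | cons b v ihv =>
      obtain ⟨ha, hu'⟩ := List.forall_mem_cons.1 hu
      obtain ⟨hb, hv'⟩ := List.forall_mem_cons.1 hv
      have huv' := (List.pairwise_cons.1 huv).2
      have ihu := ihu huv' hu' hv
      have ihv := ihv (huv.sublist ((List.sublist_cons_self b v).append_left _)) hv'
      have hsum_a : shuffleSum K (degs γ) u (b :: v) (fun l => O.bracketAcross γ c (a :: l)) =
          (sgn K ((k + 1) * (γ a).1) • leftMul K ((γ a).2 : V))
              (shuffleSum K (degs γ) u (b :: v) (O.bracketAcross γ c)) +
            shuffleSum K (degs γ) u (b :: v) (contractHead γ (fun i j => c i ∧ ¬ c j)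
              (fun i j => sgn K (k * (γ i).1) • O.β (γ i).2 (γ j).2) a) := by
        rw [map_shuffleSum, ← shuffleSum_add]
        rfl
      have hsum_b : shuffleSum K (degs γ) (a :: u) v (fun l => O.bracketAcross γ c (b :: l)) =
          (sgn K ((k + 1) * (γ b).1) • leftMul K ((γ b).2 : V))
            (shuffleSum K (degs γ) (a :: u) v (O.bracketAcross γ c)) := by
        simp only [map_shuffleSum, O.bracketAcross_cons_of_not γ hb]
        rfl
      rw [shuffleSum_cons _ huv, hsum_a, hsum_b, ihu, ihv,
        shuffleSum_contractHead O γ _ huv' ha hu' hb, ← wordDegree_map]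
      simp only [List.map_cons, word_cons, wordDegree_cons, degs, LinearMap.smul_apply, map_smul,
        leftMul_apply, smul_mul_assoc]
      rw [O.tensorBr_cons (γ a).2.2 (word_mem_tensorGr _) (γ b).2.2]
      match_scalars <;> simp only [sgn_add, mul_add, add_mul, mul_one, one_mul] <;> ring_nf
      simp

end ShiftedABAlgebra

variable (h : DirectSum.IsInternal gr)

theorem sum_degs {n : ℕ} (α : Fin n → Homog gr) :
    ∑ i, degs α i = wordDegree ((List.finRange n).map α) := by
  rw [wordDegree_map, ← List.ofFn_id, List.map_ofFn, List.sum_ofFn]; rfl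

theorem packetOf_eq {n : ℕ} (α : Fin n → Homog gr) :
    packetOf α = (shuffleSubmodule gr).mkQ (word ((List.finRange n).map α)) := by
  rw [packetOf, packet, tens_letters]; rfl

theorem symProdOf_eq {n : ℕ} (α : Fin n → Homog gr) (l : List (Fin n)) :
    symProdOf α l = (symSubmodule gr).mkQ (word (l.map α)) := by
  rw [symProdOf, symProd, tens_letters]; rfl

theorem exists_map_finRange (l : List (Homog gr)) :
    ∃ (n : ℕ) (α : Fin n → Homog gr), (List.finRange n).map α = l :=
  ⟨l.length, l.get, by rw [← List.ofFn_id, List.map_ofFn]; exact List.ofFn_get l⟩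

theorem map_firstPlaces {p q : ℕ} (α : Fin p → Homog gr) (β : Fin q → Homog gr) :
    (firstPlaces p q).map (Fin.append α β) = (List.finRange p).map α := by
  simp [firstPlaces, Function.comp_def]

theorem map_lastPlaces {p q : ℕ} (α : Fin p → Homog gr) (β : Fin q → Homog gr) :
    (lastPlaces p q).map (Fin.append α β) = (List.finRange q).map β := by
  simp [lastPlaces, Function.comp_def]

theorem bat_eq_shuffleProd {p q : ℕ} (α : Fin p → Homog gr) (β : Fin q → Homog gr) :
    bat α β =
      shuffleProd h (word ((List.finRange p).map α)) (word ((List.finRange q).map β)) := by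
  classical
  have hword := shuffleSum_word (Fin.append α β) h (pairwise_firstPlaces_append_lastPlaces p q)
  rw [map_firstPlaces, map_lastPlaces, ← sum_isShuffle] at hword
  simp only [bat, tens_letters, ← hword]

end WordBrackets

/-! ### Packets -/

section WordClasses

variable {K : Type*} [Field K] {V : Type*} [AddCommGroup V] [Module K V]
  {gr : ℤ → Submodule K V} {M : Type*} [AddCommGroup M] [Module K M]

theorem map_tensorGr (φ : TensorAlgebra K V →ₗ[K] M) (n : ℤ) :
    (tensorGr gr n).map φ = Submodule.span K {X | ∃ (m : ℕ) (α : Fin m → Homog gr),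
      ∑ i, degs α i = n ∧ X = φ (word ((List.finRange m).map α))} := by
  rw [tensorGr, Submodule.map_span]
  congr 1
  ext X
  constructor
  · rintro ⟨_, ⟨l, hl, rfl⟩, rfl⟩
    obtain ⟨m, α, rfl⟩ := exists_map_finRange l
    exact ⟨m, α, by rw [sum_degs, hl], rfl⟩
  · rintro ⟨m, α, hα, rfl⟩
    exact ⟨_, ⟨_, by rw [← hα, sum_degs], rfl⟩, rfl⟩

theorem span_map_word (h : DirectSum.IsInternal gr) {φ : TensorAlgebra K V →ₗ[K] M}
    (hφ : Function.Surjective φ) :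
    Submodule.span K (Set.range fun α : (Σ n : ℕ, Fin n → Homog gr) =>
      φ (word ((List.finRange α.1).map α.2))) = ⊤ := by
  rw [eq_top_iff, ← LinearMap.range_eq_top.2 hφ, ← Submodule.map_top, ← span_range_word h,
    Submodule.map_span, Submodule.span_le]
  rintro _ ⟨_, ⟨l, rfl⟩, rfl⟩
  obtain ⟨n, α, rfl⟩ := exists_map_finRange l
  exact Submodule.subset_span ⟨⟨n, α⟩, rfl⟩

theorem span_packetOf (h : DirectSum.IsInternal gr) :
    Submodule.span K (Set.range fun α : (Σ n : ℕ, Fin n → Homog gr) => packetOf α.2) = ⊤ := by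
  simpa only [packetOf_eq] using span_map_word h (Submodule.mkQ_surjective (shuffleSubmodule gr))

theorem span_symProdOf (h : DirectSum.IsInternal gr) :
    Submodule.span K (Set.range fun α : (Σ n : ℕ, Fin n → Homog gr) =>
      symProdOf α.2 (List.finRange α.1)) = ⊤ := by
  simpa only [symProdOf_eq] using span_map_word h (Submodule.mkQ_surjective (symSubmodule gr))

theorem packetGr_eq_map (n : ℤ) :
    packetGr gr n = (tensorGr gr n).map (shuffleSubmodule gr).mkQ := by
  simp only [packetGr, packetOf_eq, map_tensorGr]

theorem symGr_eq_map (n : ℤ) : symGr gr n = (tensorGr gr n).map (symSubmodule gr).mkQ := by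
  simp only [symGr, symProdOf_eq, map_tensorGr]

variable (gr) in
/-- The span of the words of positive length. -/
def positiveTensors : Submodule K (TensorAlgebra K V) :=
  Submodule.span K {t | ∃ l : List (Homog gr), l ≠ [] ∧ t = word l}

theorem word_mem_positiveTensors {l : List (Homog gr)} (hl : l ≠ []) :
    word l ∈ positiveTensors gr :=
  Submodule.subset_span ⟨l, hl, rfl⟩

variable (h : DirectSum.IsInternal gr)
include h

theorem isInternal_packetGr : DirectSum.IsInternal (packetGr gr) := by
  rw [funext packetGr_eq_map]
  refine isInternal_map_mkQ_tensorGr h ?_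
  rintro r (rfl | ⟨p, q, α, β, -, -, rfl⟩)
  · exact ⟨0, word_mem_tensorGr []⟩
  · rw [bat_eq_shuffleProd h]
    exact ⟨_, shuffleProd_mem h (word_mem_tensorGr _) (word_mem_tensorGr _)⟩

theorem ι_mul_mem_positiveTensors {i : ℤ} {a : V} (ha : a ∈ gr i) (t : TensorAlgebra K V) :
    TensorAlgebra.ι K a * t ∈ positiveTensors gr := by
  suffices ⊤ ≤ (positiveTensors gr).comap (leftMul K a) from this Submodule.mem_top
  rw [← span_range_word h, Submodule.span_le]
  rintro _ ⟨l, rfl⟩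
  exact word_mem_positiveTensors (l := ⟨i, a, ha⟩ :: l) (by simp)

theorem shuffleProd_mem_shuffleSubmodule {X Y : TensorAlgebra K V} (hX : X ∈ positiveTensors gr)
    (hY : Y ∈ positiveTensors gr) : shuffleProd h X Y ∈ shuffleSubmodule gr := by
  refine Submodule.map₂_le.1 (?_ : Submodule.map₂ (shuffleProd h) _ _ ≤ _) X hX Y hY
  rw [positiveTensors, Submodule.map₂_span_span, Submodule.span_le]
  rintro _ ⟨_, ⟨u, hu, rfl⟩, _, ⟨v, hv, rfl⟩, rfl⟩
  obtain ⟨p, α, rfl⟩ := exists_map_finRange u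
  obtain ⟨q, β, rfl⟩ := exists_map_finRange v
  refine Submodule.subset_span (Or.inr ⟨p, q, α, β, ?_, ?_, (bat_eq_shuffleProd h α β).symm⟩) <;>
    exact Nat.one_le_iff_ne_zero.2 (by rintro rfl; simp at hu hv)

theorem shuffleSubmodule_le {N : Submodule K (TensorAlgebra K V)} (one : 1 ∈ N)
    (shuffle : ∀ u v : List (Homog gr), u ≠ [] → v ≠ [] → shuffleProd h (word u) (word v) ∈ N) :
    shuffleSubmodule gr ≤ N := by
  refine Submodule.span_le.2 ?_
  rintro _ (rfl | ⟨p, q, α, β, hp, hq, rfl⟩)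
  · exact one
  · rw [bat_eq_shuffleProd h]
    refine shuffle _ _ ?_ ?_ <;>
      simp only [ne_eq, List.map_eq_nil_iff, List.finRange_eq_nil_iff] <;> omega

end WordClasses

section Packets

variable {K : Type*} [Field K] {V : Type*} [AddCommGroup V] [Module K V]
  {gr : ℤ → Submodule K V}

namespace ShiftedABAlgebra

variable {k : ℤ} (O : ShiftedABAlgebra gr k)

theorem merge_mem_positiveTensors (a : Homog gr) (l : List (Homog gr)) :
    O.merge a.2 (word l) ∈ positiveTensors gr := by
  cases l with
  | nil => simp
  | cons b l =>
    rw [word_cons, merge_ι_mul]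
    exact ι_mul_mem_positiveTensors O.graded (O.μ_mem a.2.2 b.2.2) _

theorem tensorD_mem_positiveTensors (l : List (Homog gr)) :
    O.tensorD (word l) ∈ positiveTensors gr := by
  cases l with
  | nil => simp
  | cons a l =>
    rw [word_cons, O.tensorD_cons a.2.2]
    exact add_mem (add_mem (ι_mul_mem_positiveTensors O.graded (O.d_mem a.2.2) _)
      (Submodule.smul_mem _ _ (ι_mul_mem_positiveTensors O.graded a.2.2 _)))
      (O.merge_mem_positiveTensors a l)

theorem tensorBr_mem_positiveTensors (u v : List (Homog gr)) :
    O.tensorBr (word u) (word v) ∈ positiveTensors gr := by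
  cases u with
  | nil => simp
  | cons a u =>
    cases v with
    | nil => simp
    | cons b v =>
      rw [word_cons, word_cons, O.tensorBr_cons a.2.2 (word_mem_tensorGr u) b.2.2]
      exact add_mem (add_mem
        (Submodule.smul_mem _ _ (ι_mul_mem_positiveTensors O.graded (O.β_mem a.2.2 b.2.2) _))
        (Submodule.smul_mem _ _ (ι_mul_mem_positiveTensors O.graded a.2.2 _)))
        (Submodule.smul_mem _ _ (ι_mul_mem_positiveTensors O.graded b.2.2 _))

theorem shuffleSubmodule_le_comap_tensorD :
    shuffleSubmodule gr ≤ (shuffleSubmodule gr).comap O.tensorD := by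
  refine shuffleSubmodule_le O.graded (by simp) fun u v hu hv => ?_
  rw [Submodule.mem_comap, O.tensorD_shuffleProd_word]
  exact add_mem
    (shuffleProd_mem_shuffleSubmodule _ (O.tensorD_mem_positiveTensors u)
      (word_mem_positiveTensors hv))
    (Submodule.smul_mem _ _ (shuffleProd_mem_shuffleSubmodule _ (word_mem_positiveTensors hu)
      (O.tensorD_mem_positiveTensors v)))

theorem tensorBr_shuffleProd_mem_shuffleSubmodule {u v : List (Homog gr)} (hu : u ≠ [])
    (hv : v ≠ []) (w : List (Homog gr)) :
    O.tensorBr (shuffleProd O.graded (word u) (word v)) (word w) ∈ shuffleSubmodule gr := by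
  rw [O.tensorBr_shuffleProd_word]
  exact add_mem
    (Submodule.smul_mem _ _ (shuffleProd_mem_shuffleSubmodule _ (word_mem_positiveTensors hu)
      (O.tensorBr_mem_positiveTensors v w)))
    (Submodule.smul_mem _ _ (shuffleProd_mem_shuffleSubmodule _
      (O.tensorBr_mem_positiveTensors u w) (word_mem_positiveTensors hv)))

theorem shuffleSubmodule_le_ker_tensorBr :
    shuffleSubmodule gr ≤ LinearMap.ker (O.tensorBr.compr₂ (shuffleSubmodule gr).mkQ) := by
  refine shuffleSubmodule_le O.graded (by ext; simp) fun u v hu hv => ?_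
  refine linearMap_ext_word O.graded fun w => (Submodule.Quotient.mk_eq_zero _).2 ?_
  exact O.tensorBr_shuffleProd_mem_shuffleSubmodule hu hv w

theorem shuffleSubmodule_le_ker_tensorBr_flip :
    shuffleSubmodule gr ≤ LinearMap.ker (O.tensorBr.compr₂ (shuffleSubmodule gr).mkQ).flip := by
  refine shuffleSubmodule_le O.graded (by ext; simp) fun u v hu hv => ?_
  refine linearMap_ext_word O.graded fun w => (Submodule.Quotient.mk_eq_zero _).2 ?_
  rw [O.tensorBr_comm (word_mem_tensorGr w)
    (shuffleProd_mem O.graded (word_mem_tensorGr u) (word_mem_tensorGr v))]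
  exact Submodule.smul_mem _ _ (O.tensorBr_shuffleProd_mem_shuffleSubmodule hu hv w)

/-- The differential on packets. -/
noncomputable def packetD : Packets gr →ₗ[K] Packets gr :=
  (shuffleSubmodule gr).mapQ _ O.tensorD O.shuffleSubmodule_le_comap_tensorD

/-- The bracket on packets. -/
noncomputable def packetBr : Packets gr →ₗ[K] Packets gr →ₗ[K] Packets gr :=
  (O.tensorBr.compr₂ (shuffleSubmodule gr).mkQ).liftQ₂ _ _ O.shuffleSubmodule_le_ker_tensorBr
    O.shuffleSubmodule_le_ker_tensorBr_flip

@[simp] theorem packetD_mkQ (X : TensorAlgebra K V) :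
    O.packetD ((shuffleSubmodule gr).mkQ X) = (shuffleSubmodule gr).mkQ (O.tensorD X) := rfl

@[simp] theorem packetBr_mkQ (X Y : TensorAlgebra K V) :
    O.packetBr ((shuffleSubmodule gr).mkQ X) ((shuffleSubmodule gr).mkQ Y) =
      (shuffleSubmodule gr).mkQ (O.tensorBr X Y) := rfl

theorem tensorD_tensorD (X : TensorAlgebra K V) : O.tensorD (O.tensorD X) = 0 := by
  suffices O.tensorD ∘ₗ O.tensorD = 0 from congr($this X)
  exact linearMap_ext_word O.graded fun l => by simpa using O.tensorD_tensorD_word l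

theorem tensorD_tensorBr {m : ℤ} {X : TensorAlgebra K V} (hX : X ∈ tensorGr gr m)
    (Y : TensorAlgebra K V) :
    O.tensorD (O.tensorBr X Y) =
      -O.tensorBr (O.tensorD X) Y - sgn K (m + k) • O.tensorBr X (O.tensorD Y) := by
  refine eqOn_tensorGr (F := O.tensorD ∘ₗ O.tensorBr.flip Y)
    (G := -(O.tensorBr.flip Y ∘ₗ O.tensorD) -
      sgn K (m + k) • O.tensorBr.flip (O.tensorD Y)) ?_ hX
  rintro u rfl
  suffices O.tensorD ∘ₗ O.tensorBr (word u) = -O.tensorBr (O.tensorD (word u)) -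
      sgn K (wordDegree u + k) • O.tensorBr (word u) ∘ₗ O.tensorD by simpa using congr($this Y)
  exact linearMap_ext_word O.graded fun v => by simpa using O.tensorD_tensorBr_word u v

theorem tensorBr_jacobi {m n l : ℤ} {X Y Z : TensorAlgebra K V} (hX : X ∈ tensorGr gr m)
    (hY : Y ∈ tensorGr gr n) (hZ : Z ∈ tensorGr gr l) :
    sgn K ((m + k) * (l + k)) • O.tensorBr (O.tensorBr X Y) Z +
      sgn K ((n + k) * (m + k)) • O.tensorBr (O.tensorBr Y Z) X +
      sgn K ((l + k) * (n + k)) • O.tensorBr (O.tensorBr Z X) Y = 0 := by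
  refine eqOn_tensorGr (F := sgn K ((m + k) * (l + k)) • O.tensorBr (O.tensorBr X Y) +
      sgn K ((n + k) * (m + k)) • (O.tensorBr.flip X ∘ₗ O.tensorBr Y) +
      sgn K ((l + k) * (n + k)) • (O.tensorBr.flip Y ∘ₗ O.tensorBr.flip X)) (G := 0) ?_ hZ
  rintro w rfl
  simp only [LinearMap.add_apply, LinearMap.smul_apply, LinearMap.comp_apply,
    LinearMap.flip_apply, LinearMap.zero_apply]
  refine eqOn_tensorGr
    (F := sgn K ((m + k) * (wordDegree w + k)) • (O.tensorBr.flip (word w) ∘ₗ O.tensorBr X) +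
      sgn K ((n + k) * (m + k)) • (O.tensorBr.flip X ∘ₗ O.tensorBr.flip (word w)) +
      sgn K ((wordDegree w + k) * (n + k)) • O.tensorBr (O.tensorBr (word w) X)) (G := 0) ?_ hY
  rintro v rfl
  simp only [LinearMap.add_apply, LinearMap.smul_apply, LinearMap.comp_apply,
    LinearMap.flip_apply, LinearMap.zero_apply]
  refine eqOn_tensorGr (F := sgn K ((m + k) * (wordDegree w + k)) •
        (O.tensorBr.flip (word w) ∘ₗ O.tensorBr.flip (word v)) +
      sgn K ((wordDegree v + k) * (m + k)) • O.tensorBr (O.tensorBr (word v) (word w)) +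
      sgn K ((wordDegree w + k) * (wordDegree v + k)) •
        (O.tensorBr.flip (word v) ∘ₗ O.tensorBr (word w))) (G := 0) ?_ hX
  rintro u rfl
  exact O.tensorBr_word_jacobi u v w

theorem packetD_packetD (X : Packets gr) : O.packetD (O.packetD X) = 0 := by
  obtain ⟨X, rfl⟩ := Submodule.mkQ_surjective _ X
  rw [packetD_mkQ, packetD_mkQ, tensorD_tensorD, map_zero]

variable {m n l : ℤ} {X Y Z : Packets gr}

theorem packetD_mem (hX : X ∈ packetGr gr m) : O.packetD X ∈ packetGr gr (m + 1) := by
  rw [packetGr_eq_map] at hX ⊢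
  obtain ⟨X, hX, rfl⟩ := hX
  exact ⟨_, O.tensorD_mem hX, rfl⟩

theorem packetBr_mem (hX : X ∈ packetGr gr m) (hY : Y ∈ packetGr gr n) :
    O.packetBr X Y ∈ packetGr gr (m + n + (k + 1)) := by
  rw [packetGr_eq_map] at hX hY ⊢
  obtain ⟨X, hX, rfl⟩ := hX
  obtain ⟨Y, hY, rfl⟩ := hY
  exact ⟨_, O.tensorBr_mem hX hY, rfl⟩

theorem packetBr_comm (hX : X ∈ packetGr gr m) (hY : Y ∈ packetGr gr n) :
    O.packetBr X Y = sgn K ((m + k) * (n + k)) • O.packetBr Y X := by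
  rw [packetGr_eq_map] at hX hY
  obtain ⟨X, hX, rfl⟩ := hX
  obtain ⟨Y, hY, rfl⟩ := hY
  rw [packetBr_mkQ, packetBr_mkQ, O.tensorBr_comm hX hY, map_smul]

theorem packetD_packetBr (hX : X ∈ packetGr gr m) (Y : Packets gr) :
    O.packetD (O.packetBr X Y) =
      -O.packetBr (O.packetD X) Y - sgn K (m + k) • O.packetBr X (O.packetD Y) := by
  rw [packetGr_eq_map] at hX
  obtain ⟨X, hX, rfl⟩ := hX
  obtain ⟨Y, rfl⟩ := Submodule.mkQ_surjective _ Y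
  simp only [packetBr_mkQ, packetD_mkQ, O.tensorD_tensorBr hX, map_sub, map_neg, map_smul]

theorem packetBr_jacobi (hX : X ∈ packetGr gr m) (hY : Y ∈ packetGr gr n)
    (hZ : Z ∈ packetGr gr l) :
    sgn K ((m + k) * (l + k)) • O.packetBr (O.packetBr X Y) Z +
      sgn K ((n + k) * (m + k)) • O.packetBr (O.packetBr Y Z) X +
      sgn K ((l + k) * (n + k)) • O.packetBr (O.packetBr Z X) Y = 0 := by
  rw [packetGr_eq_map] at hX hY hZ
  obtain ⟨X, hX, rfl⟩ := hX
  obtain ⟨Y, hY, rfl⟩ := hY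
  obtain ⟨Z, hZ, rfl⟩ := hZ
  have h := congrArg (shuffleSubmodule gr).mkQ (O.tensorBr_jacobi hX hY hZ)
  simp only [map_add, map_smul, map_zero] at h
  exact h

end ShiftedABAlgebra

end Packets

namespace DiffABAlgebra

variable {K A : Type*} [Field K] [AddCommGroup A] [Module K A] {a b : ℤ}
  (P : DiffABAlgebra K A a b)

theorem isInternal_grV : DirectSum.IsInternal P.grV := isInternal_shift P.graded _

/-- The bilinear map `(α, β) ↦ (-1)^{dg α} α.β` on `A[-a+1]`, a product of degree `1`. -/
noncomputable def shiftedMul : A →ₗ[K] A →ₗ[K] A := P.mul ∘ₗ signMap P.isInternal_grV 1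

/-- The bilinear map `(α, β) ↦ (-1)^{dg α} [α, β]` on `A[-a+1]`, a bracket of degree
`b - a + 1`. -/
noncomputable def shiftedBr : A →ₗ[K] A →ₗ[K] A := P.br ∘ₗ signMap P.isInternal_grV 1

variable {i j l : ℤ} {x y z : A}

theorem shiftedMul_apply (hx : x ∈ P.grV i) (y : A) :
    P.shiftedMul x y = sgn K i • P.mul x y := by
  simp [shiftedMul, signMap_apply _ _ hx]

theorem shiftedBr_apply (hx : x ∈ P.grV i) (y : A) :
    P.shiftedBr x y = sgn K i • P.br x y := by
  simp [shiftedBr, signMap_apply _ _ hx]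

theorem mem_grV_of_eq (hx : x ∈ P.gr i) (hij : i = j + (-a + 1)) : x ∈ P.grV j := by
  subst hij; exact hx

theorem d_mem_grV (hx : x ∈ P.grV i) : P.d x ∈ P.grV (i + 1) :=
  P.mem_grV_of_eq (P.d_mem hx) (by ring)

theorem mul_mem_grV (hx : x ∈ P.grV i) (hy : y ∈ P.grV j) : P.mul x y ∈ P.grV (i + j + 1) :=
  P.mem_grV_of_eq (P.mul_mem hx hy) (by ring)

theorem br_mem_grV (hx : x ∈ P.grV i) (hy : y ∈ P.grV j) :
    P.br x y ∈ P.grV (i + j + (b - a) + 1) :=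
  P.mem_grV_of_eq (P.br_mem hx hy) (by ring)

theorem shiftedMul_mem (hx : x ∈ P.grV i) (hy : y ∈ P.grV j) :
    P.shiftedMul x y ∈ P.grV (i + j + 1) := by
  rw [P.shiftedMul_apply hx]
  exact Submodule.smul_mem _ _ (P.mul_mem_grV hx hy)

theorem shiftedBr_mem (hx : x ∈ P.grV i) (hy : y ∈ P.grV j) :
    P.shiftedBr x y ∈ P.grV (i + j + (b - a) + 1) := by
  rw [P.shiftedBr_apply hx]
  exact Submodule.smul_mem _ _ (P.br_mem_grV hx hy)

theorem shiftedMul_comm (hx : x ∈ P.grV i) (hy : y ∈ P.grV j) :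
    P.shiftedMul x y = -(sgn K (i * j) • P.shiftedMul y x) := by
  have hdeg (i : ℤ) : i + (-a + 1) + a = i + 1 := by ring
  rw [P.shiftedMul_apply hx, P.shiftedMul_apply hy, P.mul_comm hx hy, negOnePow_smul (R := K),
    hdeg, hdeg]
  match_scalars
  simp only [sgn_add, mul_add, add_mul, mul_one, sgn_one]
  ring_nf
  simp

theorem shiftedMul_assoc (y z : A) (hx : x ∈ P.grV i) :
    P.shiftedMul (P.shiftedMul x y) z = -(sgn K i • P.shiftedMul x (P.shiftedMul y z)) := by
  suffices P.shiftedMul.flip z ∘ₗ P.shiftedMul x =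
      -(sgn K i • P.shiftedMul x ∘ₗ P.shiftedMul.flip z) from congr($this y)
  refine linearMap_ext_homogeneous P.isInternal_grV fun j y hy => ?_
  simp only [LinearMap.comp_apply, LinearMap.flip_apply, LinearMap.neg_apply,
    LinearMap.smul_apply, P.shiftedMul_apply hx, P.shiftedMul_apply hy, map_smul,
    P.shiftedMul_apply (P.mul_mem_grV hx hy), P.mul_assoc]
  match_scalars
  simp only [sgn_add, sgn_one]
  ring_nf

theorem d_shiftedMul (y : A) (hx : x ∈ P.grV i) :
    P.d (P.shiftedMul x y) = -P.shiftedMul (P.d x) y - sgn K i • P.shiftedMul x (P.d y) := by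
  have hdeg : i + (-a + 1) + a = i + 1 := by ring
  rw [P.shiftedMul_apply hx, P.shiftedMul_apply hx, P.shiftedMul_apply (P.d_mem_grV hx), map_smul,
    P.d_mul y hx, negOnePow_smul (R := K), hdeg]
  match_scalars <;> simp [sgn_add]

theorem shiftedBr_comm (hx : x ∈ P.grV i) (hy : y ∈ P.grV j) :
    P.shiftedBr x y = sgn K ((i + (b - a)) * (j + (b - a))) • P.shiftedBr y x := by
  have hdeg (i : ℤ) : i + (-a + 1) + b = i + (b - a) + 1 := by ring
  rw [P.shiftedBr_apply hx, P.shiftedBr_apply hy, P.br_antisymm hx hy, negOnePow_smul (R := K),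
    hdeg, hdeg]
  generalize b - a = k
  match_scalars
  simp only [sgn_add, mul_add, add_mul, mul_one, one_mul, sgn_one]
  ring_nf
  simp

theorem d_shiftedBr (y : A) (hx : x ∈ P.grV i) :
    P.d (P.shiftedBr x y) =
      -P.shiftedBr (P.d x) y - sgn K (i + (b - a)) • P.shiftedBr x (P.d y) := by
  have hdeg : i + (-a + 1) + b = i + (b - a) + 1 := by ring
  rw [P.shiftedBr_apply hx, P.shiftedBr_apply hx, P.shiftedBr_apply (P.d_mem_grV hx), map_smul,
    P.d_br y hx, negOnePow_smul (R := K), hdeg]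
  match_scalars
  · simp [sgn_add]
  · simp only [sgn_add, sgn_one]
    ring_nf

theorem shiftedBr_shiftedMul (z : A) (hx : x ∈ P.grV i) (hy : y ∈ P.grV j) :
    P.shiftedBr x (P.shiftedMul y z) =
      sgn K (i + (b - a) + 1) • P.shiftedMul (P.shiftedBr x y) z +
        sgn K ((j + 1) * (i + (b - a) + 1)) • P.shiftedMul y (P.shiftedBr x z) := by
  have hdeg_mul (i : ℤ) : i + (-a + 1) + a = i + 1 := by ring
  have hdeg_br (i : ℤ) : i + (-a + 1) + b = i + (b - a) + 1 := by ring
  simp only [P.shiftedBr_apply hx, P.shiftedMul_apply hy, map_smul, LinearMap.smul_apply,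
    P.shiftedMul_apply (P.br_mem_grV hx hy), P.leibniz z hx hy, negOnePow_smul (R := K), hdeg_mul,
    hdeg_br]
  generalize b - a = k
  match_scalars <;> simp only [sgn_add, mul_add, add_mul, mul_one, one_mul] <;> ring_nf
  simp

theorem shiftedBr_jacobi (hx : x ∈ P.grV i) (hy : y ∈ P.grV j) (hz : z ∈ P.grV l) :
    sgn K ((i + (b - a)) * (l + (b - a))) • P.shiftedBr (P.shiftedBr x y) z +
      sgn K ((j + (b - a)) * (i + (b - a))) • P.shiftedBr (P.shiftedBr y z) x +
      sgn K ((l + (b - a)) * (j + (b - a))) • P.shiftedBr (P.shiftedBr z x) y = 0 := by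
  have hdeg (i : ℤ) : i + (-a + 1) + b = i + (b - a) + 1 := by ring
  have hP := P.jacobi hx hy hz
  simp only [negOnePow_smul (R := K), hdeg] at hP
  simp only [P.shiftedBr_apply hx, P.shiftedBr_apply hy, P.shiftedBr_apply hz, map_smul,
    LinearMap.smul_apply, P.shiftedBr_apply (P.br_mem_grV hx hy),
    P.shiftedBr_apply (P.br_mem_grV hy hz), P.shiftedBr_apply (P.br_mem_grV hz hx)]
  generalize b - a = k at hP ⊢
  linear_combination (norm := skip) sgn K (i + j + l + k) • hP
  match_scalars <;> simp only [sgn_add, mul_add, add_mul, mul_one, one_mul, sgn_one,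
    sgn_mul_self] <;> ring_nf <;> simp only [sgn_sq, sgn_pow_four] <;> ring

/-- The operations of a differential graded `(a,b)`-algebra on the shift `A[-a+1]`. -/
noncomputable def shiftedABAlgebra : ShiftedABAlgebra P.grV (b - a) where
  graded := P.isInternal_grV
  d := P.d
  μ := P.shiftedMul
  β := P.shiftedBr
  d_mem := P.d_mem_grV
  μ_mem := P.shiftedMul_mem
  β_mem := P.shiftedBr_mem
  d_d := P.d_d
  μ_comm := P.shiftedMul_comm
  μ_assoc := P.shiftedMul_assoc
  d_μ := P.d_shiftedMul
  β_comm := P.shiftedBr_comm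
  d_β := P.d_shiftedBr
  β_μ := P.shiftedBr_shiftedMul
  jacobi := P.shiftedBr_jacobi

theorem mu_eq (x y : Homog P.grV) : P.mu x y = P.shiftedMul x.2 y.2 := by
  rw [mu, P.shiftedMul_apply x.2.2, negOnePow_smul (R := K)]

theorem ell_eq (x y : Homog P.grV) :
    P.ell x y = sgn K ((b - a) * x.1) • P.shiftedBr x.2 y.2 := by
  rw [ell, P.shiftedBr_apply x.2.2, negOnePow_smul (R := K), smul_smul, ← sgn_add]
  congr 2
  ring

theorem packetD_packetOf {n : ℕ} (α : Fin n → Homog P.grV) :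
    P.shiftedABAlgebra.packetD (packetOf α) = P.DFormula α := by
  rw [packetOf_eq, ShiftedABAlgebra.packetD_mkQ, ← ShiftedABAlgebra.applyAll_add_contract,
    ← List.ofFn_id, ← sum_applyAll, ← sum_contract, DFormula]
  simp only [map_add, map_sum, map_smul, negOnePow_smul (R := K), and_true, one_mul, mu_eq]
  rfl

theorem D_eq : P.D = P.shiftedABAlgebra.packetD :=
  linearExt_eq (span_packetOf P.isInternal_grV) _ fun α => P.packetD_packetOf α.2

theorem packetBr_packetOf {p q : ℕ} (α : Fin p → Homog P.grV) (β : Fin q → Homog P.grV) :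
    P.shiftedABAlgebra.packetBr (signMap (isInternal_packetGr P.isInternal_grV) (b - a)
      (packetOf α)) (packetOf β) = P.ell2Formula α β := by
  classical
  have hα : packetOf α ∈ packetGr P.grV (wordDegree ((List.finRange p).map α)) :=
    Submodule.subset_span ⟨p, α, sum_degs α, rfl⟩
  have hshuffle := P.shiftedABAlgebra.shuffleSum_bracketAcross (Fin.append α β)
    (c := fun i : Fin (p + q) => (i : ℕ) < p) (pairwise_firstPlaces_append_lastPlaces p q)
    (by simp [firstPlaces]) (by simp [lastPlaces])
  rw [map_firstPlaces, map_lastPlaces, ← sum_isShuffle] at hshuffle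
  rw [signMap_apply _ _ hα, map_smul, LinearMap.smul_apply, packetOf_eq, packetOf_eq,
    ShiftedABAlgebra.packetBr_mkQ, ← map_smul, ← hshuffle, ell2Formula]
  simp only [ShiftedABAlgebra.bracketAcross, ← sum_contract, map_sum, map_smul, Finset.smul_sum,
    not_lt, mul_smul, koszulSign_smul (K := K), negOnePow_smul (R := K), ell_eq]
  rfl

theorem ell2_eq : P.ell2 = P.shiftedABAlgebra.packetBr ∘ₗ
    signMap (isInternal_packetGr P.isInternal_grV) (b - a) :=
  linearExt_eq (span_packetOf P.isInternal_grV) _ fun α =>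
    (linearExt_eq (span_packetOf P.isInternal_grV) _ fun β => P.packetBr_packetOf α.2 β.2).symm

theorem isInternal_gr' : DirectSum.IsInternal P.gr' :=
  isInternal_shift (isInternal_packetGr P.isInternal_grV) _

theorem isInternal_gr'' : DirectSum.IsInternal P.gr'' :=
  isInternal_shift (isInternal_packetGr P.isInternal_grV) _

variable {X Y Z : P.H}

theorem mem_gr'_of_mem_gr'' (hX : X ∈ P.gr'' i) : X ∈ P.gr' (i + 1) := by
  have hdeg : i + 1 + (a - b - 1) = i + (a - b) := by ring
  rw [gr', shift, hdeg]
  exact hX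

theorem ell2''_eq : P.ell2'' = -P.shiftedABAlgebra.packetBr := by
  refine linearMap_ext_homogeneous P.isInternal_gr'' fun i X hX => ?_
  have hX_gr : X ∈ packetGr P.grV (i + (a - b)) := hX
  rw [ell2'', signTwist_eq P.isInternal_gr'', LinearMap.comp_apply, signMap_apply _ _ hX, ell2',
    signTwist_eq P.isInternal_gr', map_smul, LinearMap.comp_apply,
    signMap_apply _ _ (P.mem_gr'_of_mem_gr'' hX), ell2_eq, map_smul, LinearMap.comp_apply,
    signMap_apply _ _ hX_gr, map_smul, smul_smul, smul_smul, LinearMap.neg_apply]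
  match_scalars
  rw [← neg_sub a b]
  generalize a - b = k
  simp only [sgn_add, sgn_sub, sgn_neg, sub_mul, mul_add, neg_mul, mul_one, one_mul, sgn_one,
    sgn_mul_self]
  ring_nf
  simp

theorem ell2''_mem (hX : X ∈ P.gr'' i) (hY : Y ∈ P.gr'' j) :
    P.ell2'' X Y ∈ P.gr'' (i + j + 1) := by
  have hdeg : i + (a - b) + (j + (a - b)) + (b - a + 1) = i + j + 1 + (a - b) := by ring
  have hmem := P.shiftedABAlgebra.packetBr_mem hX hY
  rw [hdeg] at hmem
  rw [ell2''_eq]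
  exact neg_mem hmem

theorem D_mem (hX : X ∈ P.gr'' i) : P.D X ∈ P.gr'' (i + 1) := by
  have hmem := P.shiftedABAlgebra.packetD_mem hX
  rw [add_right_comm] at hmem
  rw [D_eq]
  exact hmem

theorem D_D (X : P.H) : P.D (P.D X) = 0 := by
  rw [D_eq, ShiftedABAlgebra.packetD_packetD]

theorem ell2''_comm (hX : X ∈ P.gr'' i) (hY : Y ∈ P.gr'' j) :
    P.ell2'' X Y = sgn K (i * j) • P.ell2'' Y X := by
  have hdeg (i : ℤ) : i + (a - b) + (b - a) = i := by ring
  simp only [ell2''_eq, LinearMap.neg_apply, P.shiftedABAlgebra.packetBr_comm hX hY, hdeg,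
    smul_neg]

theorem ell2''_jacobi (hX : X ∈ P.gr'' i) (hY : Y ∈ P.gr'' j) (hZ : Z ∈ P.gr'' l) :
    sgn K (i * l) • P.ell2'' (P.ell2'' X Y) Z + sgn K (j * i) • P.ell2'' (P.ell2'' Y Z) X +
      sgn K (l * j) • P.ell2'' (P.ell2'' Z X) Y = 0 := by
  have hdeg (i : ℤ) : i + (a - b) + (b - a) = i := by ring
  have hjacobi := P.shiftedABAlgebra.packetBr_jacobi hX hY hZ
  simp only [hdeg] at hjacobi
  simpa only [ell2''_eq, LinearMap.neg_apply, map_neg, neg_neg] using hjacobi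

theorem D_ell2'' (hX : X ∈ P.gr'' i) (Y : P.H) :
    P.D (P.ell2'' X Y) = -P.ell2'' (P.D X) Y + sgn K (1 + i) • P.ell2'' X (P.D Y) := by
  have hdeg : i + (a - b) + (b - a) = i := by ring
  simp only [ell2''_eq, D_eq, LinearMap.neg_apply, map_neg,
    P.shiftedABAlgebra.packetD_packetBr hX Y, hdeg, sgn_add, sgn_one]
  module

end DiffABAlgebra

/-! ### The graded symmetric algebra -/

section GradedSym

variable {K W M : Type*} [Field K] [AddCommGroup W] [Module K W] [AddCommGroup M] [Module K M]
  {gr : ℤ → Submodule K W}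

variable (gr) in
/-- The ideal of graded commutativity: the span of the elements
`u ⊗ x ⊗ y ⊗ v - (-1)^{|x||y|} u ⊗ y ⊗ x ⊗ v`. -/
def commSubmodule : Submodule K (TensorAlgebra K W) :=
  Submodule.span K {t | ∃ (u v : List W) (x y : Homog gr),
    t = tens (u ++ (x.2 : W) :: (y.2 : W) :: v) -
      (x.1 * y.1).negOnePow • tens (u ++ (y.2 : W) :: (x.2 : W) :: v)}

variable (gr) in
/-- The graded symmetric algebra of `W`; unlike `SymPlus`, it contains the scalars, which makes
recursion on the length of a product possible. -/
abbrev GradedSym : Type _ := TensorAlgebra K W ⧸ commSubmodule gr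

variable (gr) in
theorem ι_mul_mem_commSubmodule (x : W) :
    commSubmodule gr ≤ (commSubmodule gr).comap (leftMul K x) := by
  refine Submodule.span_le.2 ?_
  rintro _ ⟨u, v, y, z, rfl⟩
  refine Submodule.subset_span ⟨x :: u, v, y, z, ?_⟩
  simp only [leftMul_apply, mul_sub, List.cons_append, tens_cons, negOnePow_smul (R := K),
    mul_smul_comm]

/-- Left multiplication of the graded symmetric algebra by elements of `W`. -/
noncomputable def symMul : W →ₗ[K] GradedSym gr →ₗ[K] GradedSym gr :=
  Submodule.mapQLinear (commSubmodule gr) (commSubmodule gr) ∘ₗ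
    (leftMul K).codRestrict _ (ι_mul_mem_commSubmodule gr)

theorem symMul_mkQ (x : W) (t : TensorAlgebra K W) :
    symMul x ((commSubmodule gr).mkQ t) = (commSubmodule gr).mkQ (TensorAlgebra.ι K x * t) := rfl

/-- The unit of the graded symmetric algebra. -/
noncomputable def symOne : GradedSym gr := (commSubmodule gr).mkQ 1

/-- The product of a word of homogeneous letters in the graded symmetric algebra. -/
noncomputable def symWord (l : List (Homog gr)) : GradedSym gr := (commSubmodule gr).mkQ (word l)

@[simp] theorem symWord_nil : symWord ([] : List (Homog gr)) = symOne := rfl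

@[simp] theorem symWord_cons (x : Homog gr) (l : List (Homog gr)) :
    symWord (x :: l) = symMul (gr := gr) x.2 (symWord l) := by
  rw [symWord, word_cons]; rfl

theorem linearMap_ext_symWord (h : DirectSum.IsInternal gr) {F G : GradedSym gr →ₗ[K] M}
    (hFG : ∀ l : List (Homog gr), F (symWord l) = G (symWord l)) : F = G :=
  Submodule.linearMap_qext _ (linearMap_ext_word h hFG)

theorem linearMap_ext_symMul (h : DirectSum.IsInternal gr) {F G : GradedSym gr →ₗ[K] M}
    (one : F symOne = G symOne)
    (mul : ∀ i, ∀ x ∈ gr i, ∀ Y, F Y = G Y → F (symMul x Y) = G (symMul x Y)) : F = G := by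
  refine linearMap_ext_symWord h fun l => ?_
  induction l with
  | nil => exact one
  | cons x l ih => simpa using mul _ _ x.2.2 _ ih

theorem symMul_comm (h : DirectSum.IsInternal gr) {i j : ℤ} {x y : W} (hx : x ∈ gr i)
    (hy : y ∈ gr j) (Y : GradedSym gr) :
    symMul x (symMul y Y) = sgn K (i * j) • symMul y (symMul x Y) := by
  suffices symMul x ∘ₗ symMul y = sgn K (i * j) • (symMul (gr := gr) y ∘ₗ symMul x) from
    congr($this Y)
  refine linearMap_ext_symWord h fun l => ?_
  simp only [LinearMap.comp_apply, LinearMap.smul_apply, symWord, symMul_mkQ, ← map_smul]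
  rw [← sub_eq_zero, ← map_sub]
  refine (Submodule.Quotient.mk_eq_zero _).2 (Submodule.subset_span ?_)
  refine ⟨[], l.map fun x => (x.2 : W), ⟨i, x, hx⟩, ⟨j, y, hy⟩, ?_⟩
  simp [word, negOnePow_smul (R := K)]

section Recursion

variable (g : W →ₗ[K] M →ₗ[K] M) (m : M)

theorem commSubmodule_le_ker_tensorFoldr (hg : ∀ i j, ∀ x ∈ gr i, ∀ y ∈ gr j, ∀ m,
    g x (g y m) = sgn K (i * j) • g y (g x m)) :
    commSubmodule gr ≤ LinearMap.ker (tensorFoldr g m) := by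
  refine Submodule.span_le.2 ?_
  rintro _ ⟨u, v, x, y, rfl⟩
  rw [SetLike.mem_coe, LinearMap.mem_ker, map_sub, sub_eq_zero, negOnePow_smul (R := K), map_smul]
  induction u with
  | nil => simp [hg _ _ _ x.2.2 _ y.2.2]
  | cons z u ih => simp [ih]

variable (hg : ∀ i j, ∀ x ∈ gr i, ∀ y ∈ gr j, ∀ m, g x (g y m) = sgn K (i * j) • g y (g x m))

/-- The linear map `F` on the graded symmetric algebra with `F 1 = m` and `F (x Y) = g x (F Y)`. -/
noncomputable def symFoldr : GradedSym gr →ₗ[K] M :=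
  (commSubmodule gr).liftQ (tensorFoldr g m) (commSubmodule_le_ker_tensorFoldr g m hg)

@[simp] theorem symFoldr_one : symFoldr g m hg symOne = m := tensorFoldr_one g m

@[simp] theorem symFoldr_symMul (x : W) (Y : GradedSym gr) :
    symFoldr g m hg (symMul x Y) = g x (symFoldr g m hg Y) := by
  obtain ⟨t, rfl⟩ := Submodule.mkQ_surjective _ Y
  exact tensorFoldr_ι_mul g m x t

theorem exists_symRec (h : DirectSum.IsInternal gr) (ρ : W →ₗ[K] M →ₗ[K] M)
    (G : W →ₗ[K] GradedSym gr →ₗ[K] M) (m : M)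
    (hρ : ∀ i j, ∀ x ∈ gr i, ∀ y ∈ gr j, ∀ m, ρ x (ρ y m) = sgn K (i * j) • ρ y (ρ x m))
    (hG : ∀ i j, ∀ x ∈ gr i, ∀ y ∈ gr j, ∀ Y, ρ x (G y Y) + G x (symMul y Y) =
      sgn K (i * j) • (ρ y (G x Y) + G y (symMul x Y))) :
    ∃ F : GradedSym gr →ₗ[K] M, F symOne = m ∧ ∀ x Y, F (symMul x Y) = ρ x (F Y) + G x Y := by
  -- fold the step `(Y, m) ↦ (x Y, ρ x m + G x Y)`, whose first component only records `Y`
  let step : W →ₗ[K] (GradedSym gr × M) →ₗ[K] (GradedSym gr × M) :=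
    LinearMap.mk₂ K (fun x s => (symMul x s.1, ρ x s.2 + G x s.1))
      (fun x y s => by ext <;> simp; abel) (fun r x s => by ext <;> simp)
      (fun x s t => by ext <;> simp; abel) (fun r x s => by ext <;> simp)
  have step_apply x s : step x s = (symMul x s.1, ρ x s.2 + G x s.1) := rfl
  have step_comm i j x (hx : x ∈ gr i) y (hy : y ∈ gr j) s :
      step x (step y s) = sgn K (i * j) • step y (step x s) := by
    simp only [step_apply, map_add, add_assoc, hG i j x hx y hy, hρ i j x hx y hy,
      symMul_comm h hx hy, Prod.smul_mk, smul_add]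
  let F := symFoldr step (symOne, m) step_comm
  have fst_F : LinearMap.fst K _ _ ∘ₗ F = LinearMap.id := by
    refine linearMap_ext_symMul h (by simp [F]) fun _ x _ Y hY => ?_
    simp only [LinearMap.comp_apply, LinearMap.fst_apply, LinearMap.id_apply] at hY ⊢
    rw [symFoldr_symMul, step_apply, hY]
  refine ⟨LinearMap.snd K _ _ ∘ₗ F, by simp [F], fun x Y => ?_⟩
  have fst_F_apply : (F Y).1 = Y := congr($fst_F Y)
  simp only [LinearMap.comp_apply, LinearMap.snd_apply, F, symFoldr_symMul, step_apply] at *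
  rw [fst_F_apply]

end Recursion

section Grading

variable (gr) in
/-- The grading of the graded symmetric algebra by the sum of the degrees of the factors. -/
def gradedSymGr (n : ℤ) : Submodule K (GradedSym gr) := (tensorGr gr n).map (commSubmodule gr).mkQ

theorem mem_gradedSymGr_congr {m n : ℤ} {Y : GradedSym gr} (hY : Y ∈ gradedSymGr gr m)
    (e : m = n) : Y ∈ gradedSymGr gr n := e ▸ hY

theorem symMul_mem {i n : ℤ} {x : W} {Y : GradedSym gr} (hx : x ∈ gr i)
    (hY : Y ∈ gradedSymGr gr n) : symMul x Y ∈ gradedSymGr gr (i + n) := by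
  obtain ⟨t, ht, rfl⟩ := hY
  exact ⟨_, ι_mul_mem_tensorGr hx ht, rfl⟩

theorem symWord_mem (l : List (Homog gr)) : symWord l ∈ gradedSymGr gr (wordDegree l) :=
  ⟨_, word_mem_tensorGr l, rfl⟩

theorem symOne_mem : (symOne : GradedSym gr) ∈ gradedSymGr gr 0 := symWord_mem []

theorem map_mem_of_mem_gradedSymGr {F : GradedSym gr →ₗ[K] M} {N : Submodule K M} {n : ℤ}
    (hF : ∀ l : List (Homog gr), wordDegree l = n → F (symWord l) ∈ N) {Y : GradedSym gr}
    (hY : Y ∈ gradedSymGr gr n) : F Y ∈ N := by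
  obtain ⟨t, ht, rfl⟩ := hY
  exact map_mem_of_mem_tensorGr (F := F ∘ₗ (commSubmodule gr).mkQ) hF ht

variable (gr) in
/-- The relations of graded commutativity between words of homogeneous letters. -/
def wordCommRel : Set (TensorAlgebra K W) :=
  {t | ∃ (u v : List (Homog gr)) (x y : Homog gr),
    t = word (u ++ x :: y :: v) - sgn K (x.1 * y.1) • word (u ++ y :: x :: v)}

theorem word_append (u v : List (Homog gr)) : word (u ++ v) = word u * word v := by
  simp [word, tens]

theorem mul_mul_mem_of_word (h : DirectSum.IsInternal gr) {N : Submodule K (TensorAlgebra K W)}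
    {r : TensorAlgebra K W} (hr : ∀ u v : List (Homog gr), word u * r * word v ∈ N)
    (s t : TensorAlgebra K W) : s * r * t ∈ N := by
  suffices (LinearMap.mul K _ ∘ₗ (LinearMap.mul K _).flip r).compr₂ N.mkQ = 0 from
    (Submodule.Quotient.mk_eq_zero N).1 congr($this s t)
  refine linearMap_ext_word h fun u => linearMap_ext_word h fun v => ?_
  exact (Submodule.Quotient.mk_eq_zero N).2 (hr u v)

theorem span_wordCommRel (h : DirectSum.IsInternal gr) :
    Submodule.span K (wordCommRel gr) = commSubmodule gr := by
  refine le_antisymm (Submodule.span_mono ?_) (Submodule.span_le.2 ?_)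
  · rintro _ ⟨u, v, x, y, rfl⟩
    exact ⟨u.map fun x => (x.2 : W), v.map fun x => (x.2 : W), x, y, by
      simp [word, negOnePow_smul (R := K)]⟩
  · rintro _ ⟨u, v, x, y, rfl⟩
    have commutator_mem := mul_mul_mem_of_word h (N := Submodule.span K (wordCommRel gr))
      (r := word [x, y] - sgn K (x.1 * y.1) • word [y, x])
      (fun u v => Submodule.subset_span ⟨u, v, x, y, by
        simp [word_append, sub_mul, mul_sub, mul_assoc]⟩) (tens u) (tens v)
    convert commutator_mem using 1
    simp [tens, sub_mul, mul_sub, mul_assoc, negOnePow_smul (R := K)]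

theorem exists_mem_tensorGr_of_wordCommRel {r : TensorAlgebra K W} (hr : r ∈ wordCommRel gr) :
    ∃ n, r ∈ tensorGr gr n := by
  obtain ⟨u, v, x, y, rfl⟩ := hr
  refine ⟨wordDegree (u ++ x :: y :: v), sub_mem (word_mem_tensorGr _) (Submodule.smul_mem _ _ ?_)⟩
  refine mem_tensorGr_congr (word_mem_tensorGr _) ?_
  simp only [wordDegree, List.map_append, List.map_cons, List.sum_append, List.sum_cons]
  ring

theorem isInternal_gradedSymGr (h : DirectSum.IsInternal gr) :
    DirectSum.IsInternal (gradedSymGr gr) := by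
  have := isInternal_map_mkQ_tensorGr h (S := wordCommRel gr)
    fun r => exists_mem_tensorGr_of_wordCommRel
  rwa [span_wordCommRel h] at this

theorem symSubmodule_eq : symSubmodule gr = Submodule.span K {1} ⊔ commSubmodule gr := by
  rw [symSubmodule, Submodule.span_union]; rfl

theorem isInternal_symGr (h : DirectSum.IsInternal gr) : DirectSum.IsInternal (symGr gr) := by
  have := isInternal_map_mkQ_tensorGr h (S := {1} ∪ wordCommRel gr) (by
    rintro r (rfl | hr)
    · exact ⟨0, word_mem_tensorGr []⟩
    · exact exists_mem_tensorGr_of_wordCommRel hr)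
  rw [Submodule.span_union, span_wordCommRel h, ← symSubmodule_eq] at this
  rwa [funext symGr_eq_map]

end Grading

section ToSymPlus

/-- The projection of the graded symmetric algebra onto `S⁺`, which kills the scalars. -/
noncomputable def toSymPlus : GradedSym gr →ₗ[K] SymPlus gr :=
  Submodule.factor (by rw [symSubmodule_eq]; exact le_sup_right)

@[simp] theorem toSymPlus_symOne : toSymPlus (symOne : GradedSym gr) = 0 :=
  (Submodule.Quotient.mk_eq_zero _).2 (Submodule.subset_span (Or.inl rfl))

theorem toSymPlus_symWord {n : ℕ} (X : Fin n → Homog gr) (l : List (Fin n)) :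
    toSymPlus (symWord (l.map X)) = symProdOf X l := (symProdOf_eq X l).symm

theorem symGr_eq_map_toSymPlus (n : ℤ) : symGr gr n = (gradedSymGr gr n).map toSymPlus := by
  rw [symGr_eq_map, gradedSymGr, ← Submodule.map_comp]
  rfl

theorem toSymPlus_mem {n : ℤ} {Y : GradedSym gr} (hY : Y ∈ gradedSymGr gr n) :
    toSymPlus Y ∈ symGr gr n :=
  symGr_eq_map_toSymPlus (gr := gr) n ▸ Submodule.mem_map_of_mem hY

/-- The map induced on `S⁺` by a map that vanishes on the unit. -/
noncomputable def symPlusLift (F : GradedSym gr →ₗ[K] M) (hF : F symOne = 0) :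
    SymPlus gr →ₗ[K] M :=
  (symSubmodule gr).liftQ (F ∘ₗ (commSubmodule gr).mkQ) <| by
    rw [symSubmodule_eq, sup_le_iff, Submodule.span_singleton_le_iff_mem]
    exact ⟨hF, (commSubmodule gr).ker_mkQ.ge.trans (LinearMap.ker_le_ker_comp _ _)⟩

@[simp] theorem symPlusLift_toSymPlus (F : GradedSym gr →ₗ[K] M) (hF : F symOne = 0)
    (Y : GradedSym gr) : symPlusLift F hF (toSymPlus Y) = F Y := by
  obtain ⟨t, rfl⟩ := Submodule.mkQ_surjective _ Y
  rfl

theorem linearMap_ext_toSymPlus {F G : SymPlus gr →ₗ[K] M}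
    (hFG : F ∘ₗ toSymPlus = G ∘ₗ toSymPlus) : F = G :=
  Submodule.linearMap_qext _ congr($hFG ∘ₗ (commSubmodule gr).mkQ)

end ToSymPlus

section Signs

variable (h : DirectSum.IsInternal gr)

/-- The map `Y ↦ (-1)^{c |Y|} Y` of the graded symmetric algebra. -/
noncomputable abbrev symSign (c : ℤ) : GradedSym gr →ₗ[K] GradedSym gr :=
  signMap (isInternal_gradedSymGr h) c

theorem signMap_toSymPlus (c : ℤ) (Y : GradedSym gr) :
    signMap (isInternal_symGr h) c (toSymPlus Y) = toSymPlus (symSign h c Y) := by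
  simpa using signMap_map_of_degree (e := 0) (isInternal_gradedSymGr h) (isInternal_symGr h)
    (f := toSymPlus) (fun n _ hY => by simpa using toSymPlus_mem hY) c Y

end Signs

end GradedSym

/-! ### Operators of the graded symmetric algebra -/

section SymExtension

variable {K W : Type*} [Field K] [AddCommGroup W] [Module K W] {gr : ℤ → Submodule K W}

/-- `F` is the operator of degree `e` of the graded symmetric algebra with `F 1 = 0` and
`F (x Y) = G x Y + (-1)^{e |x|} x F(Y)`. With `G x Y = (D x) Y` this is the extension of `D`; with
`G x` the extension of `B x`, for a bracket `B`, it is the extension of `B`. -/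
structure IsSymExtension (F : GradedSym gr →ₗ[K] GradedSym gr)
    (G : W →ₗ[K] GradedSym gr →ₗ[K] GradedSym gr) (e : ℤ) : Prop where
  one : F symOne = 0
  mul : ∀ {i : ℤ} {x : W}, x ∈ gr i → ∀ Y,
    F (symMul x Y) = G x Y + sgn K (e * i) • symMul x (F Y)
  mem : ∀ n, ∀ Y ∈ gradedSymGr gr n, F Y ∈ gradedSymGr gr (n + e)

theorem isSymExtension_of_rec {F : GradedSym gr →ₗ[K] GradedSym gr}
    {G : W →ₗ[K] GradedSym gr →ₗ[K] GradedSym gr} {e : ℤ} (one : F symOne = 0)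
    (mul : ∀ {i : ℤ} {x : W}, x ∈ gr i → ∀ Y,
      F (symMul x Y) = G x Y + sgn K (e * i) • symMul x (F Y))
    (G_mem : ∀ i, ∀ x ∈ gr i, ∀ n, ∀ Y ∈ gradedSymGr gr n, G x Y ∈ gradedSymGr gr (i + n + e)) :
    IsSymExtension F G e := by
  refine ⟨one, mul, fun n Y hY => map_mem_of_mem_gradedSymGr (F := F) ?_ hY⟩
  rintro l rfl
  clear hY
  induction l with
  | nil => rw [symWord_nil, one]; exact zero_mem _
  | cons x l ih =>
    rw [symWord_cons, mul x.2.2, wordDegree_cons]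
    refine add_mem (G_mem _ _ x.2.2 _ _ (symWord_mem l)) (Submodule.smul_mem _ _ ?_)
    exact mem_gradedSymGr_congr (symMul_mem x.2.2 ih) (by ring)

theorem exists_isSymExtension (h : DirectSum.IsInternal gr)
    (G : W →ₗ[K] GradedSym gr →ₗ[K] GradedSym gr) (e : ℤ)
    (G_comm : ∀ i j, ∀ x ∈ gr i, ∀ y ∈ gr j, ∀ Y,
      sgn K (e * i) • symMul x (G y Y) + G x (symMul y Y) =
        sgn K (i * j) • (sgn K (e * j) • symMul y (G x Y) + G y (symMul x Y)))
    (G_mem : ∀ i, ∀ x ∈ gr i, ∀ n, ∀ Y ∈ gradedSymGr gr n, G x Y ∈ gradedSymGr gr (i + n + e)) :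
    ∃ F, IsSymExtension F G e := by
  have symMul_signMap {i : ℤ} {x : W} (hx : x ∈ gr i) (Y : GradedSym gr) :
      (symMul ∘ₗ signMap h e) x Y = sgn K (e * i) • symMul x Y := by
    rw [LinearMap.comp_apply, signMap_apply h e hx, map_smul, LinearMap.smul_apply]
  obtain ⟨F, one, mul⟩ := exists_symRec h (symMul ∘ₗ signMap h e) G 0
    (fun i j x hx y hy Y => by
      simp only [symMul_signMap hx, symMul_signMap hy, map_smul, symMul_comm h hx hy, smul_smul]
      ring_nf)
    (fun i j x hx y hy Y => by
      rw [symMul_signMap hx, symMul_signMap hy]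
      exact G_comm i j x hx y hy Y)
  exact ⟨F, isSymExtension_of_rec one (fun hx Y => by rw [mul, symMul_signMap hx, add_comm]) G_mem⟩

end SymExtension

/-- A differential graded Lie algebra with the degrees shifted so that the differential and the
bracket have degree `1` and the bracket is graded symmetric. -/
structure ShiftedDGLie {K W : Type*} [Field K] [AddCommGroup W] [Module K W]
    (gr : ℤ → Submodule K W) where
  graded : DirectSum.IsInternal gr
  D : W →ₗ[K] W
  B : W →ₗ[K] W →ₗ[K] W
  D_mem : ∀ x, ∀ X ∈ gr x, D X ∈ gr (x + 1)
  B_mem : ∀ x y, ∀ X ∈ gr x, ∀ Y ∈ gr y, B X Y ∈ gr (x + y + 1)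
  D_D : ∀ X, D (D X) = 0
  B_comm : ∀ x y, ∀ X ∈ gr x, ∀ Y ∈ gr y, B X Y = sgn K (x * y) • B Y X
  jacobi : ∀ x y z, ∀ X ∈ gr x, ∀ Y ∈ gr y, ∀ Z ∈ gr z,
    sgn K (x * z) • B (B X Y) Z + sgn K (y * x) • B (B Y Z) X + sgn K (z * y) • B (B Z X) Y = 0
  D_B : ∀ x, ∀ X ∈ gr x, ∀ Y, D (B X Y) = -B (D X) Y + sgn K (1 + x) • B X (D Y)

namespace ShiftedDGLie

variable {K W : Type*} [Field K] [AddCommGroup W] [Module K W] {gr : ℤ → Submodule K W}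
  (S : ShiftedDGLie gr)

theorem exists_symD : ∃ F, IsSymExtension F (symMul (gr := gr) ∘ₗ S.D) 1 := by
  refine exists_isSymExtension S.graded _ 1 (fun i j x hx y hy Y => ?_) (fun i x hx n Y hY => ?_)
  · simp only [LinearMap.comp_apply, symMul_comm S.graded hx (S.D_mem _ _ hy),
      symMul_comm S.graded (S.D_mem _ _ hx) hy]
    match_scalars <;> simp [sgn_add, mul_add, mul_comm]
  · exact mem_gradedSymGr_congr (symMul_mem (S.D_mem _ _ hx) hY) (by ring)

/-- The extension of `D` to the graded symmetric algebra. -/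
noncomputable def symD : GradedSym gr →ₗ[K] GradedSym gr := S.exists_symD.choose

theorem isSymExtension_symD : IsSymExtension S.symD (symMul ∘ₗ S.D) 1 := S.exists_symD.choose_spec

/-- The signed product `y (φ x)` that occurs in the recursive formula for `x ↦ ad x (y Y)`. -/
noncomputable def adMul :
    W →ₗ[K] (W →ₗ[K] GradedSym gr) →ₗ[K] W →ₗ[K] GradedSym gr :=
  byDegree S.graded fun j => LinearMap.mk₂ K
    (fun y φ => sgn K j • symMul y ∘ₗ φ ∘ₗ signMap S.graded j)
    (fun x y φ => by ext; simp) (fun r x φ => by ext; simp [smul_comm _ r])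
    (fun x φ ψ => by ext; simp) (fun r x φ => by ext; simp [smul_comm _ r])

theorem adMul_apply {i j : ℤ} {x y : W} (hx : x ∈ gr i) (hy : y ∈ gr j)
    (φ : W →ₗ[K] GradedSym gr) :
    S.adMul y φ x = sgn K ((i + 1) * j) • symMul y (φ x) := by
  simp only [adMul, byDegree_apply S.graded _ hy, LinearMap.mk₂_apply, LinearMap.smul_apply,
    LinearMap.comp_apply, signMap_apply S.graded j hx, map_smul, smul_smul, ← sgn_add]
  ring_nf

/-- The product `x ↦ B x y · Y` that occurs in the recursive formula for `x ↦ ad x (y Y)`. -/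
noncomputable def bracketMul : W →ₗ[K] GradedSym gr →ₗ[K] W →ₗ[K] GradedSym gr :=
  LinearMap.mk₂ K (fun y Y => symMul.flip Y ∘ₗ S.B.flip y)
    (fun x y φ => by ext; simp) (fun r x φ => by ext; simp)
    (fun x φ ψ => by ext; simp) (fun r x φ => by ext; simp)

theorem bracketMul_apply (x y : W) (Y : GradedSym gr) :
    S.bracketMul y Y x = symMul (S.B x y) Y := rfl

theorem exists_ad : ∃ F : GradedSym gr →ₗ[K] W →ₗ[K] GradedSym gr, F symOne = 0 ∧
    ∀ y Y, F (symMul y Y) = S.adMul y (F Y) + S.bracketMul y Y := by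
  refine exists_symRec S.graded _ _ 0 (fun i j x hx y hy φ => ?_) (fun i j x hx y hy Y => ?_) <;>
    refine linearMap_ext_homogeneous S.graded fun k w hw => ?_
  · simp only [LinearMap.smul_apply, S.adMul_apply hw hx, S.adMul_apply hw hy, map_smul,
      symMul_comm S.graded hx hy, smul_smul]
    ring_nf
  · simp only [LinearMap.smul_apply, LinearMap.add_apply, S.adMul_apply hw hx,
      S.adMul_apply hw hy, bracketMul_apply,
      symMul_comm S.graded (S.B_mem _ _ _ hw _ hx) hy,
      symMul_comm S.graded hx (S.B_mem _ _ _ hw _ hy)]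
    match_scalars <;> simp only [sgn_add, mul_add, add_mul, mul_one, one_mul] <;> ring_nf
    simp

/-- The extensions `ad x` of the maps `B x` to the graded symmetric algebra. -/
noncomputable def ad : W →ₗ[K] GradedSym gr →ₗ[K] GradedSym gr := S.exists_ad.choose.flip

theorem isSymExtension_ad {i : ℤ} {x : W} (hx : x ∈ gr i) :
    IsSymExtension (S.ad x) (symMul ∘ₗ S.B x) (i + 1) := by
  obtain ⟨one, mul⟩ := S.exists_ad.choose_spec
  refine isSymExtension_of_rec ?_ (fun hy Y => ?_) (fun j y hy n Y hY => ?_)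
  · rw [ad, LinearMap.flip_apply, one, LinearMap.zero_apply]
  · rw [ad, LinearMap.flip_apply, mul, LinearMap.add_apply, S.adMul_apply hx hy, add_comm]
    rfl
  · exact mem_gradedSymGr_congr (symMul_mem (S.B_mem _ _ _ hx _ hy) hY) (by ring)

theorem exists_symB : ∃ F, IsSymExtension F S.ad 1 := by
  refine exists_isSymExtension S.graded _ 1 (fun i j x hx y hy Y => ?_) (fun i x hx n Y hY => ?_)
  · simp only [(S.isSymExtension_ad hx).mul hy, (S.isSymExtension_ad hy).mul hx,
      LinearMap.comp_apply, S.B_comm _ _ _ hx _ hy, map_smul, LinearMap.smul_apply]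
    match_scalars <;> simp [sgn_add, mul_add, mul_comm, mul_left_comm]
  · exact mem_gradedSymGr_congr ((S.isSymExtension_ad hx).mem _ _ hY) (by ring)

/-- The extension of `B` to the graded symmetric algebra. -/
noncomputable def symB : GradedSym gr →ₗ[K] GradedSym gr := S.exists_symB.choose

theorem isSymExtension_symB : IsSymExtension S.symB S.ad 1 := S.exists_symB.choose_spec

theorem symD_symD (Y : GradedSym gr) : S.symD (S.symD Y) = 0 := by
  suffices S.symD ∘ₗ S.symD = 0 from congr($this Y)
  have hD := S.isSymExtension_symD
  refine linearMap_ext_symMul S.graded (by simp [hD.one]) fun i x hx Y hY => ?_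
  simp only [LinearMap.comp_apply, LinearMap.zero_apply] at hY ⊢
  simp only [hD.mul hx, hD.mul (S.D_mem _ _ hx), map_add, map_smul, hY, LinearMap.comp_apply,
    S.D_D, map_zero, LinearMap.zero_apply]
  match_scalars
  simp [sgn_add]

theorem jacobi_left {i j : ℤ} {x y : W} (hx : x ∈ gr i) (hy : y ∈ gr j) (z : W) :
    S.B (S.B x y) z + sgn K ((i + 1) * j) • S.B y (S.B x z) + sgn K i • S.B x (S.B y z) = 0 := by
  suffices S.B (S.B x y) + sgn K ((i + 1) * j) • S.B y ∘ₗ S.B x + sgn K i • S.B x ∘ₗ S.B y = 0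
    from congr($this z)
  refine linearMap_ext_homogeneous S.graded fun k z hz => ?_
  have jacobi := S.jacobi _ _ _ _ hx _ hy _ hz
  rw [S.B_comm _ _ _ (S.B_mem _ _ _ hy _ hz) _ hx, S.B_comm _ _ _ hz _ hx, map_smul,
    LinearMap.smul_apply, S.B_comm _ _ _ (S.B_mem _ _ _ hx _ hz) _ hy] at jacobi
  simp only [LinearMap.add_apply, LinearMap.smul_apply, LinearMap.comp_apply, LinearMap.zero_apply]
  linear_combination (norm := skip) sgn K (i * k) • jacobi
  match_scalars <;> simp only [sgn_add, add_mul, mul_one, one_mul] <;> ring_nf <;> simp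

theorem ad_B {i j : ℤ} {x y : W} (hx : x ∈ gr i) (hy : y ∈ gr j) (Y : GradedSym gr) :
    S.ad (S.B x y) Y + sgn K ((i + 1) * j) • S.ad y (S.ad x Y) + sgn K i • S.ad x (S.ad y Y) =
      0 := by
  suffices S.ad (S.B x y) + sgn K ((i + 1) * j) • S.ad y ∘ₗ S.ad x +
    sgn K i • S.ad x ∘ₗ S.ad y = 0 from congr($this Y)
  have adx := S.isSymExtension_ad hx
  have ady := S.isSymExtension_ad hy
  have adB := S.isSymExtension_ad (S.B_mem _ _ _ hx _ hy)
  refine linearMap_ext_symMul S.graded (by simp [adx.one, ady.one, adB.one]) fun k z hz Y hY => ?_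
  simp only [LinearMap.add_apply, LinearMap.smul_apply, LinearMap.comp_apply,
    LinearMap.zero_apply] at hY ⊢
  have jacobi := congr(symMul $(S.jacobi_left hx hy z) Y)
  have z_hY := congr(symMul z $hY)
  simp only [map_add, map_smul, LinearMap.add_apply, LinearMap.smul_apply, map_zero,
    LinearMap.zero_apply] at jacobi z_hY
  simp only [adx.mul hz, ady.mul hz, adB.mul hz, adx.mul (S.B_mem _ _ _ hy _ hz),
    ady.mul (S.B_mem _ _ _ hx _ hz), map_add, map_smul, LinearMap.comp_apply]
  linear_combination (norm := skip) jacobi + sgn K ((i + j) * k) • z_hY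
  match_scalars <;> ring_nf <;> simp [sgn_add] <;> ring_nf <;> simp

theorem symB_ad {i : ℤ} {x : W} (hx : x ∈ gr i) (Y : GradedSym gr) :
    S.symB (S.ad x Y) + sgn K i • S.ad x (S.symB Y) = 0 := by
  suffices S.symB ∘ₗ S.ad x + sgn K i • S.ad x ∘ₗ S.symB = 0 from congr($this Y)
  have hB := S.isSymExtension_symB
  have adx := S.isSymExtension_ad hx
  refine linearMap_ext_symMul S.graded (by simp [adx.one, hB.one]) fun k z hz Y hY => ?_
  simp only [LinearMap.add_apply, LinearMap.smul_apply, LinearMap.comp_apply,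
    LinearMap.zero_apply] at hY ⊢
  have z_hY := congr(symMul z $hY)
  simp only [map_add, map_smul, map_zero] at z_hY
  simp only [adx.mul hz, hB.mul hz, hB.mul (S.B_mem _ _ _ hx _ hz), map_add, map_smul,
    LinearMap.comp_apply]
  linear_combination (norm := skip) S.ad_B hx hz Y + sgn K (i * k) • z_hY
  match_scalars <;> ring_nf <;> simp [sgn_add] <;> ring_nf <;> simp

theorem symB_symB (Y : GradedSym gr) : S.symB (S.symB Y) = 0 := by
  suffices S.symB ∘ₗ S.symB = 0 from congr($this Y)
  have hB := S.isSymExtension_symB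
  refine linearMap_ext_symMul S.graded (by simp [hB.one]) fun i x hx Y hY => ?_
  simp only [LinearMap.comp_apply, LinearMap.zero_apply] at hY ⊢
  simpa only [hB.mul hx, map_add, map_smul, hY, one_mul, map_zero, smul_zero, add_zero] using
    S.symB_ad hx Y

theorem symD_ad {i : ℤ} {x : W} (hx : x ∈ gr i) (Y : GradedSym gr) :
    S.symD (S.ad x Y) + S.ad (S.D x) Y + sgn K i • S.ad x (S.symD Y) = 0 := by
  suffices S.symD ∘ₗ S.ad x + S.ad (S.D x) + sgn K i • S.ad x ∘ₗ S.symD = 0 from congr($this Y)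
  have hD := S.isSymExtension_symD
  have adx := S.isSymExtension_ad hx
  have adDx := S.isSymExtension_ad (S.D_mem _ _ hx)
  refine linearMap_ext_symMul S.graded (by simp [adx.one, adDx.one, hD.one]) fun k z hz Y hY => ?_
  simp only [LinearMap.add_apply, LinearMap.smul_apply, LinearMap.comp_apply,
    LinearMap.zero_apply] at hY ⊢
  have z_hY := congr(symMul z $hY)
  simp only [map_add, map_smul, map_zero] at z_hY
  simp only [adx.mul hz, hD.mul hz, hD.mul (S.B_mem _ _ _ hx _ hz), adDx.mul hz,
    adx.mul (S.D_mem _ _ hz), S.D_B _ _ hx, map_add, map_smul, map_neg, LinearMap.comp_apply,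
    LinearMap.add_apply, LinearMap.smul_apply, LinearMap.neg_apply]
  linear_combination (norm := skip) sgn K (i * k) • z_hY
  match_scalars <;> ring_nf <;> simp [sgn_add] <;> ring_nf <;> simp

theorem symD_symB (Y : GradedSym gr) : S.symD (S.symB Y) + S.symB (S.symD Y) = 0 := by
  suffices S.symD ∘ₗ S.symB + S.symB ∘ₗ S.symD = 0 from congr($this Y)
  have hD := S.isSymExtension_symD
  have hB := S.isSymExtension_symB
  refine linearMap_ext_symMul S.graded (by simp [hB.one, hD.one]) fun i x hx Y hY => ?_
  simp only [LinearMap.comp_apply, LinearMap.zero_apply, LinearMap.add_apply] at hY ⊢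
  have x_hY := congr(symMul x $hY)
  simp only [map_add, map_zero] at x_hY
  simp only [hB.mul hx, hD.mul hx, hB.mul (S.D_mem _ _ hx), map_add, map_smul,
    LinearMap.comp_apply]
  linear_combination (norm := skip) S.symD_ad hx Y + x_hY
  match_scalars <;> simp [sgn_add]

end ShiftedDGLie

/-! ### The coproduct of the graded symmetric algebra -/

section TensorSquare

variable {K M N : Type*} [Field K] [AddCommGroup M] [Module K M] [AddCommGroup N] [Module K N]
  {gr : ℤ → Submodule K M} {gr' : ℤ → Submodule K N}

theorem linearMap_ext_tmul_homogeneous (h : DirectSum.IsInternal gr) {F G : M ⊗[K] M →ₗ[K] N}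
    (hFG : ∀ i j, ∀ x ∈ gr i, ∀ y ∈ gr j, F (x ⊗ₜ y) = G (x ⊗ₜ y)) : F = G :=
  TensorProduct.ext <| linearMap_ext_homogeneous h fun i x hx =>
    linearMap_ext_homogeneous h fun j y hy => hFG i j x hx y hy

theorem flip_tmul (h : DirectSum.IsInternal gr) {i j : ℤ} {x y : M} (hx : x ∈ gr i)
    (hy : y ∈ gr j) : flip gr (x ⊗ₜ[K] y) = sgn K (i * j) • (y ⊗ₜ[K] x) := by
  let signedSwap : M ⊗[K] M →ₗ[K] M ⊗[K] M :=
    TensorProduct.lift (byDegree h fun i => (TensorProduct.mk K M M).flip.compl₂ (signMap h i))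
  have signedSwap_tmul (p : Homog gr × Homog gr) : signedSwap ((p.1.2 : M) ⊗ₜ[K] (p.2.2 : M)) =
      (p.1.1 * p.2.1).negOnePow • ((p.2.2 : M) ⊗ₜ[K] (p.1.2 : M)) := by
    simp [signedSwap, byDegree_apply h _ p.1.2.2, signMap_apply h _ p.2.2.2,
      TensorProduct.smul_tmul', negOnePow_smul (R := K)]
  exact (linearExt_apply ⟨signedSwap, signedSwap_tmul⟩ (⟨i, x, hx⟩, ⟨j, y, hy⟩)).trans
    (negOnePow_smul _ _)

theorem flip_map (h : DirectSum.IsInternal gr) (h' : DirectSum.IsInternal gr') {f : M →ₗ[K] N}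
    (hf : ∀ n, ∀ x ∈ gr n, f x ∈ gr' n) (t : M ⊗[K] M) :
    flip gr' (TensorProduct.map f f t) = TensorProduct.map f f (flip gr t) := by
  suffices flip gr' ∘ₗ TensorProduct.map f f = TensorProduct.map f f ∘ₗ flip gr from
    congr($this t)
  refine linearMap_ext_tmul_homogeneous h fun i j x hx y hy => ?_
  simp only [LinearMap.comp_apply, TensorProduct.map_tmul, flip_tmul h hx hy, map_smul,
    flip_tmul h' (hf i x hx) (hf j y hy)]

variable (gr) in
/-- The grading of a tensor square by the sum of the degrees of the factors. -/
def tmulGr (k : ℤ) : Submodule K (M ⊗[K] M) :=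
  Submodule.span K {t | ∃ (i j : ℤ) (Y Z : M),
    Y ∈ gr i ∧ Z ∈ gr j ∧ i + j = k ∧ t = Y ⊗ₜ[K] Z}

theorem tmul_mem_tmulGr {i j : ℤ} {x y : M} (hx : x ∈ gr i) (hy : y ∈ gr j) :
    x ⊗ₜ[K] y ∈ tmulGr gr (i + j) := Submodule.subset_span ⟨i, j, x, y, hx, hy, rfl, rfl⟩

theorem tmulGr_le {k : ℤ} {S : Submodule K (M ⊗[K] M)}
    (hS : ∀ i j, i + j = k → ∀ x ∈ gr i, ∀ y ∈ gr j, x ⊗ₜ y ∈ S) : tmulGr gr k ≤ S := by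
  refine Submodule.span_le.2 ?_
  rintro _ ⟨i, j, x, y, hx, hy, e, rfl⟩
  exact hS i j e x hx y hy

theorem map_signMap_signMap (h : DirectSum.IsInternal gr) (c : ℤ) {n : ℤ} {t : M ⊗[K] M}
    (ht : t ∈ tmulGr gr n) :
    TensorProduct.map (signMap h c) (signMap h c) t = sgn K (c * n) • t := by
  suffices tmulGr gr n ≤ LinearMap.eqLocus (TensorProduct.map (signMap h c) (signMap h c))
    (sgn K (c * n) • LinearMap.id) from this ht
  refine tmulGr_le ?_
  rintro i j rfl x hx y hy
  rw [LinearMap.mem_eqLocus, TensorProduct.map_tmul, signMap_apply h c hx, signMap_apply h c hy,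
    TensorProduct.smul_tmul_smul, mul_add, sgn_add]
  rfl

/-- The operator `F ⊗ 1 + 1 ⊗ F` for an operator `F` of degree `e`, with the Koszul sign
`(1 ⊗ F) (Y ⊗ Z) = (-1)^{e |Y|} Y ⊗ F Z`. -/
noncomputable def onTensorSquare (h : DirectSum.IsInternal gr) (e : ℤ) :
    (M →ₗ[K] M) →ₗ[K] M ⊗[K] M →ₗ[K] M ⊗[K] M :=
  (TensorProduct.mapBilinear (RingHom.id K) M M M M).flip LinearMap.id +
    TensorProduct.mapBilinear (RingHom.id K) M M M M (signMap h e)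

theorem onTensorSquare_tmul (h : DirectSum.IsInternal gr) (e : ℤ) (F : M →ₗ[K] M) (Y Z : M) :
    onTensorSquare h e F (Y ⊗ₜ Z) = F Y ⊗ₜ Z + signMap h e Y ⊗ₜ F Z := rfl

theorem onTensorSquare_mem (h : DirectSum.IsInternal gr) {e n : ℤ} {F : M →ₗ[K] M}
    (hF : ∀ n, ∀ Y ∈ gr n, F Y ∈ gr (n + e)) {t : M ⊗[K] M} (ht : t ∈ tmulGr gr n) :
    onTensorSquare h e F t ∈ tmulGr gr (n + e) := by
  suffices tmulGr gr n ≤ (tmulGr gr (n + e)).comap (onTensorSquare h e F) from this ht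
  refine tmulGr_le ?_
  rintro i j rfl Y hY Z hZ
  rw [Submodule.mem_comap, onTensorSquare_tmul, signMap_apply h e hY]
  refine add_mem ?_ ?_
  · rw [add_right_comm]
    exact tmul_mem_tmulGr (hF _ _ hY) hZ
  · rw [add_assoc]
    exact tmul_mem_tmulGr (Submodule.smul_mem _ _ hY) (hF _ _ hZ)

theorem onTensorSquare_commutator (h : DirectSum.IsInternal gr) {e e' : ℤ} {F G : M →ₗ[K] M}
    (hF : ∀ n, ∀ Y ∈ gr n, F Y ∈ gr (n + e)) (hG : ∀ n, ∀ Y ∈ gr n, G Y ∈ gr (n + e'))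
    (t : M ⊗[K] M) :
    onTensorSquare h (e + e') (F ∘ₗ G - sgn K (e * e') • G ∘ₗ F) t =
      onTensorSquare h e F (onTensorSquare h e' G t) -
        sgn K (e * e') • onTensorSquare h e' G (onTensorSquare h e F t) := by
  induction t using TensorProduct.induction_on with
  | zero => simp
  | add s t hs ht => simp only [map_add, hs, ht, smul_add]; abel
  | tmul Y Z =>
    simp only [onTensorSquare_tmul, map_add, signMap_map_of_degree h h hF,
      signMap_map_of_degree h h hG, signMap_add, signMap_signMap_comm h e' e, LinearMap.sub_apply,
      LinearMap.smul_apply, LinearMap.comp_apply, TensorProduct.sub_tmul, TensorProduct.tmul_sub,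
      ← TensorProduct.smul_tmul', TensorProduct.tmul_smul]
    match_scalars <;> simp [mul_comm]

theorem flip_onTensorSquare (h : DirectSum.IsInternal gr) {e : ℤ} {F : M →ₗ[K] M}
    (hF : ∀ n, ∀ Y ∈ gr n, F Y ∈ gr (n + e)) (t : M ⊗[K] M) :
    flip gr (onTensorSquare h e F t) = onTensorSquare h e F (flip gr t) := by
  suffices flip gr ∘ₗ onTensorSquare h e F = onTensorSquare h e F ∘ₗ flip gr from congr($this t)
  refine linearMap_ext_tmul_homogeneous h fun i j Y hY Z hZ => ?_
  simp only [LinearMap.comp_apply, onTensorSquare_tmul, map_add, signMap_apply h e hY,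
    signMap_apply h e hZ, flip_tmul h hY hZ, flip_tmul h (hF _ _ hY) hZ,
    flip_tmul h hY (hF _ _ hZ), ← TensorProduct.smul_tmul', map_smul]
  match_scalars <;> simp [sgn_add, mul_add, mul_comm]

theorem coassoc_comp_of_coassoc {Δ : M →ₗ[K] M ⊗[K] M} {Δ' : N →ₗ[K] N ⊗[K] N} {π : M →ₗ[K] N}
    (hπ : Δ' ∘ₗ π = TensorProduct.map π π ∘ₗ Δ)
    (hΔ : (TensorProduct.assoc K M M M).toLinearMap ∘ₗ TensorProduct.map Δ LinearMap.id ∘ₗ Δ =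
      TensorProduct.map LinearMap.id Δ ∘ₗ Δ) :
    ((TensorProduct.assoc K N N N).toLinearMap ∘ₗ TensorProduct.map Δ' LinearMap.id ∘ₗ Δ') ∘ₗ π =
      (TensorProduct.map LinearMap.id Δ' ∘ₗ Δ') ∘ₗ π := by
  have left : TensorProduct.map Δ' LinearMap.id ∘ₗ TensorProduct.map π π =
      TensorProduct.map (TensorProduct.map π π) π ∘ₗ TensorProduct.map Δ LinearMap.id := by
    rw [← TensorProduct.map_comp, ← TensorProduct.map_comp, hπ, LinearMap.id_comp,
      LinearMap.comp_id]
  have right : TensorProduct.map LinearMap.id Δ' ∘ₗ TensorProduct.map π π =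
      TensorProduct.map π (TensorProduct.map π π) ∘ₗ TensorProduct.map LinearMap.id Δ := by
    rw [← TensorProduct.map_comp, ← TensorProduct.map_comp, hπ, LinearMap.id_comp,
      LinearMap.comp_id]
  calc _ = (TensorProduct.assoc K N N N).toLinearMap ∘ₗ
        (TensorProduct.map Δ' LinearMap.id ∘ₗ TensorProduct.map π π) ∘ₗ Δ := by
        simp only [LinearMap.comp_assoc, hπ]
    _ = TensorProduct.map π (TensorProduct.map π π) ∘ₗ
        ((TensorProduct.assoc K M M M).toLinearMap ∘ₗ TensorProduct.map Δ LinearMap.id ∘ₗ Δ) := by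
        rw [left, LinearMap.comp_assoc, ← LinearMap.comp_assoc,
          ← TensorProduct.map_map_comp_assoc_eq, LinearMap.comp_assoc]
    _ = (TensorProduct.map LinearMap.id Δ' ∘ₗ TensorProduct.map π π) ∘ₗ Δ := by
        rw [hΔ, right, LinearMap.comp_assoc]
    _ = _ := by simp only [LinearMap.comp_assoc, hπ]

end TensorSquare

section SymCoproduct

variable {K W : Type*} [Field K] [AddCommGroup W] [Module K W] {gr : ℤ → Submodule K W}
  (h : DirectSum.IsInternal gr)

theorem symMul_mem' {i : ℤ} {x : W} (hx : x ∈ gr i) (n : ℤ) (Y : GradedSym gr)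
    (hY : Y ∈ gradedSymGr gr n) : symMul x Y ∈ gradedSymGr gr (n + i) :=
  add_comm i n ▸ symMul_mem hx hY

/-- Multiplication by `Δ(x) = x ⊗ 1 + 1 ⊗ x` in the tensor square of the graded symmetric
algebra. -/
noncomputable def symMulTwo :
    W →ₗ[K] GradedSym gr ⊗[K] GradedSym gr →ₗ[K] GradedSym gr ⊗[K] GradedSym gr :=
  byDegree h fun i => onTensorSquare (isInternal_gradedSymGr h) i ∘ₗ symMul

theorem symMulTwo_eq {i : ℤ} {x : W} (hx : x ∈ gr i) :
    symMulTwo h x = onTensorSquare (isInternal_gradedSymGr h) i (symMul x) := by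
  rw [symMulTwo, byDegree_apply h _ hx]
  rfl

theorem symMulTwo_comm {i j : ℤ} {x y : W} (hx : x ∈ gr i) (hy : y ∈ gr j)
    (t : GradedSym gr ⊗[K] GradedSym gr) :
    symMulTwo h x (symMulTwo h y t) = sgn K (i * j) • symMulTwo h y (symMulTwo h x t) := by
  have commutator : symMul (gr := gr) x ∘ₗ symMul y - sgn K (i * j) • symMul y ∘ₗ symMul x = 0 :=
    LinearMap.ext fun Y => sub_eq_zero.2 (symMul_comm h hx hy Y)
  have := onTensorSquare_commutator (isInternal_gradedSymGr h) (symMul_mem' hx) (symMul_mem' hy) t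
  rw [commutator, map_zero, LinearMap.zero_apply] at this
  simpa only [symMulTwo_eq h hx, symMulTwo_eq h hy] using sub_eq_zero.1 this.symm

/-- The coproduct of the graded symmetric algebra, for which the elements of `W` are primitive. -/
noncomputable def symCoproduct : GradedSym gr →ₗ[K] GradedSym gr ⊗[K] GradedSym gr :=
  symFoldr (symMulTwo h) (symOne ⊗ₜ symOne) fun _ _ _ hx _ hy t => symMulTwo_comm h hx hy t

@[simp] theorem symCoproduct_symOne :
    symCoproduct h (symOne : GradedSym gr) = symOne ⊗ₜ symOne := symFoldr_one _ _ _

@[simp] theorem symCoproduct_symMul (x : W) (Y : GradedSym gr) :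
    symCoproduct h (symMul x Y) = symMulTwo h x (symCoproduct h Y) := symFoldr_symMul _ _ _ _ _

theorem symCoproduct_mem {n : ℤ} {Y : GradedSym gr} (hY : Y ∈ gradedSymGr gr n) :
    symCoproduct h Y ∈ tmulGr (gradedSymGr gr) n := by
  refine map_mem_of_mem_gradedSymGr (F := symCoproduct h) ?_ hY
  rintro l rfl
  clear hY
  induction l with
  | nil => simpa using tmul_mem_tmulGr (symOne_mem (gr := gr)) symOne_mem
  | cons x l ih =>
    rw [symWord_cons, symCoproduct_symMul, wordDegree_cons, add_comm, symMulTwo_eq h x.2.2]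
    exact onTensorSquare_mem _ (symMul_mem' x.2.2) ih

theorem flip_symCoproduct (Y : GradedSym gr) :
    flip (gradedSymGr gr) (symCoproduct h Y) = symCoproduct h Y := by
  have hS := isInternal_gradedSymGr h
  suffices flip (gradedSymGr gr) ∘ₗ symCoproduct h = symCoproduct h from congr($this Y)
  refine linearMap_ext_symMul h ?_ fun i x hx Y hY => ?_
  · simp [flip_tmul hS symOne_mem symOne_mem]
  · simp only [LinearMap.comp_apply] at hY ⊢
    rw [symCoproduct_symMul, symMulTwo_eq h hx, flip_onTensorSquare hS (symMul_mem' hx), hY]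

theorem symCoproduct_symSign (k : ℤ) (Y : GradedSym gr) :
    symCoproduct h (symSign h k Y) =
      TensorProduct.map (symSign h k) (symSign h k) (symCoproduct h Y) := by
  have hS := isInternal_gradedSymGr h
  suffices symCoproduct h ∘ₗ symSign h k =
    TensorProduct.map (symSign h k) (symSign h k) ∘ₗ symCoproduct h from congr($this Y)
  refine linearMap_ext_homogeneous hS fun n Y hY => ?_
  rw [LinearMap.comp_apply, LinearMap.comp_apply, signMap_apply hS k hY, map_smul,
    map_signMap_signMap hS k (symCoproduct_mem h hY)]

/-- Multiplication by `x ⊗ 1 ⊗ 1 + 1 ⊗ x ⊗ 1 + 1 ⊗ 1 ⊗ x` in the tensor cube of the graded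
symmetric algebra, for `x` of degree `i`. -/
noncomputable def symMulThree (i : ℤ) (x : W) :
    GradedSym gr ⊗[K] (GradedSym gr ⊗[K] GradedSym gr) →ₗ[K]
      GradedSym gr ⊗[K] (GradedSym gr ⊗[K] GradedSym gr) :=
  TensorProduct.map (symMul x) LinearMap.id + TensorProduct.map (symSign h i) (symMulTwo h x)

theorem symMulThree_tmul (i : ℤ) (x : W) (Y : GradedSym gr)
    (t : GradedSym gr ⊗[K] GradedSym gr) :
    symMulThree h i x (Y ⊗ₜ t) = symMul x Y ⊗ₜ t + symSign h i Y ⊗ₜ symMulTwo h x t := rfl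

theorem symMulThree_assoc {i : ℤ} {x : W} (hx : x ∈ gr i)
    (s : GradedSym gr ⊗[K] GradedSym gr) (Z : GradedSym gr) :
    symMulThree h i x (TensorProduct.assoc K _ _ _ (s ⊗ₜ Z)) =
      TensorProduct.assoc K _ _ _ (symMulTwo h x s ⊗ₜ Z) +
        TensorProduct.assoc K _ _ _
          (TensorProduct.map (symSign h i) (symSign h i) s ⊗ₜ symMul x Z) := by
  induction s using TensorProduct.induction_on with
  | zero => simp
  | add s t hs ht => simp only [map_add, TensorProduct.add_tmul, hs, ht]; abel
  | tmul U V =>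
    simp [symMulTwo_eq h hx, onTensorSquare_tmul, symMulThree_tmul, TensorProduct.add_tmul,
      TensorProduct.tmul_add, add_assoc]

theorem map_id_symCoproduct_symMulTwo {i : ℤ} {x : W} (hx : x ∈ gr i)
    (t : GradedSym gr ⊗[K] GradedSym gr) :
    TensorProduct.map LinearMap.id (symCoproduct h) (symMulTwo h x t) =
      symMulThree h i x (TensorProduct.map LinearMap.id (symCoproduct h) t) := by
  induction t using TensorProduct.induction_on with
  | zero => simp
  | add s t hs ht => simp only [map_add, hs, ht]
  | tmul Y Z => simp [symMulTwo_eq h hx, onTensorSquare_tmul, symMulThree_tmul]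

theorem assoc_map_symCoproduct_id_symMulTwo {i : ℤ} {x : W} (hx : x ∈ gr i)
    (t : GradedSym gr ⊗[K] GradedSym gr) :
    TensorProduct.assoc K _ _ _
        (TensorProduct.map (symCoproduct h) LinearMap.id (symMulTwo h x t)) =
      symMulThree h i x (TensorProduct.assoc K _ _ _
        (TensorProduct.map (symCoproduct h) LinearMap.id t)) := by
  induction t using TensorProduct.induction_on with
  | zero => simp
  | add s t hs ht => simp only [map_add, hs, ht]
  | tmul Y Z =>
    rw [symMulTwo_eq h hx, onTensorSquare_tmul, TensorProduct.map_tmul, LinearMap.id_apply,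
      symMulThree_assoc h hx, map_add, map_add, TensorProduct.map_tmul, TensorProduct.map_tmul,
      symCoproduct_symMul, symCoproduct_symSign, LinearMap.id_apply, LinearMap.id_apply]

theorem coassoc_symCoproduct :
    (TensorProduct.assoc K (GradedSym gr) (GradedSym gr) (GradedSym gr)).toLinearMap ∘ₗ
      TensorProduct.map (symCoproduct h) LinearMap.id ∘ₗ symCoproduct h =
    TensorProduct.map LinearMap.id (symCoproduct h) ∘ₗ symCoproduct h := by
  refine linearMap_ext_symMul h (by simp) fun i x hx Y hY => ?_
  simp only [LinearMap.comp_apply, LinearEquiv.coe_coe] at hY ⊢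
  rw [symCoproduct_symMul, map_id_symCoproduct_symMulTwo h hx,
    assoc_map_symCoproduct_id_symMulTwo h hx, hY]

theorem onTensorSquare_symMul {i : ℤ} {x : W} (hx : x ∈ gr i) (Y : GradedSym gr) :
    onTensorSquare (isInternal_gradedSymGr h) i (symMul x) (symCoproduct h Y) =
      symCoproduct h (symMul x Y) := by
  rw [symCoproduct_symMul, symMulTwo_eq h hx]

theorem IsSymExtension.onTensorSquare_symCoproduct {F : GradedSym gr →ₗ[K] GradedSym gr}
    {G : W →ₗ[K] GradedSym gr →ₗ[K] GradedSym gr} {e : ℤ} (hF : IsSymExtension F G e)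
    (hG : ∀ i, ∀ x ∈ gr i, ∀ Y, onTensorSquare (isInternal_gradedSymGr h) (e + i) (G x)
      (symCoproduct h Y) = symCoproduct h (G x Y)) (Y : GradedSym gr) :
    onTensorSquare (isInternal_gradedSymGr h) e F (symCoproduct h Y) = symCoproduct h (F Y) := by
  have hS := isInternal_gradedSymGr h
  suffices onTensorSquare hS e F ∘ₗ symCoproduct h = symCoproduct h ∘ₗ F from congr($this Y)
  refine linearMap_ext_symMul h ?_ fun i x hx Y hY => ?_
  · simp [onTensorSquare_tmul, hF.one]
  · have commutator : F ∘ₗ symMul x - sgn K (e * i) • symMul x ∘ₗ F = G x :=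
      LinearMap.ext fun Y => sub_eq_iff_eq_add.2 (hF.mul hx Y)
    have := onTensorSquare_commutator hS hF.mem (symMul_mem' hx) (symCoproduct h Y)
    simp only [LinearMap.comp_apply] at hY ⊢
    rw [commutator, hY, eq_sub_iff_add_eq, hG i x hx] at this
    rw [hF.mul hx, symCoproduct_symMul, symMulTwo_eq h hx, ← this, map_add, map_smul,
      symCoproduct_symMul, symMulTwo_eq h hx]

end SymCoproduct

namespace ShiftedDGLie

variable {K W : Type*} [Field K] [AddCommGroup W] [Module K W] {gr : ℤ → Submodule K W}
  (S : ShiftedDGLie gr)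

theorem onTensorSquare_symD (Y : GradedSym gr) :
    onTensorSquare (isInternal_gradedSymGr S.graded) 1 S.symD (symCoproduct S.graded Y) =
      symCoproduct S.graded (S.symD Y) :=
  S.isSymExtension_symD.onTensorSquare_symCoproduct S.graded (fun i x hx Y => by
    rw [add_comm]
    exact onTensorSquare_symMul S.graded (S.D_mem _ x hx) Y) Y

theorem onTensorSquare_ad {i : ℤ} {x : W} (hx : x ∈ gr i) (Y : GradedSym gr) :
    onTensorSquare (isInternal_gradedSymGr S.graded) (i + 1) (S.ad x) (symCoproduct S.graded Y) =
      symCoproduct S.graded (S.ad x Y) :=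
  (S.isSymExtension_ad hx).onTensorSquare_symCoproduct S.graded (fun j y hy Y => by
    rw [add_right_comm]
    exact onTensorSquare_symMul S.graded (S.B_mem _ _ x hx y hy) Y) Y

theorem onTensorSquare_symB (Y : GradedSym gr) :
    onTensorSquare (isInternal_gradedSymGr S.graded) 1 S.symB (symCoproduct S.graded Y) =
      symCoproduct S.graded (S.symB Y) :=
  S.isSymExtension_symB.onTensorSquare_symCoproduct S.graded (fun i x hx Y => by
    rw [add_comm]
    exact S.onTensorSquare_ad hx Y) Y

end ShiftedDGLie

/-! ### The explicit formulas -/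

section Places

variable {n : ℕ}

theorem places_of_zero_mem {I : Finset (Fin (n + 1))} {J : Finset (Fin n)} (h0 : 0 ∈ I)
    (hJ : ∀ i : Fin n, i.succ ∈ I ↔ i ∈ J) : places I = 0 :: (places J).map Fin.succ := by
  rw [places, List.finRange_succ, List.filter_cons_of_pos (by simpa using h0), List.filter_map,
    places]
  simp [Function.comp_def, hJ]

theorem places_of_zero_notMem {I : Finset (Fin (n + 1))} {J : Finset (Fin n)} (h0 : 0 ∉ I)
    (hJ : ∀ i : Fin n, i.succ ∈ I ↔ i ∈ J) : places I = (places J).map Fin.succ := by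
  rw [places, List.finRange_succ, List.filter_cons_of_neg (by simpa using h0), List.filter_map,
    places]
  simp [Function.comp_def, hJ]

theorem places_empty : places (∅ : Finset (Fin n)) = [] := by simp [places]

theorem places_compl_zero :
    places ({0}ᶜ : Finset (Fin (n + 1))) = (List.finRange n).map Fin.succ := by
  rw [places_of_zero_notMem (J := Finset.univ) (by simp) (by simp [Fin.succ_ne_zero])]
  simp [places]

theorem places_compl_succ (i : Fin n) :
    places ({i.succ}ᶜ : Finset (Fin (n + 1))) = 0 :: (places {i}ᶜ).map Fin.succ :=
  places_of_zero_mem (by simp [(Fin.succ_ne_zero i).symm]) (by simp)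

theorem places_compl_zero_succ (j : Fin n) :
    places ({0, j.succ}ᶜ : Finset (Fin (n + 1))) = (places {j}ᶜ).map Fin.succ :=
  places_of_zero_notMem (by simp) (by simp [Fin.succ_ne_zero])

theorem places_compl_succ_succ (i j : Fin n) :
    places ({i.succ, j.succ}ᶜ : Finset (Fin (n + 1))) = 0 :: (places {i, j}ᶜ).map Fin.succ :=
  places_of_zero_mem (by simp [(Fin.succ_ne_zero _).symm]) (by simp)

/-- The subsets of `{0, …, n}` as the subsets of `{1, …, n}` with or without `0` added. -/
def finsetFinSuccEquiv (n : ℕ) :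
    Finset (Fin n) ⊕ Finset (Fin n) ≃ Finset (Fin (n + 1)) where
  toFun := Sum.elim (fun J => insert 0 (J.map (Fin.succEmb n))) fun J => J.map (Fin.succEmb n)
  invFun I :=
    if 0 ∈ I then .inl (Finset.univ.filter fun i => i.succ ∈ I)
    else .inr (Finset.univ.filter fun i => i.succ ∈ I)
  left_inv := by rintro (J | J) <;> simp
  right_inv I := by
    by_cases h0 : 0 ∈ I <;> simp only [h0, if_true, if_false, Sum.elim_inl, Sum.elim_inr] <;>
      ext i <;> cases i using Fin.cases <;> simp [h0]

theorem sum_finset_fin_succ {M : Type*} [AddCommMonoid M] (G : Finset (Fin (n + 1)) → M) :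
    ∑ I, G I = ∑ J : Finset (Fin n),
      (G (insert 0 (J.map (Fin.succEmb n))) + G (J.map (Fin.succEmb n))) := by
  rw [← (finsetFinSuccEquiv n).sum_comp, Fintype.sum_sum_type, Finset.sum_add_distrib]
  rfl

variable {K : Type*} [Field K]

theorem filter_lt_map_succ (i : Fin n) (l : List (Fin n)) :
    (l.map Fin.succ).filter (· < i.succ) = (l.filter (· < i)).map Fin.succ := by
  simp [List.filter_map, Function.comp_def]

theorem koszulScalar_map_succ (deg : Fin (n + 1) → ℤ) (l : List (Fin n)) :
    koszulScalar K deg (l.map Fin.succ) = koszulScalar K (fun i => deg i.succ) l := by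
  induction l with
  | nil => simp [koszulScalar_nil]
  | cons i l ih =>
    rw [List.map_cons, koszulScalar_cons, koszulScalar_cons, ih, filter_lt_map_succ, List.map_map]
    rfl

theorem koszulScalar_zero_cons_map_succ (deg : Fin (n + 1) → ℤ) (l : List (Fin n)) :
    koszulScalar K deg (0 :: l.map Fin.succ) = koszulScalar K (fun i => deg i.succ) l := by
  rw [koszulScalar_cons_of_lt _ (by simp [Fin.succ_pos]), koszulScalar_map_succ]

theorem koszulScalar_map_succ_append_zero (deg : Fin (n + 1) → ℤ) (u v : List (Fin n)) :
    koszulScalar K deg (u.map Fin.succ ++ 0 :: v.map Fin.succ) =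
      sgn K (deg 0 * (u.map fun i => deg i.succ).sum) *
        koszulScalar K (fun i => deg i.succ) (u ++ v) := by
  induction u with
  | nil => simp [koszulScalar_zero_cons_map_succ]
  | cons i u ih =>
    have filter_lt : (u.map Fin.succ ++ 0 :: v.map Fin.succ).filter (· < i.succ) =
        (u.filter (· < i)).map Fin.succ ++ 0 :: (v.filter (· < i)).map Fin.succ := by
      rw [List.filter_append, List.filter_cons_of_pos (by simp [Fin.succ_pos]),
        filter_lt_map_succ, filter_lt_map_succ]
    rw [List.map_cons, List.cons_append, koszulScalar_cons, ih, filter_lt, List.cons_append,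
      koszulScalar_cons, List.filter_append, ← mul_assoc, ← mul_assoc, ← sgn_add, ← sgn_add]
    congr 2
    simp only [List.map_append, List.map_cons, List.sum_append, List.sum_cons, List.map_map,
      Function.comp_def]
    ring

end Places

section Explicit

variable {K : Type*} [Field K] {W : Type*} [AddCommGroup W] [Module K W]
  {gr : ℤ → Submodule K W} {n : ℕ}

theorem symWord_map_finRange_succ (X : Fin (n + 1) → Homog gr) :
    symWord ((List.finRange (n + 1)).map X) =
      symMul (gr := gr) (X 0).2 (symWord ((List.finRange n).map fun i => X i.succ)) := by
  rw [List.finRange_succ, List.map_cons, symWord_cons, List.map_map]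
  rfl

theorem sgn_smul_symMul_koszulScalar (h : DirectSum.IsInternal gr) (X : Fin (n + 1) → Homog gr)
    (u v : List (Fin n)) {e : ℤ} {y : W} (hy : y ∈ gr ((u.map fun i => degs X i.succ).sum + e)) :
    sgn K (e * degs X 0) • symMul (gr := gr) (X 0).2
        (koszulScalar K (fun i => degs X i.succ) (u ++ v) •
          symMul y (symWord (v.map fun i => X i.succ))) =
      koszulScalar K (degs X) (u.map Fin.succ ++ 0 :: v.map Fin.succ) •
        symMul y (symWord ((0 :: v.map Fin.succ).map X)) := by
  rw [koszulScalar_map_succ_append_zero, map_smul, symMul_comm h (i := degs X 0) (X 0).2.2 hy,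
    List.map_cons, symWord_cons, List.map_map, smul_smul, smul_smul, mul_add, sgn_add,
    mul_comm _ e]
  congr 1
  linear_combination (sgn K (degs X 0 * (u.map fun i => degs X i.succ).sum) *
    koszulScalar K (fun i => degs X i.succ) (u ++ v)) * sgn_mul_sgn_self (R := K) (e * degs X 0)

theorem IsSymExtension.apply_symWord (h : DirectSum.IsInternal gr)
    {F : GradedSym gr →ₗ[K] GradedSym gr} {f : W →ₗ[K] W} {e : ℤ}
    (hF : IsSymExtension F (symMul ∘ₗ f) e) (hf : ∀ i, ∀ x ∈ gr i, f x ∈ gr (i + e))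
    (X : Fin n → Homog gr) :
    F (symWord ((List.finRange n).map X)) = ∑ i, koszulScalar K (degs X) (i :: places {i}ᶜ) •
      symMul (f (X i).2) (symWord ((places {i}ᶜ).map X)) := by
  induction n with
  | zero => exact hF.one
  | succ n ih =>
    rw [symWord_map_finRange_succ, hF.mul (X 0).2.2, ih, Fin.sum_univ_succ, places_compl_zero,
      koszulScalar_zero_cons_map_succ, koszulScalar_of_pairwise _ (List.pairwise_lt_finRange n),
      one_smul, List.map_map, map_sum, Finset.smul_sum]
    congr 1
    refine Finset.sum_congr rfl fun i _ => ?_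
    rw [places_compl_succ]
    exact sgn_smul_symMul_koszulScalar h X [i] (places {i}ᶜ)
      (by simpa [degs] using hf _ _ (X i.succ).2.2)

theorem ShiftedDGLie.symB_symWord (S : ShiftedDGLie gr) (X : Fin n → Homog gr) :
    S.symB (symWord ((List.finRange n).map X)) = ∑ i, ∑ j with i < j,
      koszulScalar K (degs X) (i :: j :: places {i, j}ᶜ) •
        symMul (S.B (X i).2 (X j).2) (symWord ((places {i, j}ᶜ).map X)) := by
  induction n with
  | zero => exact S.isSymExtension_symB.one
  | succ n ih =>
    have ad_symWord := (S.isSymExtension_ad (X 0).2.2).apply_symWord S.graded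
      (fun j y hy => by
        rw [← add_assoc, add_comm j]
        exact S.B_mem _ _ _ (X 0).2.2 _ hy) fun i => X i.succ
    rw [symWord_map_finRange_succ, S.isSymExtension_symB.mul (X 0).2.2, ih, ad_symWord,
      Fin.sum_univ_succ, map_sum, Finset.smul_sum]
    simp only [Finset.sum_filter, Fin.sum_univ_succ (n := n), lt_self_iff_false, if_false,
      Fin.succ_pos, if_true, Fin.not_lt_zero, Fin.succ_lt_succ_iff, zero_add, map_sum,
      Finset.smul_sum]
    congr 1
    · refine Finset.sum_congr rfl fun j _ => ?_
      rw [places_compl_zero_succ, ← List.map_cons, koszulScalar_zero_cons_map_succ, List.map_map]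
      rfl
    · refine Finset.sum_congr rfl fun i _ => Finset.sum_congr rfl fun j _ => ?_
      split_ifs
      · rw [places_compl_succ_succ]
        exact sgn_smul_symMul_koszulScalar S.graded X [i, j] (places {i, j}ᶜ)
          (by simpa [degs] using S.B_mem _ _ _ (X i.succ).2.2 _ (X j.succ).2.2)
      · simp

theorem symCoproduct_symWord (h : DirectSum.IsInternal gr) (X : Fin n → Homog gr) :
    symCoproduct h (symWord ((List.finRange n).map X)) = ∑ I : Finset (Fin n),
      koszulScalar K (degs X) (places I ++ places Iᶜ) •
        (symWord ((places I).map X) ⊗ₜ[K] symWord ((places Iᶜ).map X)) := by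
  induction n with
  | zero =>
    rw [Fintype.sum_eq_single ∅ (fun I hI => absurd (Subsingleton.elim _ _) hI)]
    exact (symCoproduct_symOne h).trans (by simp [places, koszulScalar_nil])
  | succ n ih =>
    rw [symWord_map_finRange_succ, symCoproduct_symMul, ih, map_sum, sum_finset_fin_succ]
    refine Finset.sum_congr rfl fun J _ => ?_
    rw [places_of_zero_mem (I := insert 0 (J.map (Fin.succEmb n))) (J := J) (by simp) (by simp),
      places_of_zero_notMem (I := (insert 0 (J.map (Fin.succEmb n)))ᶜ) (J := Jᶜ) (by simp)
        (by simp [Fin.succ_ne_zero]),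
      places_of_zero_mem (I := (J.map (Fin.succEmb n))ᶜ) (J := Jᶜ) (by simp) (by simp),
      places_of_zero_notMem (I := J.map (Fin.succEmb n)) (J := J) (by simp) (by simp),
      koszulScalar_map_succ_append_zero, List.cons_append, ← List.map_append,
      koszulScalar_zero_cons_map_succ, map_smul, symMulTwo_eq h (X 0).2.2, onTensorSquare_tmul,
      signMap_apply _ _ (symWord_mem _), wordDegree_map, smul_add, ← TensorProduct.smul_tmul',
      smul_smul, mul_comm (koszulScalar _ _ _), List.map_cons, List.map_cons, symWord_cons,
      symWord_cons, List.map_map, List.map_map]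
    rfl

end Explicit

/-! ### The coalgebra `S⁺` -/

section SymPlus

variable {K : Type*} [Field K] {W M : Type*} [AddCommGroup W] [Module K W] [AddCommGroup M]
  [Module K M] {gr : ℤ → Submodule K W}

theorem linearExt_symProdOf_toSymPlus (h : DirectSum.IsInternal gr) {F : GradedSym gr →ₗ[K] M}
    (one : F symOne = 0) {f : (Σ n : ℕ, Fin n → Homog gr) → M}
    (hF : ∀ X, F (symWord ((List.finRange X.1).map X.2)) = f X) (Y : GradedSym gr) :
    linearExt (K := K) (fun X : (Σ n : ℕ, Fin n → Homog gr) =>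
      symProdOf X.2 (List.finRange X.1)) f (toSymPlus Y) = F Y := by
  rw [linearExt_eq (span_symProdOf h) (symPlusLift F one) fun X => ?_, symPlusLift_toSymPlus]
  rw [← toSymPlus_symWord, symPlusLift_toSymPlus, hF]

theorem symProd_cons_letters {n : ℕ} (x : W) (X : Fin n → Homog gr) (l : List (Fin n)) :
    symProd gr (x :: letters X l) = toSymPlus (symMul x (symWord (l.map X))) := by
  rw [symProd, tens_cons, tens_letters]
  rfl

section ExtendOne

variable (h : DirectSum.IsInternal gr) {F : GradedSym gr →ₗ[K] GradedSym gr} {f : W →ₗ[K] W}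
  {e : ℤ} (hF : IsSymExtension F (symMul ∘ₗ f) e) (hf : ∀ i, ∀ x ∈ gr i, f x ∈ gr (i + e))

include h hF hf

theorem IsSymExtension.toSymPlus_symWord {n : ℕ} (X : Fin n → Homog gr) :
    toSymPlus (F (symWord ((List.finRange n).map X))) = extendOneFormula f X := by
  rw [hF.apply_symWord h hf, map_sum]
  simp only [extendOneFormula, koszulSign_smul (K := K), symProd_cons_letters, map_smul]

theorem extendOne_toSymPlus (Y : GradedSym gr) :
    extendOne gr f (toSymPlus Y) = toSymPlus (F Y) :=
  linearExt_symProdOf_toSymPlus h (F := toSymPlus ∘ₗ F) (by simp [hF.one])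
    (fun X => hF.toSymPlus_symWord h hf X.2) Y

theorem extendOne_symProdOf {n : ℕ} (X : Fin n → Homog gr) :
    extendOne gr f (symProdOf X (List.finRange n)) = extendOneFormula f X := by
  rw [← ABHomotopy.toSymPlus_symWord, extendOne_toSymPlus h hF hf, hF.toSymPlus_symWord h hf]

end ExtendOne

namespace ShiftedDGLie

variable (S : ShiftedDGLie gr)

theorem toSymPlus_symB_symWord {n : ℕ} (X : Fin n → Homog gr) :
    toSymPlus (S.symB (symWord ((List.finRange n).map X))) = extendTwoFormula S.B X := by
  rw [S.symB_symWord]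
  simp only [extendTwoFormula, koszulSign_smul (K := K), symProd_cons_letters, map_smul, map_sum]

theorem extendTwo_toSymPlus (Y : GradedSym gr) :
    extendTwo gr S.B (toSymPlus Y) = toSymPlus (S.symB Y) :=
  linearExt_symProdOf_toSymPlus S.graded (F := toSymPlus ∘ₗ S.symB)
    (by simp [S.isSymExtension_symB.one]) (fun X => S.toSymPlus_symB_symWord X.2) Y

theorem extendTwo_symProdOf {n : ℕ} (X : Fin n → Homog gr) :
    extendTwo gr S.B (symProdOf X (List.finRange n)) = extendTwoFormula S.B X := by
  rw [← toSymPlus_symWord, S.extendTwo_toSymPlus, S.toSymPlus_symB_symWord]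

end ShiftedDGLie

variable (h : DirectSum.IsInternal gr)

include h

theorem map_toSymPlus_symCoproduct_symWord {n : ℕ} (X : Fin n → Homog gr) :
    TensorProduct.map toSymPlus toSymPlus (symCoproduct h (symWord ((List.finRange n).map X))) =
      coproductFormula X := by
  rw [symCoproduct_symWord, map_sum, coproductFormula, Finset.sum_filter]
  refine Finset.sum_congr rfl fun I _ => ?_
  have symProdOf_nil : symProdOf X [] = 0 := toSymPlus_symWord X [] ▸ toSymPlus_symOne
  rw [map_smul, TensorProduct.map_tmul, koszulSign_smul (K := K), toSymPlus_symWord,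
    toSymPlus_symWord]
  split_ifs with hI
  · rfl
  · rw [not_and_or, not_not, not_not] at hI
    rcases hI with hI | hI <;> simp [hI, places_empty, symProdOf_nil]

theorem coproduct_toSymPlus (Y : GradedSym gr) :
    coproduct gr (toSymPlus Y) = TensorProduct.map toSymPlus toSymPlus (symCoproduct h Y) :=
  linearExt_symProdOf_toSymPlus h (F := TensorProduct.map toSymPlus toSymPlus ∘ₗ symCoproduct h)
    (by simp) (fun X => map_toSymPlus_symCoproduct_symWord h X.2) Y

theorem coproduct_symProdOf {n : ℕ} (X : Fin n → Homog gr) :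
    coproduct gr (symProdOf X (List.finRange n)) = coproductFormula X := by
  rw [← toSymPlus_symWord, coproduct_toSymPlus h, map_toSymPlus_symCoproduct_symWord]

theorem coproduct_mem {n : ℤ} {X : SymPlus gr} (hX : X ∈ symGr gr n) :
    coproduct gr X ∈ tmulGr (symGr gr) n := by
  rw [symGr_eq_map_toSymPlus] at hX
  obtain ⟨Y, hY, rfl⟩ := hX
  rw [coproduct_toSymPlus h]
  suffices tmulGr (gradedSymGr gr) n ≤
    (tmulGr (symGr gr) n).comap (TensorProduct.map toSymPlus toSymPlus) from
    this (symCoproduct_mem h hY)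
  refine tmulGr_le ?_
  rintro i j rfl Y hY Z hZ
  exact tmul_mem_tmulGr (toSymPlus_mem hY) (toSymPlus_mem hZ)

theorem flip_coproduct : flip (symGr gr) ∘ₗ coproduct gr = coproduct gr := by
  refine linearMap_ext_toSymPlus (LinearMap.ext fun Y => ?_)
  simp only [LinearMap.comp_apply, coproduct_toSymPlus h]
  rw [flip_map (isInternal_gradedSymGr h) (isInternal_symGr h) fun i Y hY => toSymPlus_mem hY,
    flip_symCoproduct h]

theorem coassoc_coproduct :
    (TensorProduct.assoc K (SymPlus gr) (SymPlus gr) (SymPlus gr)).toLinearMap ∘ₗ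
      TensorProduct.map (coproduct gr) LinearMap.id ∘ₗ coproduct gr =
    TensorProduct.map LinearMap.id (coproduct gr) ∘ₗ coproduct gr :=
  linearMap_ext_toSymPlus (coassoc_comp_of_coassoc (LinearMap.ext (coproduct_toSymPlus h))
    (coassoc_symCoproduct h))

theorem isCoderivation_of_toSymPlus {F : GradedSym gr →ₗ[K] GradedSym gr}
    {G : SymPlus gr →ₗ[K] SymPlus gr} (hG : ∀ Y, G (toSymPlus Y) = toSymPlus (F Y))
    (hdeg : ∀ n, ∀ Y ∈ gradedSymGr gr n, F Y ∈ gradedSymGr gr (n + 1))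
    (hF : ∀ Y, onTensorSquare (isInternal_gradedSymGr h) 1 F (symCoproduct h Y) =
      symCoproduct h (F Y)) : IsCoderivation gr G := by
  constructor
  · intro i X hX
    rw [symGr_eq_map_toSymPlus] at hX ⊢
    obtain ⟨Y, hY, rfl⟩ := hX
    exact ⟨F Y, hdeg _ _ hY, (hG Y).symm⟩
  · refine linearMap_ext_toSymPlus (LinearMap.ext fun Y => ?_)
    simp only [LinearMap.comp_apply, hG, coproduct_toSymPlus h, ← hF]
    generalize symCoproduct h Y = t
    rw [signTwist_eq (isInternal_symGr h)]
    induction t using TensorProduct.induction_on with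
    | zero => simp
    | add s t hs ht => simp only [map_add, hs, ht]
    | tmul Y Z =>
      simp only [onTensorSquare_tmul, TensorProduct.map_tmul, LinearMap.add_apply, map_add, hG,
        LinearMap.comp_apply, LinearMap.id_apply, signMap_toSymPlus h]

end SymPlus

namespace DiffABAlgebra

variable {K A : Type*} [Field K] [AddCommGroup A] [Module K A] {a b : ℤ}
  (P : DiffABAlgebra K A a b)

/-- `H[a-b]` with the operators `D` and `ℓ''_2`. -/
noncomputable def shiftedDGLie : ShiftedDGLie P.gr'' where
  graded := P.isInternal_gr''
  D := P.D
  B := P.ell2''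
  D_mem _ _ hX := P.D_mem hX
  B_mem _ _ _ hX _ hY := P.ell2''_mem hX hY
  D_D := P.D_D
  B_comm _ _ _ hX _ hY := P.ell2''_comm hX hY
  jacobi _ _ _ _ hX _ hY _ hZ := P.ell2''_jacobi hX hY hZ
  D_B _ _ hX Y := P.D_ell2'' hX Y

theorem m_toSymPlus (Y : GradedSym P.gr'') :
    P.m (toSymPlus Y) = toSymPlus (P.shiftedDGLie.symD Y) :=
  extendOne_toSymPlus P.isInternal_gr'' P.shiftedDGLie.isSymExtension_symD P.shiftedDGLie.D_mem Y

theorem l''_toSymPlus (Y : GradedSym P.gr'') :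
    P.l'' (toSymPlus Y) = toSymPlus (P.shiftedDGLie.symB Y) :=
  P.shiftedDGLie.extendTwo_toSymPlus Y

theorem wellDefined : P.WellDefined where
  graded := P.isInternal_gr''
  D_apply n α := by rw [P.D_eq, P.packetD_packetOf]
  ell2_apply p q α β := by rw [P.ell2_eq]; exact P.packetBr_packetOf α β
  ell2'_apply x' X hX Y := by
    rw [ell2', signTwist_eq P.isInternal_gr', LinearMap.comp_apply, signMap_apply _ _ hX, map_smul,
      LinearMap.smul_apply, negOnePow_smul (R := K)]
  ell2''_apply x'' X hX Y := by
    rw [ell2'', signTwist_eq P.isInternal_gr'', LinearMap.comp_apply, signMap_apply _ _ hX,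
      map_smul, LinearMap.smul_apply, negOnePow_smul (R := K), one_mul]
  m_apply _ X :=
    extendOne_symProdOf P.isInternal_gr'' P.shiftedDGLie.isSymExtension_symD
      P.shiftedDGLie.D_mem X
  l''_apply _ X := P.shiftedDGLie.extendTwo_symProdOf X

theorem isCoderivation_m : IsCoderivation P.gr'' P.m :=
  isCoderivation_of_toSymPlus P.isInternal_gr'' P.m_toSymPlus
    P.shiftedDGLie.isSymExtension_symD.mem P.shiftedDGLie.onTensorSquare_symD

theorem isCoderivation_l'' : IsCoderivation P.gr'' P.l'' :=
  isCoderivation_of_toSymPlus P.isInternal_gr'' P.l''_toSymPlus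
    P.shiftedDGLie.isSymExtension_symB.mem P.shiftedDGLie.onTensorSquare_symB

theorem m_comp_m : P.m ∘ₗ P.m = 0 :=
  linearMap_ext_toSymPlus (LinearMap.ext fun Y => by
    simp [m_toSymPlus, ShiftedDGLie.symD_symD])

theorem l''_comp_l'' : P.l'' ∘ₗ P.l'' = 0 :=
  linearMap_ext_toSymPlus (LinearMap.ext fun Y => by
    simp [l''_toSymPlus, ShiftedDGLie.symB_symB])

theorem m_comp_l''_add_l''_comp_m : P.m ∘ₗ P.l'' + P.l'' ∘ₗ P.m = 0 :=
  linearMap_ext_toSymPlus (LinearMap.ext fun Y => by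
    simp [m_toSymPlus, l''_toSymPlus, ← map_add, ShiftedDGLie.symD_symB])

theorem isCoderivation_Q : IsCoderivation P.gr'' P.Q where
  degree_one i X hX :=
    add_mem (P.isCoderivation_m.degree_one i X hX) (P.isCoderivation_l''.degree_one i X hX)
  coleibniz := by
    rw [Q, LinearMap.comp_add, ← P.isCoderivation_m.coleibniz, ← P.isCoderivation_l''.coleibniz,
      TensorProduct.map_add_left, TensorProduct.map_add_right, ← LinearMap.add_comp]
    congr 1
    abel

theorem Q_comp_Q : P.Q ∘ₗ P.Q = 0 := by
  rw [Q, LinearMap.add_comp, LinearMap.comp_add, LinearMap.comp_add, P.m_comp_m, P.l''_comp_l'',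
    zero_add, add_zero, P.m_comp_l''_add_l''_comp_m]

theorem isLInfinity : IsLInfinity P.gr'' P.Q where
  graded := isInternal_symGr P.isInternal_gr''
  coproduct_apply _ := coproduct_symProdOf P.isInternal_gr''
  coproduct_degree _ _ := coproduct_mem P.isInternal_gr''
  cocommutative := flip_coproduct P.isInternal_gr''
  coassociative := coassoc_coproduct P.isInternal_gr''
  coderivation := P.isCoderivation_Q
  sq_zero := P.Q_comp_Q

end DiffABAlgebra

end ABHomotopy

theorem proposition4p3 {K A : Type*} [Field K] [AddCommGroup A] [Module K A] (a b : ℤ)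
    (P : ABHomotopy.DiffABAlgebra K A a b) :
    P.WellDefined ∧
    -- degrees: the bracket and `D` have degree one on `H[a-b]`
    (∀ (x y : ℤ), ∀ X ∈ P.gr'' x, ∀ Y ∈ P.gr'' y, P.ell2'' X Y ∈ P.gr'' (x + y + 1)) ∧
    (∀ (x : ℤ), ∀ X ∈ P.gr'' x, P.D X ∈ P.gr'' (x + 1)) ∧
    -- (i) graded symmetry
    (∀ (x y : ℤ), ∀ X ∈ P.gr'' x, ∀ Y ∈ P.gr'' y,
      P.ell2'' X Y = (x * y).negOnePow • P.ell2'' Y X) ∧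
    -- (ii) graded Jacobi identity
    (∀ (x y z : ℤ), ∀ X ∈ P.gr'' x, ∀ Y ∈ P.gr'' y, ∀ Z ∈ P.gr'' z,
      (x * z).negOnePow • P.ell2'' (P.ell2'' X Y) Z +
        (y * x).negOnePow • P.ell2'' (P.ell2'' Y Z) X +
        (z * y).negOnePow • P.ell2'' (P.ell2'' Z X) Y = 0) ∧
    -- (iii) compatibility with `D`
    (∀ (x : ℤ), ∀ X ∈ P.gr'' x, ∀ Y : P.H,
      P.D (P.ell2'' X Y) =
        -P.ell2'' (P.D X) Y + (1 + x).negOnePow • P.ell2'' X (P.D Y)) ∧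
    -- `m` and `ℓ''` are coderivations of square zero
    ABHomotopy.IsCoderivation P.gr'' P.m ∧ P.m ∘ₗ P.m = 0 ∧
    ABHomotopy.IsCoderivation P.gr'' P.l'' ∧ P.l'' ∘ₗ P.l'' = 0 ∧
    -- `(S⁺(H[a-b]), Δ, Q)` is an `L∞` algebra; in particular `Q` squares to zero
    ABHomotopy.IsLInfinity P.gr'' P.Q := by
  refine ⟨P.wellDefined, P.shiftedDGLie.B_mem, P.shiftedDGLie.D_mem, fun x y X hX Y hY => ?_,
    fun x y z X hX Y hY Z hZ => ?_, fun x X hX Y => ?_, P.isCoderivation_m, P.m_comp_m,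
    P.isCoderivation_l'', P.l''_comp_l'', P.isLInfinity⟩
  · rw [ABHomotopy.negOnePow_smul (R := K)]
    exact P.ell2''_comm hX hY
  · simp only [ABHomotopy.negOnePow_smul (R := K)]
    exact P.ell2''_jacobi hX hY hZ
  · rw [ABHomotopy.negOnePow_smul (R := K)]
    exact P.D_ell2'' hX Y
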